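/- Let $k$ be an algebraically closed field of characteristic $p>0$, let $d_1,\dots,d_l$ be integers with $0\le d_\sigma\le p-1$ and $\sum_\sigma d_\sigma(d_\sigma+1)/2\ge 2$, and put $$\mathbf I=\{(\sigma,i): 1\le\sigma\le l,\ 0\le i\le d_\sigma\},\qquad \mathbf I^*=\{(\sigma,i)\in\mathbf I: i\ge 1\},\qquad N=|\mathbf I|.$$ Let $\mathbb A^N=\operatorname{Spec}k[x_i^{(\sigma)}:(\sigma,i)\in\mathbf I]$ with the derivation $\partial=\sum_\sigma\sum_{i=1}^{d_\sigma}x_i^{(\sigma)}\,\partial/\partial x_{i-1}^{(\sigma)}$, and let $\mathcal F$ be the foliation generated by $\partial$. Let $f\colon Y\to\mathbb A^N$ be the (schematic) weighted blow-up in which $x_i^{(\sigma)}$ has weight $i$ for $i\ge1$: $Y=\operatorname{Proj}\bigoplus_{m\ge0}I_mt^m$, where $I_m$ is the ideal generated by the monomials $\prod (x_i^{(\sigma)})^{e_{\sigma,i}}$ with $\sum i\,e_{\sigma,i}\ge m$. Let $E=f^{-1}\big(V(x_i^{(\sigma)}:(\sigma,i)\in\mathbf I^*)\big)$ be its exceptional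 divisor. Let $q\colon Y\to W=Y/f^*\mathcal F$ be the quotient by the pulled back foliation: $q$ is a homeomorphism and $\mathcal O_W\subseteq\mathcal O_Y$ is the subsheaf of functions which, as rational functions, are killed by $\partial$. Let $\widetilde E=q(E)$, with its reduced structure. For non-empty $\mathscr S\subseteq\mathbf I^*$ let $\gcd(\mathscr S)=\gcd\{i:(\sigma,i)\in\mathscr S\text{ for some }\sigma\}$. Let $Q^\circ_{\mathscr S}=q(P^\circ_{\mathscr S})$, where $P^\circ_{\mathscr S}\subseteq E$ is the set of points of $E$ at which the homogeneous coordinate $U_i^{(\sigma)}$ (the class of $x_i^{(\sigma)}t^i$) is non-zero for $(\sigma,i)\in\mathscr S$ and zero for $(\sigma,i)\in\mathbf I^*\setminus\mathscr S$. Definition. Let $O$ be a normal $\mathbb Q$-factorial Noetherian local $k$-algebra of dimension $t$ and let $B\subset\operatorname{Spec}O$ be a prime divisor. For $n\ge1$ and $a_1,\dots,a_t\in\mathbb Z$, the pair $(\operatorname{Spec}O,B)$ is a cyclic quotient singularity of type $\frac1n(a_1,\dots,a_t)$, with $B$ corresponding to the index $i_0$, if there is a $k$-linear action of $\mu_n$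 on $R=k[[x_1,\dots,x_t]]$ whose fixed locus contains the closed point, for which each $x_i$ is an eigenfunction of weight $a_i\bmod n$, together with a $k$-algebra isomorphism $R^{\mu_n}\cong\widehat O$ under which the ideal $x_{i_0}R\cap R^{\mu_n}$ corresponds to the extension to $\widehat O$ of the ideal of $B$. Proposition. Let $\mathscr S\subseteq\mathbf I^*$ be non-empty and let $w\in Q^\circ_{\mathscr S}$ be a closed point of $W$. 1. If $\gcd(\mathscr S)=1$, then $\mathcal O_{W,w}$ is a regular local ring. 2. If $\gcd(\mathscr S)\ne1$, then $p\nmid\gcd(\mathscr S)$ and, for every $(\sigma,i)\in\mathscr S$, the pair $(\operatorname{Spec}\mathcal O_{W,w},\widetilde E)$ is a (tame) cyclic quotient singularity of type $$\frac1{\gcd(\mathscr S)}\Big(v_j^{(\pi)}\ \Big|\ (\pi,j)\in\mathbf I\Big),\qquad v_j^{(\pi)}=\begin{cases}p&\text{if }(\pi,j)=(\sigma,i-1),\\ 1&\text{if }(\pi,j)=(\sigma,i),\\ -j&\text{otherwise},\end{cases}$$ with $\widetilde E$ corresponding to the index $(\sigma,i)$. -/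

import Mathlib

open CategoryTheory AlgebraicGeometry TopologicalSpace Opposite

noncomputable section

namespace AlphaP

universe u

/-! ### Index sets, the derivation, and the weighted filtration -/

/-- The indices `(σ, i)` with `0 ≤ i ≤ d σ` of the coordinates of affine space. -/
abbrev Idx {l : ℕ} (d : Fin l → ℕ) : Type := Σ σ : Fin l, Fin (d σ + 1)

/-- The indices `(σ, i)` with `1 ≤ i ≤ d σ`. -/
abbrev PosIdx {l : ℕ} (d : Fin l → ℕ) : Type := {v : Idx d // 1 ≤ (v.2 : ℕ)}

section Geometry

variable (k : Type u) [Field k] {l : ℕ} (d : Fin l → ℕ)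

/-- The coordinate ring of the affine space with coordinates `x_i^(σ)`, `(σ, i) ∈ Idx d`. -/
abbrev Coord : Type u := MvPolynomial (Idx d) k

/-- The derivation `∑_σ ∑_{1 ≤ i ≤ d σ} x_i^(σ) ∂/∂x_{i-1}^(σ)`: it sends `x_i^(σ)` to
`x_{i+1}^(σ)` if `i < d σ`, and `x_{d σ}^(σ)` to `0`. -/
def del : Derivation k (Coord k d) (Coord k d) :=
  MvPolynomial.mkDerivation k fun v =>
    if h : (v.2 : ℕ) + 1 < d v.1 + 1 then MvPolynomial.X ⟨v.1, ⟨(v.2 : ℕ) + 1, h⟩⟩ else 0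

/-- The weight `∑ i * e (σ, i)` of an exponent vector `e`. -/
def wt (e : Idx d →₀ ℕ) : ℕ := e.sum fun v n => n * (v.2 : ℕ)

lemma wt_add (e f : Idx d →₀ ℕ) : wt d (e + f) = wt d e + wt d f :=
  Finsupp.sum_add_index' (by simp) (by intros; ring)

/-- The degree `m` part of the (decreasing) Rees algebra generated by the `x_i^(σ)` placed in
degree `i`, for `i ≥ 1`: the ideal generated by the monomials of weight at least `m`. -/
def weightIdeal (m : ℕ) : Ideal (Coord k d) :=
  Ideal.span {f | ∃ e : Idx d →₀ ℕ, m ≤ wt d e ∧ f = MvPolynomial.monomial e 1}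

lemma weightIdeal_zero : weightIdeal k d 0 = ⊤ := by
  rw [Ideal.eq_top_iff_one]
  exact Ideal.subset_span ⟨0, Nat.zero_le _, rfl⟩

lemma weightIdeal_mul {m n : ℕ} {f g : Coord k d} (hf : f ∈ weightIdeal k d m)
    (hg : g ∈ weightIdeal k d n) : f * g ∈ weightIdeal k d (m + n) := by
  have h : weightIdeal k d m * weightIdeal k d n ≤ weightIdeal k d (m + n) := by
    rw [weightIdeal, weightIdeal, Ideal.span_mul_span', Ideal.span_le]
    rintro _ ⟨_, ⟨e, he, rfl⟩, _, ⟨e', he', rfl⟩, rfl⟩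
    refine Ideal.subset_span ⟨e + e', ?_, by simp [MvPolynomial.monomial_mul]⟩
    rw [wt_add]; exact add_le_add he he'
  exact h (Ideal.mul_mem_mul hf hg)

lemma X_mem_weightIdeal (v : Idx d) : MvPolynomial.X v ∈ weightIdeal k d (v.2 : ℕ) :=
  Ideal.subset_span ⟨Finsupp.single v 1, by simp [wt], rfl⟩

/-- The Rees algebra `⨁_m (weightIdeal m) t^m`, as a subring of the polynomials in `t` over the
coordinate ring. -/
def rees : Subring (Polynomial (Coord k d)) where
  carrier := {F | ∀ m, F.coeff m ∈ weightIdeal k d m}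
  mul_mem' {F G} hF hG m := by
    rw [Polynomial.coeff_mul]
    refine Ideal.sum_mem _ fun x hx => ?_
    rw [← Finset.HasAntidiagonal.mem_antidiagonal.1 hx]
    exact weightIdeal_mul k d (hF _) (hG _)
  add_mem' {F G} hF hG m := by
    rw [Polynomial.coeff_add]
    exact Ideal.add_mem _ (hF m) (hG m)
  zero_mem' m := by simp
  one_mem' m := by
    rw [Polynomial.coeff_one]
    split_ifs with h
    · subst h; rw [weightIdeal_zero]; trivial
    · exact Ideal.zero_mem _
  neg_mem' {F} hF m := by
    rw [Polynomial.coeff_neg]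
    exact neg_mem (hF m)

/-- The element `f t^m` of the Rees algebra. -/
def reesMonomial (m : ℕ) (f : Coord k d) (hf : f ∈ weightIdeal k d m) : rees k d :=
  ⟨Polynomial.monomial m f, fun n => by
    rw [Polynomial.coeff_monomial]
    split_ifs with h
    · exact h ▸ hf
    · exact Ideal.zero_mem _⟩

/-- The homogeneous elements of degree `m` of the Rees algebra. -/
def reesGrading (m : ℕ) : AddSubgroup (rees k d) where
  carrier := {F | ∀ n, n ≠ m → (F : Polynomial (Coord k d)).coeff n = 0}
  add_mem' {F G} hF hG n hn := by simp [hF n hn, hG n hn]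
  zero_mem' n _ := by simp
  neg_mem' {F} hF n hn := by simp [hF n hn]

/-- The homogeneous component of degree `m` of an element of the Rees algebra. -/
def reesComponent (F : rees k d) (m : ℕ) : reesGrading k d m :=
  ⟨reesMonomial k d m ((F : Polynomial (Coord k d)).coeff m) (F.2 m), fun n hn => by
    simp [reesMonomial, Polynomial.coeff_monomial, hn.symm]⟩

lemma reesComponent_coe (F : rees k d) (m : ℕ) :
    ((reesComponent k d F m : rees k d) : Polynomial (Coord k d)) =
      Polynomial.monomial m ((F : Polynomial (Coord k d)).coeff m) := rfl

lemma coeff_coeAddMonoidHom (n : ℕ) (x : DirectSum ℕ fun m => reesGrading k d m) :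
    ((DirectSum.coeAddMonoidHom (reesGrading k d) x : rees k d) :
      Polynomial (Coord k d)).coeff n = ((x n : rees k d) : Polynomial (Coord k d)).coeff n := by
  induction x using DirectSum.induction_on with
  | zero => simp
  | of i x =>
    rw [DirectSum.coeAddMonoidHom_of]
    by_cases h : i = n
    · subst h; rw [DirectSum.of_eq_same]
    · rw [DirectSum.of_eq_of_ne _ _ _ (Ne.symm h)]
      simpa using x.2 n (Ne.symm h)
  | add x y hx hy =>
    rw [map_add, DirectSum.add_apply]
    simp [hx, hy]

instance : GradedRing (reesGrading k d) where
  one_mem n hn := by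
    simp [Polynomial.coeff_one, hn]
  mul_mem i j F G hF hG n hn := by
    rw [MulMemClass.coe_mul, Polynomial.coeff_mul]
    refine Finset.sum_eq_zero fun x hx => ?_
    rw [Finset.HasAntidiagonal.mem_antidiagonal] at hx
    by_cases h1 : x.1 = i
    · rw [hG x.2 (by omega), mul_zero]
    · rw [hF x.1 h1, zero_mul]
  decompose' F := DFinsupp.mk (F : Polynomial (Coord k d)).support fun m => reesComponent k d F m
  left_inv F := by
    refine Subtype.ext (Polynomial.ext fun n => ?_)
    have h : ∀ x : DirectSum ℕ fun m => reesGrading k d m,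
        ((DirectSum.coeAddMonoidHom (reesGrading k d) x : rees k d) :
          Polynomial (Coord k d)).coeff n = ((x n : rees k d) : Polynomial (Coord k d)).coeff n :=
      coeff_coeAddMonoidHom k d n
    rw [h]
    by_cases hn : n ∈ (F : Polynomial (Coord k d)).support
    · rw [DFinsupp.mk_apply, dif_pos hn, reesComponent_coe, Polynomial.coeff_monomial, if_pos rfl]
    · rw [DFinsupp.mk_apply, dif_neg hn]
      simpa using (Polynomial.notMem_support_iff.1 hn).symm
  right_inv x := by
    refine DFinsupp.ext fun n => Subtype.ext (Subtype.ext ?_)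
    have hx : ((x n : rees k d) : Polynomial (Coord k d)) =
        Polynomial.monomial n (((x n : rees k d) : Polynomial (Coord k d)).coeff n) := by
      ext1 m
      rw [Polynomial.coeff_monomial]
      split_ifs with h
      · rw [h]
      · exact (x n).2 m (Ne.symm h)
    have h := coeff_coeAddMonoidHom k d n x
    rw [hx, ← h]
    rw [DFinsupp.mk_apply]
    split_ifs with hn
    · rfl
    · rw [Polynomial.notMem_support_iff.1 hn]; simp

/-! ### The weighted blow-up and its exceptional divisor -/

/-- The (schematic) weighted blow-up `Y`: the `Proj` of the Rees algebra. -/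
def weightedBlowup : Scheme.{u} := Proj (reesGrading k d)

/-- The identification of the coordinate ring with the degree zero part of the Rees algebra. -/
def reesZero : Coord k d →+* reesGrading k d 0 where
  toFun f := ⟨reesMonomial k d 0 f (by rw [weightIdeal_zero]; trivial), fun n hn => by
    change (Polynomial.monomial 0 f).coeff n = 0
    rw [Polynomial.coeff_monomial, if_neg hn.symm]⟩
  map_one' := rfl
  map_mul' f g := Subtype.ext (Subtype.ext (by simp [reesMonomial]))
  map_zero' := Subtype.ext (Subtype.ext (by simp [reesMonomial]))
  map_add' f g := Subtype.ext (Subtype.ext (by simp [reesMonomial]))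

/-- The blow-up morphism `Y ⟶ 𝔸`. -/
def blowdown : weightedBlowup k d ⟶ Spec (.of (Coord k d)) :=
  Proj.toSpecZero (reesGrading k d) ≫ Spec.map (CommRingCat.ofHom (reesZero k d))

/-- The center of the blow-up: the common zero locus of the `x_i^(σ)` with `i ≥ 1`. -/
def center : Set (Spec (.of (Coord k d))) :=
  PrimeSpectrum.zeroLocus (Set.range fun c : PosIdx d => (MvPolynomial.X c.1 : Coord k d))

/-- The exceptional divisor of the weighted blow-up (as a closed subset). -/
def excDiv : Set (weightedBlowup k d) := (blowdown k d) ⁻¹' center k d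

/-- The locus `H_i^(σ)` in the exceptional divisor where the homogeneous coordinate
`U_i^(σ)`, the class of `x_i^(σ) t^i`, vanishes. -/
def hyperplane (c : PosIdx d) : Set (weightedBlowup k d) :=
  {y | y ∈ excDiv k d ∧
    reesMonomial k d (c.1.2 : ℕ) (MvPolynomial.X c.1) (X_mem_weightIdeal k d c.1) ∈
      (show ProjectiveSpectrum (reesGrading k d) from y).asHomogeneousIdeal}

/-- The stratum of the exceptional divisor on which the coordinates in `S` are nonzero and all
other coordinates vanish. -/
def stratumY (S : Finset (PosIdx d)) : Set (weightedBlowup k d) :=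
  (excDiv k d ∩ ⋂ c ∉ S, hyperplane k d c) \ ⋃ c ∈ S, hyperplane k d c

/-! ### The quotient of the weighted blow-up by the foliation

The pullback of the foliation generated by `del` to the integral scheme `Y` is the saturated
rank one foliation which over the generic point is generated by `del`, acting on the function
field of `Y`, that is, on the fraction field of `Coord k d`. The quotient `W` has the same
underlying space as `Y`, and its functions are the functions on `Y` killed by the foliation,
equivalently by `del`. -/

/-- Setting `t = 1`: the homogeneous fraction `F / G` on `Y` is the rational function
`atOne F / atOne G` on affine space. -/
def atOne : rees k d →+* Coord k d := (Polynomial.evalRingHom 1).comp (rees k d).subtype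

open HomogeneousLocalization

variable {k d} in
/-- An element of the local ring of `Y` at `y` is killed by `del`: it is a fraction whose
associated rational function `a / b` satisfies `b * del a = a * del b`. -/
def IsConst (y : ProjectiveSpectrum (reesGrading k d))
    (z : AtPrime (reesGrading k d) y.asHomogeneousIdeal.toIdeal) : Prop :=
  ∃ c : NumDenSameDeg (reesGrading k d) y.asHomogeneousIdeal.toIdeal.primeCompl,
    z = .mk c ∧ atOne k d c.den * del k d (atOne k d c.num) =
      atOne k d c.num * del k d (atOne k d c.den)

/-- The subring of the local ring of `Y` at `y` of the elements killed by `del`. -/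
def constSubring (y : ProjectiveSpectrum (reesGrading k d)) :
    Subring (AtPrime (reesGrading k d) y.asHomogeneousIdeal.toIdeal) where
  carrier := {z | IsConst y z}
  mul_mem' := by
    rintro _ _ ⟨a, rfl, ha⟩ ⟨b, rfl, hb⟩
    refine ⟨a * b, rfl, ?_⟩
    simp only [NumDenSameDeg.den_mul, NumDenSameDeg.num_mul, map_mul, Derivation.leibniz,
      smul_eq_mul]
    linear_combination (atOne k d b.den * atOne k d b.num) * ha +
      (atOne k d a.den * atOne k d a.num) * hb
  one_mem' := ⟨1, rfl, by simp⟩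
  add_mem' := by
    rintro _ _ ⟨a, rfl, ha⟩ ⟨b, rfl, hb⟩
    refine ⟨a + b, rfl, ?_⟩
    simp only [NumDenSameDeg.den_add, NumDenSameDeg.num_add, map_mul, map_add, Derivation.leibniz,
      smul_eq_mul]
    linear_combination (atOne k d b.den ^ 2) * ha + (atOne k d a.den ^ 2) * hb
  zero_mem' := ⟨0, rfl, by simp⟩
  neg_mem' := by
    rintro _ ⟨a, rfl, ha⟩
    refine ⟨-a, rfl, ?_⟩
    simp only [NumDenSameDeg.den_neg, NumDenSameDeg.num_neg, map_neg]
    linear_combination -ha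

lemma isConst_of_mul_eq_one {y : ProjectiveSpectrum (reesGrading k d)}
    {z z' : AtPrime (reesGrading k d) y.asHomogeneousIdeal.toIdeal}
    (hz : IsConst y z) (h : z * z' = 1) : IsConst y z' := by
  obtain ⟨a, rfl, ha⟩ := hz
  have hn : (a.num : rees k d) ∈ y.asHomogeneousIdeal.toIdeal.primeCompl := by
    intro hmem
    have hu : IsUnit (HomogeneousLocalization.val (.mk a : AtPrime (reesGrading k d)
        y.asHomogeneousIdeal.toIdeal)) :=
      (IsUnit.of_mul_eq_one _ h).map (algebraMap _ (Localization _))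
    rw [HomogeneousLocalization.val_mk, Localization.mk_eq_mk',
      IsLocalization.AtPrime.isUnit_mk'_iff _ y.asHomogeneousIdeal.toIdeal] at hu
    exact hu hmem
  let b : NumDenSameDeg (reesGrading k d) y.asHomogeneousIdeal.toIdeal.primeCompl :=
    ⟨a.deg, a.den, a.num, hn⟩
  have hb : (HomogeneousLocalization.mk a : AtPrime (reesGrading k d)
      y.asHomogeneousIdeal.toIdeal) * .mk b = 1 := by
    apply HomogeneousLocalization.val_injective
    rw [HomogeneousLocalization.val_mul, HomogeneousLocalization.val_mk,
      HomogeneousLocalization.val_mk, HomogeneousLocalization.val_one, Localization.mk_mul,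
      ← Localization.mk_one, Localization.mk_eq_mk_iff, Localization.r_iff_exists]
    exact ⟨1, by simp [b, mul_comm]⟩
  refine ⟨b, ?_, ha.symm⟩
  calc z' = (.mk a * .mk b) * z' := by rw [hb, one_mul]
    _ = .mk b := by rw [mul_right_comm, h, one_mul]

/-- The structure sheaf of `Y`. -/
abbrev sheafY : TopCat.Sheaf CommRingCat.{u} (ProjectiveSpectrum.top (reesGrading k d)) :=
  ProjectiveSpectrum.Proj.structureSheaf (reesGrading k d)

/-- The germ at `y` of a function on an open subset of `Y`. -/
def germAt {U : (Opens (ProjectiveSpectrum.top (reesGrading k d)))ᵒᵖ}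
    (y : ProjectiveSpectrum (reesGrading k d)) (hy : y ∈ U.unop) :
    (sheafY k d).1.obj U →+* AtPrime (reesGrading k d) y.asHomogeneousIdeal.toIdeal :=
  (openToLocalization (reesGrading k d) U.unop y hy).hom

/-- The functions on an open subset of `Y` which are killed by `del`. -/
def quotSections (U : (Opens (ProjectiveSpectrum.top (reesGrading k d)))ᵒᵖ) :
    Subring ((sheafY k d).1.obj U) :=
  ⨅ (y : ProjectiveSpectrum (reesGrading k d)) (hy : y ∈ U.unop),
    (constSubring k d y).comap (germAt k d y hy)

lemma mem_quotSections {U : (Opens (ProjectiveSpectrum.top (reesGrading k d)))ᵒᵖ}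
    {s : (sheafY k d).1.obj U} : s ∈ quotSections k d U ↔
      ∀ (y : ProjectiveSpectrum (reesGrading k d)) (hy : y ∈ U.unop),
        germAt k d y hy s ∈ constSubring k d y := by
  simp [quotSections, Subring.mem_iInf]

/-- The subsheaf of the structure sheaf of `Y` of the functions killed by `del`. -/
def quotPresheaf : TopCat.Presheaf CommRingCat.{u} (ProjectiveSpectrum.top (reesGrading k d)) where
  obj U := CommRingCat.of (quotSections k d U)
  map {U V} i := CommRingCat.ofHom <|
    (((sheafY k d).1.map i).hom.comp (quotSections k d U).subtype).codRestrict (quotSections k d V)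
      fun s => (mem_quotSections k d).2 fun y hy =>
        (mem_quotSections k d).1 s.2 y (i.unop.le hy)
  map_id U := CommRingCat.hom_ext <| RingHom.ext fun s =>
    Subtype.ext (ConcreteCategory.congr_hom ((sheafY k d).1.map_id U) s.1)
  map_comp i j := CommRingCat.hom_ext <| RingHom.ext fun s =>
    Subtype.ext (ConcreteCategory.congr_hom ((sheafY k d).1.map_comp i j) s.1)

/-- The inclusion of the functions killed by `del` into all functions on `Y`. -/
def quotInclusion : quotPresheaf k d ⟶ (sheafY k d).1 where
  app U := CommRingCat.ofHom (quotSections k d U).subtype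
  naturality _ _ _ := rfl

lemma quotPresheaf_isSheaf : (quotPresheaf k d).IsSheaf := by
  refine (TopCat.Presheaf.isSheaf_iff_isSheafUniqueGluing _).2 fun ι U sf hsf => ?_
  obtain ⟨s, hs, hu⟩ := (sheafY k d).existsUnique_gluing U (fun i => (sf i).1)
    (fun i j => congrArg Subtype.val (hsf i j))
  refine ⟨⟨s, (mem_quotSections k d).2 fun y hy => ?_⟩, fun i => Subtype.ext (hs i),
    fun t ht => Subtype.ext (hu _ fun i => congrArg Subtype.val (ht i))⟩
  obtain ⟨i, hi⟩ := Opens.mem_iSup.1 hy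
  have h := (mem_quotSections k d).1 (sf i).2 y hi
  have hi' : (sf i).1 = (sheafY k d).1.map (Opens.leSupr U i).op s := (hs i).symm
  rw [hi'] at h
  exact h

/-- The quotient of `Y` by the foliation, as a sheafed space. -/
def quotSheafedSpace : SheafedSpace CommRingCat.{u} where
  carrier := TopCat.of (ProjectiveSpectrum (reesGrading k d))
  presheaf := quotPresheaf k d
  IsSheaf := quotPresheaf_isSheaf k d

lemma inv_mem_quotSections {V : (Opens (ProjectiveSpectrum.top (reesGrading k d)))ᵒᵖ}
    {s t : (sheafY k d).1.obj V} (hs : s ∈ quotSections k d V) (h : s * t = 1) :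
    t ∈ quotSections k d V :=
  (mem_quotSections k d).2 fun x hx =>
    isConst_of_mul_eq_one k d ((mem_quotSections k d).1 hs x hx) <| by
      rw [← map_mul, h, map_one]

lemma isUnit_of_isUnit_val {V : (Opens (ProjectiveSpectrum.top (reesGrading k d)))ᵒᵖ}
    (s : quotSections k d V) (h : IsUnit (s : (sheafY k d).1.obj V)) : IsUnit s := by
  obtain ⟨t, ht⟩ := h.exists_right_inv
  exact .of_mul_eq_one ⟨t, inv_mem_quotSections k d s.2 ht⟩ (Subtype.ext ht)

/-- The quotient map `Y ⟶ W` as a map of ringed spaces: the identity on points, and the inclusion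
of the functions killed by `del` on functions. -/
def quotHom : (Proj.toSheafedSpace (reesGrading k d)).toPresheafedSpace.Hom
    (quotSheafedSpace k d).toPresheafedSpace where
  base := 𝟙 _
  c := quotInclusion k d

lemma isLocalHom_quotHom (y : ProjectiveSpectrum.top (reesGrading k d)) :
    IsLocalHom ((quotHom k d).stalkMap y).hom := by
  constructor
  intro z hz
  obtain ⟨U, hU, s, rfl⟩ := (quotPresheaf k d).exists_germ_eq (x := y) z
  have h1 : ((quotHom k d).stalkMap y).hom ((quotPresheaf k d).germ U y hU s) =
      (sheafY k d).presheaf.germ U y hU s.1 :=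
    PresheafedSpace.stalkMap_germ_apply (quotHom k d) U y hU s
  rw [h1] at hz
  obtain ⟨V, i, hV, hu⟩ := RingedSpace.isUnit_res_of_isUnit_germ
    (Proj.toSheafedSpace (reesGrading k d)) U s.1 y hU hz
  have h4 : (quotPresheaf k d).germ V y hV ((quotPresheaf k d).map i.op s) =
      (quotPresheaf k d).germ U y hU s := (quotPresheaf k d).germ_res_apply i y hV s
  have h5 : IsUnit ((quotPresheaf k d).map i.op s) :=
    isUnit_of_isUnit_val k d (V := op V) ((quotPresheaf k d).map i.op s) hu
  rw [← h4]
  exact h5.map ((quotPresheaf k d).germ V y hV).hom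

/-- The partial resolution `W`: the quotient of the weighted blow-up `Y` by the pullback of the
foliation generated by `del`. -/
def partialRes : LocallyRingedSpace.{u} where
  toSheafedSpace := quotSheafedSpace k d
  isLocalRing y :=
    have : IsLocalRing ((Proj.toSheafedSpace (reesGrading k d)).presheaf.stalk y) :=
      (Proj.toLocallyRingedSpace (reesGrading k d)).isLocalRing y
    @RingHom.domain_isLocalRing _ _ _ _ this ((quotHom k d).stalkMap y).hom
      (isLocalHom_quotHom k d y)

/-- The quotient morphism `q : Y ⟶ W`. -/
def quot : (weightedBlowup k d).toLocallyRingedSpace ⟶ partialRes k d where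
  toHom := quotHom k d
  prop y := isLocalHom_quotHom k d y

/-- The constant function on `Y` with value `c ∈ k`. -/
def scalarSection (c : k) : quotSections k d (op ⊤) :=
  ⟨⟨fun y => HomogeneousLocalization.mk ⟨0, reesZero k d (MvPolynomial.C c), 1, one_mem _⟩,
    fun _ => ⟨⊤, trivial, 𝟙 _, 0, reesZero k d (MvPolynomial.C c), 1,
      fun z => (Ideal.ne_top_iff_one _).1 z.1.isPrime.ne_top, fun _ => rfl⟩⟩,
    (mem_quotSections k d).2 fun y hy => ⟨_, rfl, by
      simp [atOne, reesZero, reesMonomial]⟩⟩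

/-- The structure of a `k`-scheme on `W`, on global functions. -/
def scalars : k →+* (partialRes k d).presheaf.obj (op ⊤) where
  toFun := scalarSection k d
  map_one' := Subtype.ext (Subtype.ext (funext fun _ =>
    map_one ((fromZeroRingHom (reesGrading k d) _).comp ((reesZero k d).comp MvPolynomial.C))))
  map_mul' a b := Subtype.ext (Subtype.ext (funext fun _ =>
    map_mul ((fromZeroRingHom (reesGrading k d) _).comp ((reesZero k d).comp MvPolynomial.C)) a b))
  map_zero' := Subtype.ext (Subtype.ext (funext fun _ =>
    map_zero ((fromZeroRingHom (reesGrading k d) _).comp ((reesZero k d).comp MvPolynomial.C))))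
  map_add' a b := Subtype.ext (Subtype.ext (funext fun _ =>
    map_add ((fromZeroRingHom (reesGrading k d) _).comp ((reesZero k d).comp MvPolynomial.C)) a b))

/-- The local rings of `W` are `k`-algebras. -/
instance (w : partialRes k d) : Algebra k ((partialRes k d).presheaf.stalk w) :=
  (((partialRes k d).presheaf.germ ⊤ w trivial).hom.comp (scalars k d)).toAlgebra

/-- The exceptional divisor of `W`: the image of the exceptional divisor of `Y`. -/
def excDivW : Set (partialRes k d) := (quot k d).base '' excDiv k d

/-- The stratum of the exceptional divisor of `W` given by a set `S` of indices. -/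
def stratumW (S : Finset (PosIdx d)) : Set (partialRes k d) :=
  (quot k d).base '' stratumY k d S

end Geometry

/-- The ideal in the local ring of `X` at `w` of the germs vanishing along `Z`: those whose value
at every point of `Z` specialising to `w` is zero. On a scheme, and for closed `Z`, this is
the stalk at `w` of the ideal of `Z` with its reduced structure. -/
def idealAt (X : LocallyRingedSpace.{u}) (Z : Set X) (w : X) : Ideal (X.presheaf.stalk w) :=
  ⨅ (v : X) (h : v ⤳ w) (_ : v ∈ Z),
    (IsLocalRing.maximalIdeal (X.presheaf.stalk v)).comap (X.presheaf.stalkSpecializes h).hom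

/-! ### Cyclic quotient singularities -/

/-- A pair consisting of (the spectrum of) a local `k`-algebra `O` and a prime divisor, with ideal
`B`, is a cyclic quotient singularity of type `(1/n) (a i | i : ι)`, the divisor corresponding to
the index `i₀`.

An action of the group scheme `μ_n` on the ring of power series is a `ℤ/n`-grading; an
eigenfunction of weight `a` is a homogeneous element of degree `a`, the ring of invariants is the
degree zero part, and the fixed locus is cut out by the homogeneous elements of nonzero degree. -/
structure IsCyclicQuotient (k : Type*) [Field k] (O : Type*) [CommRing O] [IsLocalRing O]
    [Algebra k O] (B : Ideal O) {ι : Type*} [Fintype ι] (n : ℕ) (a : ι → ℤ) (i₀ : ι) : Prop where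
  pos : 0 < n
  noetherian : IsNoetherianRing O
  dim : ringKrullDim O = Fintype.card ι
  domain : IsDomain O
  normal : IsIntegrallyClosed O
  /-- `ℚ`-factoriality: every prime divisor has a multiple which is principal. -/
  qfactorial : ∀ P : Ideal O, P.IsPrime → P.height = 1 → ∃ f : O, (Ideal.span {f}).radical = P
  prime : B.IsPrime
  height : B.height = 1
  exists_action : ∃ (𝒜 : ZMod n → Submodule k (MvPowerSeries ι k)) (_ : GradedAlgebra 𝒜),
    (∀ c : ZMod n, c ≠ 0 → ∀ f ∈ 𝒜 c, f ∈ IsLocalRing.maximalIdeal (MvPowerSeries ι k)) ∧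
    (∀ i, MvPowerSeries.X i ∈ 𝒜 (a i : ZMod n)) ∧
    ∃ e : 𝒜 0 ≃ₐ[k] AdicCompletion (IsLocalRing.maximalIdeal O) O,
      ∀ f : 𝒜 0,
        e f ∈ B.map (algebraMap O (AdicCompletion (IsLocalRing.maximalIdeal O) O)) ↔
          (f : MvPowerSeries ι k) ∈ Ideal.span {MvPowerSeries.X i₀}

/-- The greatest common divisor of the `i` with `(σ, i) ∈ S` for some `σ`. -/
def gcdIdx {l : ℕ} {d : Fin l → ℕ} (S : Finset (PosIdx d)) : ℕ := S.gcd fun c => (c.1.2 : ℕ)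

/-- The weights attached to `c = (σ, i)`: `p` at `(σ, i - 1)`, `1` at `(σ, i)`, and `-j` at every
other `(π, j)`. -/
def weights (p : ℕ) {l : ℕ} {d : Fin l → ℕ} (c : PosIdx d) (v : Idx d) : ℤ :=
  if v.1 = c.1.1 ∧ (v.2 : ℕ) + 1 = (c.1.2 : ℕ) then p
  else if v = c.1 then 1
  else -((v.2 : ℕ) : ℤ)

end AlphaP

end

noncomputable section

namespace AlphaP

/-! ### Gradings on power series rings -/

section PowerSeriesGrading

variable (k : Type*) [Field k] {ι : Type*} {M : Type*} [AddCommGroup M] (r : ι → M)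

/-! Fix c = (σ, i) in S. On the chart U_c ≠ 0 set U_c = 1, x_c = E^i and x_v = U_v E^j for v = (π,
j). This presents the chart of Y as the quotient of an affine space, with coordinates E and the U_v,
by μ_i. Since 1 ≤ i ≤ p - 1, the group is tame and is given by a primitive i-th root of unity ζ.
Upstairs ∂ = E·D with D a regular derivation (`chartDer_chartMap`). D preserves the ideal (E) and
vanishes at no point (`exists_chartDer_ne_zero`). If D U_{v₀} ≠ 0 at the point a over w, then Δ = D
/ D U_{v₀} generates the same foliation and Δ U_{v₀} = 1. Moreover Δ^p = 0, because ∂^p = 0 and ∂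
has a slice (`iterate_smul_eq_zero`).

Put y = U_{v₀} - a_{v₀}. The Taylor operator f ↦ ∑_{n < p} (-y)^n / n! · Δ^n f projects onto the
constants of Δ. Hence the constants regular at a have coordinates y^p and the projections of the
remaining coordinates (`mem_span_constProj`). The local ring of W at w is the ring of those
constants which are fixed by ζ (`mem_inv_iff_stalkEmb`). The stabilizer of a in μ_i is μ_g with g =
gcd(S) (`stabilizer_iff`). Here E has weight 1 and U_v has weight -j. As D multiplies weights by ζ
and D U_{v₀} does not vanish at the fixed point a, y has weight 1 on μ_g (`pow_chartWeight_eq`), so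
y^p has weight p. Since 1 ≡ -(i - 1) mod g, exchanging v₀ with (σ, i - 1) produces the stated list
of weights (`weights_swap`).

To reach the completion, compose the Taylor projection with the average over ζ. This is a Reynolds
operator from the functions regular along the orbit of a onto the local ring X of W. Hence ideals of
X are contracted from the local ring upstairs (`purity`). This gives Noetherianity, the comparison
of the two adic topologies, and control of the ideal of the exceptional divisor. The coordinates of
the constants are analytically independent by a dimension count (`ind`), weight-zero monomials are
approximated by elements of X (`dense`), and expansions of elements of X only have terms of weight
zero (`hom`). `IsWeightedChart` collects these facts and yields the isomorphism of the completion of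
X with the power series of weight zero. ℚ-factoriality comes from unique factorization upstairs:
p-th powers of norms of prime elements cut out the height one primes of X (`exists_radical_span`).
If g = 1, all weights are trivial and Nakayama's lemma shows that X is regular. -/

/-- The power series all of whose monomials have weight `c`. -/
def psGrading (c : M) : Submodule k (MvPowerSeries ι k) where
  carrier := {f | ∀ α, Finsupp.weight r α ≠ c → MvPowerSeries.coeff α f = 0}
  add_mem' hf hg α h := by rw [map_add, hf α h, hg α h, add_zero]
  zero_mem' α _ := by simp
  smul_mem' a f hf α h := by rw [MvPowerSeries.coeff_smul, hf α h, mul_zero]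

open Classical in
/-- The component of weight `c` of a power series. -/
def psProj (c : M) : MvPowerSeries ι k →ₗ[k] psGrading k r c where
  toFun f := ⟨fun α => if Finsupp.weight r α = c then MvPowerSeries.coeff α f else 0,
    fun α h => by
      change (if Finsupp.weight r α = c then MvPowerSeries.coeff α f else 0) = 0
      rw [if_neg h]⟩
  map_add' f g := by
    refine Subtype.ext (funext fun α => ?_)
    change (if Finsupp.weight r α = c then MvPowerSeries.coeff α (f + g) else 0) =
      (if Finsupp.weight r α = c then MvPowerSeries.coeff α f else 0) +
        if Finsupp.weight r α = c then MvPowerSeries.coeff α g else 0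
    split_ifs <;> simp
  map_smul' a f := by
    refine Subtype.ext (funext fun α => ?_)
    change (if Finsupp.weight r α = c then MvPowerSeries.coeff α (a • f) else 0) =
      a • if Finsupp.weight r α = c then MvPowerSeries.coeff α f else 0
    split_ifs <;> simp

open Classical in
lemma coeff_psProj (c : M) (f : MvPowerSeries ι k) (α : ι →₀ ℕ) :
    MvPowerSeries.coeff α (psProj k r c f : MvPowerSeries ι k) =
      if Finsupp.weight r α = c then MvPowerSeries.coeff α f else 0 := rfl

lemma psProj_same (c : M) (f : psGrading k r c) : psProj k r c (f : MvPowerSeries ι k) = f := by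
  refine Subtype.ext (MvPowerSeries.ext fun α => ?_)
  rw [coeff_psProj]
  split_ifs with h
  · rfl
  · exact (f.2 α h).symm

lemma psProj_ne {c c' : M} (h : c ≠ c') (f : psGrading k r c) :
    psProj k r c' (f : MvPowerSeries ι k) = 0 := by
  refine Subtype.ext (MvPowerSeries.ext fun α => ?_)
  rw [coeff_psProj]
  split_ifs with h'
  · rw [f.2 α (fun h'' => h (h''.symm.trans h'))]; simp
  · simp

instance psGrading_gradedMonoid : SetLike.GradedMonoid (psGrading k r) where
  one_mem α h := by
    classical
    rw [MvPowerSeries.coeff_one, if_neg]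
    rintro rfl
    simp at h
  mul_mem c c' f g hf hg α h := by
    classical
    rw [MvPowerSeries.coeff_mul]
    refine Finset.sum_eq_zero fun x hx => ?_
    rw [Finset.HasAntidiagonal.mem_antidiagonal] at hx
    by_cases h1 : Finsupp.weight r x.1 = c
    · rw [hg x.2, mul_zero]
      intro h2
      exact h (by rw [← hx, map_add, h1, h2])
    · rw [hf x.1 h1, zero_mul]

/-- The decomposition of a power series into its finitely many weight components. -/
def psDecompose [Fintype M] [DecidableEq M] :
    MvPowerSeries ι k →ₗ[k] DirectSum M fun c => psGrading k r c :=
  ∑ c : M, (DirectSum.lof k M (fun c => psGrading k r c) c) ∘ₗ psProj k r c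

instance psGrading_gradedAlgebra [Fintype M] [DecidableEq M] : GradedAlgebra (psGrading k r) where
  toDecomposition := DirectSum.Decomposition.ofLinearMap _ (psDecompose k r)
    (by
      ext1 f
      refine MvPowerSeries.ext fun α => ?_
      simp only [psDecompose, LinearMap.comp_apply, LinearMap.sum_apply, map_sum,
        DirectSum.coeLinearMap_lof, coeff_psProj, LinearMap.id_apply]
      exact (Finset.sum_eq_single (Finsupp.weight r α) (fun b _ hb => if_neg hb.symm)
        (by simp)).trans (if_pos rfl))
    (by
      refine DirectSum.linearMap_ext _ fun c => LinearMap.ext fun f => ?_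
      simp only [psDecompose, LinearMap.comp_apply, LinearMap.sum_apply,
        DirectSum.coeLinearMap_lof, LinearMap.id_apply]
      rw [Finset.sum_eq_single c]
      · rw [psProj_same]
      · intro b _ hb
        rw [psProj_ne k r hb.symm, map_zero]
      · simp)

end PowerSeriesGrading

end AlphaP
end

noncomputable section

namespace AlphaP

lemma mvPolynomial_X_dvd_iff {R ι : Type*} [CommRing R] {c : ι} {F : MvPolynomial ι R} :
    MvPolynomial.X c ∣ F ↔ ∀ α : ι →₀ ℕ, α c = 0 → F.coeff α = 0 := by
  constructor
  · rintro ⟨G, rfl⟩ α hα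
    classical
    rw [MvPolynomial.coeff_X_mul', if_neg (by simpa using hα)]
  · intro h
    rw [F.as_sum]
    refine Finset.dvd_sum fun α hα => ?_
    rw [MvPolynomial.X_dvd_monomial]
    exact Or.inr fun h' => MvPolynomial.mem_support_iff.1 hα (h α h')

/-! ### Truncated evaluation of power series -/

section Truncation

variable {k : Type*} [Field k] {ι : Type*} {T : Type*} [CommRing T] [Algebra k T] (z : ι → T)

/-- A polynomial without terms of degree less than `n` takes values in the `n`-th power of the
ideal generated by the arguments. -/
lemma aeval_mem_pow {n : ℕ} (F : MvPolynomial ι k)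
    (hF : ∀ α, α.degree < n → F.coeff α = 0) :
    MvPolynomial.aeval z F ∈ Ideal.span (Set.range z) ^ n := by
  rw [F.as_sum, map_sum]
  refine Ideal.sum_mem _ fun α hα => ?_
  rw [MvPolynomial.aeval_monomial]
  refine Ideal.mul_mem_left _ _ ?_
  have hdeg : n ≤ α.degree := not_lt.1 fun h => (MvPolynomial.mem_support_iff.1 hα) (hF α h)
  refine Ideal.pow_le_pow_right hdeg ?_
  rw [Finsupp.degree_apply, ← Finset.prod_pow_eq_pow_sum]
  exact Ideal.prod_mem_prod fun i _ =>
    Ideal.pow_mem_pow (Ideal.subset_span (Set.mem_range_self i)) _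

variable {z} in
/-- If every element is a scalar modulo the ideal generated by `z`, then every element of its
`n`-th power is a polynomial in `z` modulo the next power. -/
lemma exists_aeval_sub_mem_succ (hexp : ∀ t : T, ∃ c : k,
    t - algebraMap k T c ∈ Ideal.span (Set.range z)) (n : ℕ) :
    ∀ t ∈ Ideal.span (Set.range z) ^ n, ∃ F : MvPolynomial ι k,
      t - MvPolynomial.aeval z F ∈ Ideal.span (Set.range z) ^ (n + 1) := by
  set I := Ideal.span (Set.range z)
  have h0 : ∀ t : T, ∃ F : MvPolynomial ι k, t - MvPolynomial.aeval z F ∈ I := fun t => by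
    obtain ⟨c, hc⟩ := hexp t
    exact ⟨MvPolynomial.C c, by simpa [MvPolynomial.algHom_C] using hc⟩
  -- In order one the generators are themselves values of variables, and a coefficient may be
  -- replaced by a scalar at the cost of an error in I².
  have h1 : ∀ t ∈ I, ∃ F : MvPolynomial ι k, t - MvPolynomial.aeval z F ∈ I ^ 2 := by
    intro t ht
    induction ht using Submodule.span_induction with
    | mem x hx => obtain ⟨v, rfl⟩ := hx; exact ⟨MvPolynomial.X v, by simp⟩
    | zero => exact ⟨0, by simp⟩
    | add x y _ _ hx hy =>
      obtain ⟨F, hF⟩ := hx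
      obtain ⟨G, hG⟩ := hy
      exact ⟨F + G, by rw [map_add, add_sub_add_comm]; exact add_mem hF hG⟩
    | smul a x hx hx' =>
      obtain ⟨F, hF⟩ := hx'
      obtain ⟨G, hG⟩ := h0 a
      refine ⟨G * F, ?_⟩
      have : a • x - MvPolynomial.aeval z (G * F) = (a - MvPolynomial.aeval z G) * x +
          MvPolynomial.aeval z G * (x - MvPolynomial.aeval z F) := by
        rw [map_mul, smul_eq_mul]; ring
      rw [this]
      refine add_mem ?_ (Ideal.mul_mem_left _ _ hF)
      rw [sq]
      exact Ideal.mul_mem_mul hG hx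
  induction n with
  | zero => intro t _; simpa using h0 t
  | succ n ih =>
    intro t ht
    rw [pow_succ'] at ht
    induction ht using Submodule.mul_induction_on' with
    | mem_mul_mem a ha b hb =>
      obtain ⟨F, hF⟩ := h1 a ha
      obtain ⟨G, hG⟩ := ih b hb
      refine ⟨F * G, ?_⟩
      have hFI : MvPolynomial.aeval z F ∈ I := by
        have := sub_mem ha (Ideal.pow_le_self two_ne_zero hF)
        simpa using this
      have : a * b - MvPolynomial.aeval z (F * G) = (a - MvPolynomial.aeval z F) * b +
          MvPolynomial.aeval z F * (b - MvPolynomial.aeval z G) := by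
        rw [map_mul]; ring
      rw [this]
      refine add_mem ?_ ?_
      -- The error of the first factor lies in I², one order better than the factor itself; this
      -- gives the extra order for the product.
      · rw [show n + 1 + 1 = 2 + n by ring, pow_add]
        exact Ideal.mul_mem_mul hF hb
      · rw [pow_succ']
        exact Ideal.mul_mem_mul hFI hG
    | add x _ y _ hx hy =>
      obtain ⟨F, hF⟩ := hx
      obtain ⟨G, hG⟩ := hy
      exact ⟨F + G, by rw [map_add, add_sub_add_comm]; exact add_mem hF hG⟩

-- Errors are corrected one order at a time; a finite order needs only finitely many corrections, so
-- the result stays a polynomial.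
variable {z} in
lemma exists_aeval_sub_mem (hexp : ∀ t : T, ∃ c : k,
    t - algebraMap k T c ∈ Ideal.span (Set.range z)) (n : ℕ) (t : T) :
    ∃ F : MvPolynomial ι k, t - MvPolynomial.aeval z F ∈ Ideal.span (Set.range z) ^ n := by
  induction n with
  | zero => exact ⟨0, by simp⟩
  | succ n ih =>
    obtain ⟨F, hF⟩ := ih
    obtain ⟨G, hG⟩ := exists_aeval_sub_mem_succ hexp n _ hF
    exact ⟨F + G, by rw [map_add, ← sub_sub]; exact hG⟩

variable [Finite ι]

/-- The value at `z` of the part of degree less than `n` of a power series. -/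
def truncEval (n : ℕ) : MvPowerSeries ι k →ₗ[k] T :=
  (MvPolynomial.aeval z).toLinearMap ∘ₗ MvPowerSeries.truncTotal n

lemma truncEval_apply (n : ℕ) (f : MvPowerSeries ι k) :
    truncEval z n f = MvPolynomial.aeval z (MvPowerSeries.truncTotal n f) := rfl

/-- Truncation is not multiplicative, but all discarded terms have degree at least n, so evaluation
is multiplicative modulo the n-th power. -/
lemma truncEval_mul_sub_mem (n : ℕ) (f g : MvPowerSeries ι k) :
    truncEval z n (f * g) - truncEval z n f * truncEval z n g ∈
      Ideal.span (Set.range z) ^ n := by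
  rw [truncEval_apply, truncEval_apply, truncEval_apply, ← map_mul, ← map_sub]
  refine aeval_mem_pow z _ fun α hα => ?_
  rw [MvPolynomial.coeff_sub, MvPowerSeries.coeff_truncTotal _ hα,
    MvPowerSeries.coeff_truncTotal_mul_truncTotal_eq_coeff_mul _ _ hα, sub_self]

lemma truncEval_one_sub_mem (n : ℕ) :
    1 - truncEval z n (1 : MvPowerSeries ι k) ∈ Ideal.span (Set.range z) ^ n := by
  rcases eq_or_ne n 0 with rfl | hn
  · simp
  · rw [truncEval_apply, MvPowerSeries.truncTotal_one hn, map_one, sub_self]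
    exact zero_mem _

lemma truncEval_sub_mem {n m : ℕ} (h : n ≤ m) (f : MvPowerSeries ι k) :
    truncEval z m f - truncEval z n f ∈ Ideal.span (Set.range z) ^ n := by
  rw [truncEval_apply, truncEval_apply, ← map_sub]
  refine aeval_mem_pow z _ fun α hα => ?_
  rw [MvPolynomial.coeff_sub, MvPowerSeries.coeff_truncTotal _ hα,
    MvPowerSeries.coeff_truncTotal _ (hα.trans_le h), sub_self]

lemma aeval_sub_truncEval_mem {n : ℕ} (F : MvPolynomial ι k) (f : MvPowerSeries ι k)
    (h : ∀ α, α.degree < n → F.coeff α = MvPowerSeries.coeff α f) :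
    MvPolynomial.aeval z F - truncEval z n f ∈ Ideal.span (Set.range z) ^ n := by
  rw [truncEval_apply, ← map_sub]
  refine aeval_mem_pow z _ fun α hα => ?_
  rw [MvPolynomial.coeff_sub, MvPowerSeries.coeff_truncTotal _ hα, h α hα, sub_self]

/-- The hypothesis `hind` is analytic independence. It makes expansions unique below degree n, so
coefficients can be recovered from values in T. -/
lemma coeff_eq_of_aeval_sub_truncEval_mem
    (hind : ∀ (n : ℕ) (F : MvPolynomial ι k),
      MvPolynomial.aeval z F ∈ Ideal.span (Set.range z) ^ n →
        ∀ α, α.degree < n → F.coeff α = 0) {n : ℕ}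
    (F : MvPolynomial ι k) (f : MvPowerSeries ι k)
    (h : MvPolynomial.aeval z F - truncEval z n f ∈ Ideal.span (Set.range z) ^ n)
    (α : ι →₀ ℕ) (hα : α.degree < n) : F.coeff α = MvPowerSeries.coeff α f := by
  rw [truncEval_apply, ← map_sub] at h
  have := hind n _ h α hα
  rwa [MvPolynomial.coeff_sub, MvPowerSeries.coeff_truncTotal _ hα, sub_eq_zero] at this

end Truncation

/-! ### Ideals in completions -/

/-- The extension of an ideal of a Noetherian ring to an adic completion consists of the elements
all of whose truncations lie in the image of the ideal. -/
lemma mem_map_adicCompletion_iff {X : Type*} [CommRing X] [IsNoetherianRing X] (I B : Ideal X)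
    (x : AdicCompletion I X) : x ∈ B.map (algebraMap X (AdicCompletion I X)) ↔
      ∀ n, ∃ b ∈ B, AdicCompletion.evalₐ I n x = Ideal.Quotient.mk (I ^ n) b := by
  constructor
  · intro hx n
    have h := Ideal.mem_map_of_mem (AdicCompletion.evalₐ I n : AdicCompletion I X →+* X ⧸ I ^ n) hx
    rw [Ideal.map_map] at h
    have hc : (AdicCompletion.evalₐ I n : AdicCompletion I X →+* X ⧸ I ^ n).comp
        (algebraMap X (AdicCompletion I X)) = Ideal.Quotient.mk (I ^ n) := by
      ext y
      exact AlgHom.commutes (AdicCompletion.evalₐ I n) y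
    rw [hc, Ideal.mem_map_iff_of_surjective _ Ideal.Quotient.mk_surjective] at h
    obtain ⟨b, hb, h⟩ := h
    exact ⟨b, hb, h.symm⟩
  · intro h
    -- Completion is exact on finitely generated modules. Since x dies in the completion of X/B, it
    -- comes from the completion of B, and the latter is generated by B over the completed ring.
    have hex := AdicCompletion.map_exact (I := I) (f := B.subtype) (g := B.mkQ)
      B.subtype_injective (LinearMap.exact_subtype_mkQ B) B.mkQ_surjective
    have hx : AdicCompletion.map I B.mkQ x = 0 := by
      refine AdicCompletion.ext fun n => ?_
      obtain ⟨b, hb, hbx⟩ := h n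
      have h1 : x.val n = Submodule.Quotient.mk b := by
        have h2 : I ^ n • (⊤ : Ideal X) = I ^ n := by simp
        have h3 := AdicCompletion.factor_evalₐ_eq_eval (I := I) (n := n) x h2.ge
        rw [hbx] at h3
        exact h3.symm
      rw [AdicCompletion.map_val_apply, h1]
      have h4 : B.mkQ b = 0 := by rwa [Submodule.mkQ_apply, Submodule.Quotient.mk_eq_zero]
      change Submodule.Quotient.mk (B.mkQ b) = _
      rw [h4]; rfl
    obtain ⟨y, hy⟩ := (hex x).1 hx
    obtain ⟨w, rfl⟩ := AdicCompletion.ofTensorProduct_surjective_of_finite I B y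
    rw [← hy]
    clear hy hx
    induction w with
    | zero => simp
    | add a b ha hb =>
      rw [map_add, map_add]
      exact add_mem ha hb
    | tmul a b =>
      rw [AdicCompletion.ofTensorProduct_tmul, map_smul, AdicCompletion.map_of, smul_eq_mul]
      exact Ideal.mul_mem_left _ _ (Ideal.mem_map_of_mem _ b.2)

end AlphaP
end

noncomputable section

namespace AlphaP

/-! ### The completion of a weighted subring -/

section Completion

variable {k : Type*} [Field k] {ι : Type*} {M : Type*} [AddCommGroup M] {T : Type*} [CommRing T]
  [Algebra k T] {X : Type*} [CommRing X] [IsLocalRing X] [Algebra k X]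

/-- The elements `z` of `T` are coordinates, with weights `r`, such that the local ring `X`
approximates the polynomials of weight zero in them. -/
structure IsWeightedChart (ψ : X →ₐ[k] T) (z : ι → T) (r : ι → M) : Prop where
  exp : ∀ t : T, ∃ c : k, t - algebraMap k T c ∈ Ideal.span (Set.range z)
  ind : ∀ (n : ℕ) (F : MvPolynomial ι k), MvPolynomial.aeval z F ∈ Ideal.span (Set.range z) ^ n →
    ∀ α, α.degree < n → F.coeff α = 0
  loc : ∀ o ∈ IsLocalRing.maximalIdeal X, ψ o ∈ Ideal.span (Set.range z)
  cof : ∀ n, ∃ h, ∀ o, ψ o ∈ Ideal.span (Set.range z) ^ h → o ∈ IsLocalRing.maximalIdeal X ^ n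
  dense : ∀ α, Finsupp.weight r α = 0 → ∀ n, ∃ o,
    MvPolynomial.aeval z (MvPolynomial.monomial α (1 : k)) - ψ o ∈ Ideal.span (Set.range z) ^ n
  hom : ∀ (o : X) (n : ℕ) (F : MvPolynomial ι k),
    ψ o - MvPolynomial.aeval z F ∈ Ideal.span (Set.range z) ^ n →
      ∀ α, α.degree < n → Finsupp.weight r α ≠ 0 → F.coeff α = 0

namespace IsWeightedChart

variable {ψ : X →ₐ[k] T} {z : ι → T} {r : ι → M} (H : IsWeightedChart ψ z r)

-- The completion uses the maximal ideal of X, while approximation is measured in T. The function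
-- comparing the two is made monotone and at least the identity, so that it can serve as a
-- reindexing.
include H in
lemma exists_bound : ∃ h : ℕ → ℕ, Monotone h ∧ (∀ n, n ≤ h n) ∧
    ∀ n o, ψ o ∈ Ideal.span (Set.range z) ^ h n → o ∈ IsLocalRing.maximalIdeal X ^ n := by
  choose h hh using H.cof
  refine ⟨fun n => (∑ j ∈ Finset.range (n + 1), h j) + n, ?_, fun n => Nat.le_add_left _ _,
    fun n o ho => hh n o (Ideal.pow_le_pow_right ?_ ho)⟩
  · intro a b hab
    exact add_le_add (Finset.sum_le_sum_of_subset (Finset.range_mono (by omega))) hab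
  · exact (Finset.single_le_sum (f := h) (fun _ _ => Nat.zero_le _)
      (Finset.self_mem_range_succ n)).trans (Nat.le_add_right _ _)

include H in
lemma map_mem_pow {n : ℕ} {o : X} (ho : o ∈ IsLocalRing.maximalIdeal X ^ n) :
    ψ o ∈ Ideal.span (Set.range z) ^ n := by
  have h : (IsLocalRing.maximalIdeal X).map (ψ : X →+* T) ≤ Ideal.span (Set.range z) :=
    Ideal.map_le_iff_le_comap.2 H.loc
  have h2 := Ideal.mem_map_of_mem (ψ : X →+* T) ho
  rw [Ideal.map_pow] at h2
  exact Ideal.pow_right_mono h n h2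

include H in
lemma exists_approx (n : ℕ) (F : MvPolynomial ι k)
    (hF : ∀ α, Finsupp.weight r α ≠ 0 → F.coeff α = 0) :
    ∃ o, ψ o - MvPolynomial.aeval z F ∈ Ideal.span (Set.range z) ^ n := by
  classical
  have h : ∀ α, ∃ o, ψ o - MvPolynomial.aeval z (MvPolynomial.monomial α (F.coeff α)) ∈
      Ideal.span (Set.range z) ^ n := by
    intro α
    by_cases hα : Finsupp.weight r α = 0
    · obtain ⟨o, ho⟩ := H.dense α hα n
      refine ⟨F.coeff α • o, ?_⟩
      have h2 : MvPolynomial.monomial α (F.coeff α) =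
          F.coeff α • MvPolynomial.monomial α (1 : k) := by
        rw [MvPolynomial.smul_monomial, smul_eq_mul, mul_one]
      rw [h2, map_smul, map_smul, ← smul_sub, ← neg_sub, smul_neg, neg_mem_iff,
        Algebra.smul_def]
      exact Ideal.mul_mem_left _ _ ho
    · exact ⟨0, by simp [hF α hα]⟩
  choose o ho using h
  refine ⟨∑ α ∈ F.support, o α, ?_⟩
  conv => enter [2, 2, 2]; rw [F.as_sum]
  rw [map_sum, map_sum, ← Finset.sum_sub_distrib]
  exact Ideal.sum_mem _ fun α _ => ho α

variable [Finite ι]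

variable (ψ z) in
/-- A power series and an element of the completion which have the same truncations. -/
def Agree (f : MvPowerSeries ι k) (x : AdicCompletion (IsLocalRing.maximalIdeal X) X) : Prop :=
  ∀ n, ∃ o, AdicCompletion.evalₐ (IsLocalRing.maximalIdeal X) n x = Ideal.Quotient.mk _ o ∧
    ψ o - truncEval z n f ∈ Ideal.span (Set.range z) ^ n

-- Representatives at level h n agree in T to order h n, so by `cof` they agree modulo the n-th
-- power of the maximal ideal of X.
include H in
lemma agree_unique {f : MvPowerSeries ι k}
    {x y : AdicCompletion (IsLocalRing.maximalIdeal X) X} (hx : Agree ψ z f x)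
    (hy : Agree ψ z f y) : x = y := by
  obtain ⟨h, -, hle, hc⟩ := H.exists_bound
  refine AdicCompletion.ext_evalₐ fun n => ?_
  obtain ⟨o, ho, ho'⟩ := hx (h n)
  obtain ⟨q, hq, hq'⟩ := hy (h n)
  have hsub : ψ (o - q) ∈ Ideal.span (Set.range z) ^ h n := by
    have := sub_mem ho' hq'
    rwa [sub_sub_sub_cancel_right, ← map_sub] at this
  -- A representative at the deeper level h n also represents at level n, because n ≤ h n.
  have key : ∀ (w : AdicCompletion (IsLocalRing.maximalIdeal X) X) (a : X),
      AdicCompletion.evalₐ (IsLocalRing.maximalIdeal X) (h n) w = Ideal.Quotient.mk _ a →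
      AdicCompletion.evalₐ (IsLocalRing.maximalIdeal X) n w = Ideal.Quotient.mk _ a := by
    intro w a hw
    obtain ⟨s, rfl⟩ := AdicCompletion.mk_surjective _ _ w
    rw [AdicCompletion.evalₐ_mk] at hw ⊢
    rw [← AdicCompletion.Ideal.mk_eq_mk _ (hle n)]
    rw [Ideal.Quotient.eq] at hw ⊢
    exact Ideal.pow_le_pow_right (hle n) hw
  rw [key x o ho, key y q hq, Ideal.Quotient.eq]
  exact hc n _ hsub

-- Density gives approximations of the truncations whose images are Cauchy in T. Reindexing by the
-- function h makes the sequence Cauchy for the maximal ideal of X.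
include H in
lemma exists_agree {f : MvPowerSeries ι k} (hf : f ∈ psGrading k r 0) :
    ∃ x, Agree ψ z f x := by
  obtain ⟨h, hmono, hle, hc⟩ := H.exists_bound
  have hap : ∀ n, ∃ o, ψ o - truncEval z n f ∈ Ideal.span (Set.range z) ^ n := fun n =>
    H.exists_approx n _ fun α hα => by
      rw [MvPowerSeries.coeff_truncTotal_eq_ite, hf α hα, ite_self]
  choose o ho using hap
  have hco : ∀ n m, n ≤ m → ψ (o m) - truncEval z n f ∈ Ideal.span (Set.range z) ^ n := by
    intro n m hnm
    have := add_mem (Ideal.pow_le_pow_right hnm (ho m)) (truncEval_sub_mem z hnm f)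
    simpa using this
  refine ⟨AdicCompletion.mk _ _ (AdicCompletion.AdicCauchySequence.mk
    (IsLocalRing.maximalIdeal X) X (fun n => o (h n)) fun n => ?_), fun n =>
    ⟨o (h n), ?_, hco n _ (hle n)⟩⟩
  · rw [SModEq.sub_mem]
    simp only [smul_eq_mul, Ideal.mul_top]
    refine hc n _ ?_
    have := sub_mem (ho (h n)) (hco (h n) (h (n + 1)) (hmono n.le_succ))
    rwa [sub_sub_sub_cancel_right, ← map_sub] at this
  · rw [AdicCompletion.evalₐ_mk]
    rfl

-- Expanding the terms of a Cauchy sequence in the coordinates gives polynomials whose coefficients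
-- stabilize by independence. The coefficient at α is read off at level deg α + 1, the first at
-- which it is determined, and `hom` forces it to vanish unless α has weight zero.
include H in
lemma exists_agree_right (x : AdicCompletion (IsLocalRing.maximalIdeal X) X) :
    ∃ f ∈ psGrading k r 0, Agree ψ z f x := by
  obtain ⟨s, rfl⟩ := AdicCompletion.mk_surjective _ _ x
  choose F hF using fun n => exists_aeval_sub_mem H.exp n (ψ (s n))
  have hs : ∀ n m, n ≤ m → ψ (s m) - ψ (s n) ∈ Ideal.span (Set.range z) ^ n := by
    intro n m hnm
    have h1 := AdicCompletion.Ideal.mk_eq_mk _ hnm s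
    rw [Ideal.Quotient.eq] at h1
    rw [← map_sub]
    exact H.map_mem_pow h1
  have hco : ∀ n m, n ≤ m → ∀ α, α.degree < n → (F m).coeff α = (F n).coeff α := by
    intro n m hnm α hα
    rw [← sub_eq_zero, ← MvPolynomial.coeff_sub]
    refine H.ind n _ ?_ α hα
    have := add_mem (sub_mem (hF n) (Ideal.pow_le_pow_right hnm (hF m))) (hs n m hnm)
    rw [map_sub]
    convert this using 1
    ring
  refine ⟨fun α => (F (α.degree + 1)).coeff α, fun α hα =>
    H.hom (s (α.degree + 1)) (α.degree + 1) _ (hF _) α (Nat.lt_succ_self _) hα, fun n =>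
    ⟨s n, AdicCompletion.evalₐ_mk _ _ _, ?_⟩⟩
  have h2 : MvPolynomial.aeval z (F n) - truncEval z n
      (fun α => (F (α.degree + 1)).coeff α : MvPowerSeries ι k) ∈ Ideal.span (Set.range z) ^ n :=
    aeval_sub_truncEval_mem z _ _ fun α hα => hco (α.degree + 1) n hα α (Nat.lt_succ_self _)
  have := add_mem (hF n) h2
  simpa using this

include H in
lemma agree_unique_left {f g : MvPowerSeries ι k}
    {x : AdicCompletion (IsLocalRing.maximalIdeal X) X} (hf : Agree ψ z f x)
    (hg : Agree ψ z g x) : f = g := by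
  refine MvPowerSeries.ext fun α => ?_
  set n := α.degree + 1
  have hα : α.degree < n := Nat.lt_succ_self _
  obtain ⟨o, ho, ho'⟩ := hf n
  obtain ⟨q, hq, hq'⟩ := hg n
  rw [ho, Ideal.Quotient.eq] at hq
  have h1 := H.map_mem_pow hq
  rw [map_sub] at h1
  have h2 := sub_mem (add_mem h1 hq') ho'
  have h3 : truncEval z n f - truncEval z n g ∈ Ideal.span (Set.range z) ^ n := by
    convert h2 using 1
    ring
  rw [truncEval_apply] at h3
  rw [← coeff_eq_of_aeval_sub_truncEval_mem z H.ind _ g h3 α hα, MvPowerSeries.coeff_truncTotal _ hα]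

lemma Agree.add {f g : MvPowerSeries ι k} {x y : AdicCompletion (IsLocalRing.maximalIdeal X) X}
    (hf : Agree ψ z f x) (hg : Agree ψ z g y) : Agree ψ z (f + g) (x + y) := fun n => by
  obtain ⟨o, ho, ho'⟩ := hf n
  obtain ⟨q, hq, hq'⟩ := hg n
  refine ⟨o + q, by rw [map_add, ho, hq, map_add], ?_⟩
  rw [map_add, map_add, add_sub_add_comm]
  exact add_mem ho' hq'

lemma Agree.mul {f g : MvPowerSeries ι k} {x y : AdicCompletion (IsLocalRing.maximalIdeal X) X}
    (hf : Agree ψ z f x) (hg : Agree ψ z g y) : Agree ψ z (f * g) (x * y) := fun n => by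
  obtain ⟨o, ho, ho'⟩ := hf n
  obtain ⟨q, hq, hq'⟩ := hg n
  refine ⟨o * q, by rw [map_mul, ho, hq, map_mul], ?_⟩
  have h := sub_mem (add_mem (Ideal.mul_mem_left _ (ψ q) ho')
    (Ideal.mul_mem_left _ (truncEval z n f) hq')) (truncEval_mul_sub_mem z n f g)
  rw [map_mul]
  convert h using 1
  ring

lemma Agree.scalar (c : k) : Agree ψ z (algebraMap k (MvPowerSeries ι k) c)
    (algebraMap k (AdicCompletion (IsLocalRing.maximalIdeal X) X) c) := fun n => by
  refine ⟨algebraMap k X c, ?_, ?_⟩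
  · rw [AdicCompletion.algebraMap_apply]
    exact AdicCompletion.evalₐ_of _ _ _
  · rw [AlgHom.commutes, Algebra.algebraMap_eq_smul_one, Algebra.algebraMap_eq_smul_one, map_smul,
      ← smul_sub, Algebra.smul_def]
    exact Ideal.mul_mem_left _ _ (truncEval_one_sub_mem z n)

/-- The isomorphism between the power series of weight zero and the completion. -/
def equiv : psGrading k r 0 ≃ₐ[k] AdicCompletion (IsLocalRing.maximalIdeal X) X :=
  AlgEquiv.ofBijective
    { toFun := fun f => (H.exists_agree f.2).choose
      map_one' := H.agree_unique (H.exists_agree (1 : psGrading k r 0).2).choose_spec <| by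
        have := Agree.scalar (ψ := ψ) (z := z) 1
        rwa [map_one, map_one] at this
      map_zero' := H.agree_unique (H.exists_agree (0 : psGrading k r 0).2).choose_spec <| by
        have := Agree.scalar (ψ := ψ) (z := z) 0
        rwa [map_zero, map_zero] at this
      map_add' := fun f g => H.agree_unique (H.exists_agree (f + g).2).choose_spec <|
        (H.exists_agree f.2).choose_spec.add (H.exists_agree g.2).choose_spec
      map_mul' := fun f g => H.agree_unique (H.exists_agree (f * g).2).choose_spec <|
        (H.exists_agree f.2).choose_spec.mul (H.exists_agree g.2).choose_spec
      commutes' := fun c => H.agree_unique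
        (H.exists_agree (algebraMap k (psGrading k r 0) c).2).choose_spec <|
          Agree.scalar c }
    ⟨fun f g h => Subtype.ext <| H.agree_unique_left (H.exists_agree f.2).choose_spec <| by
        have h2 := (H.exists_agree g.2).choose_spec
        have h3 : (H.exists_agree f.2).choose = (H.exists_agree g.2).choose := h
        rwa [← h3] at h2,
      fun x => by
        obtain ⟨f, hf, hx⟩ := H.exists_agree_right x
        exact ⟨⟨f, hf⟩, H.agree_unique (H.exists_agree hf).choose_spec hx⟩⟩

lemma agree_equiv (f : psGrading k r 0) : Agree ψ z (f : MvPowerSeries ι k) (H.equiv f) :=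
  (H.exists_agree f.2).choose_spec

/-- Together `hB` and `hB'` say that B is the contraction of the ideal of one coordinate, up to
errors which are small in both topologies. Membership can then be tested on truncations, where
divisibility by a variable is visible on coefficients. -/
lemma equiv_mem_iff [IsNoetherianRing X] (B : Ideal X) (c : ι)
    (hB : ∀ o ∈ B, ψ o ∈ Ideal.span {z c})
    (hB' : ∀ n, ∃ h, ∀ o, ψ o ∈ Ideal.span {z c} ⊔ Ideal.span (Set.range z) ^ h →
      o ∈ B ⊔ IsLocalRing.maximalIdeal X ^ n) (f : psGrading k r 0) :
    H.equiv f ∈ B.map (algebraMap X (AdicCompletion (IsLocalRing.maximalIdeal X) X)) ↔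
      (f : MvPowerSeries ι k) ∈ Ideal.span {(MvPowerSeries.X c : MvPowerSeries ι k)} := by
  rw [mem_map_adicCompletion_iff, Ideal.mem_span_singleton, MvPowerSeries.X_dvd_iff]
  constructor
  · intro h α hα
    set n := α.degree + 1
    have hn : α.degree < n := Nat.lt_succ_self _
    obtain ⟨b, hb, hbx⟩ := h n
    obtain ⟨o, ho, ho'⟩ := H.agree_equiv f n
    rw [hbx, Ideal.Quotient.eq] at ho
    have h1 := H.map_mem_pow ho
    rw [map_sub] at h1
    obtain ⟨t, ht⟩ := Ideal.mem_span_singleton.1 (hB b hb)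
    obtain ⟨G, hG⟩ := exists_aeval_sub_mem H.exp n t
    have h2 := sub_mem (add_mem h1 ho') (Ideal.mul_mem_left _ (z c) hG)
    have h3 : MvPolynomial.aeval z (MvPolynomial.X c * G) - truncEval z n
        (f : MvPowerSeries ι k) ∈ Ideal.span (Set.range z) ^ n := by
      convert h2 using 1
      rw [map_mul, MvPolynomial.aeval_X, ht]
      ring
    rw [← coeff_eq_of_aeval_sub_truncEval_mem z H.ind _ _ h3 α hn]
    exact mvPolynomial_X_dvd_iff.1 (Dvd.intro _ rfl) α hα
  · intro h n
    obtain ⟨m, hm⟩ := hB' n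
    -- Level m + n serves two purposes: order m is needed to apply `hm`, and order n to read the
    -- truncation in the completion.
    obtain ⟨o, ho, ho'⟩ := H.agree_equiv f (m + n)
    have h1 : truncEval z (m + n) (f : MvPowerSeries ι k) ∈ Ideal.span {z c} := by
      rw [truncEval_apply, Ideal.mem_span_singleton]
      have : MvPolynomial.X c ∣ MvPowerSeries.truncTotal (m + n) (f : MvPowerSeries ι k) := by
        rw [mvPolynomial_X_dvd_iff]
        intro α hα
        rw [MvPowerSeries.coeff_truncTotal_eq_ite, h α hα, ite_self]
      obtain ⟨G, hG⟩ := this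
      exact ⟨MvPolynomial.aeval z G, by rw [hG, map_mul, MvPolynomial.aeval_X]⟩
    have h2 : ψ o ∈ Ideal.span {z c} ⊔ Ideal.span (Set.range z) ^ m := by
      have := add_mem (Ideal.mem_sup_right (S := Ideal.span {z c})
        (Ideal.pow_le_pow_right (Nat.le_add_right m n) ho')) (Ideal.mem_sup_left h1)
      simpa using this
    obtain ⟨b, hb, e, he, hbe⟩ := Submodule.mem_sup.1 (hm o h2)
    refine ⟨b, hb, ?_⟩
    obtain ⟨s, hs⟩ := AdicCompletion.mk_surjective _ _ (H.equiv f)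
    rw [← hs, AdicCompletion.evalₐ_mk] at ho ⊢
    rw [← AdicCompletion.Ideal.mk_eq_mk _ (Nat.le_add_left n m)]
    rw [Ideal.Quotient.eq] at ho ⊢
    have := add_mem (Ideal.pow_le_pow_right (Nat.le_add_left n m) ho) he
    rw [← hbe] at this
    convert this using 1
    ring

include H in
/-- The action on power series required of a cyclic quotient singularity. -/
lemma exists_action [Fintype M] [DecidableEq M] [IsNoetherianRing X] (B : Ideal X) (c : ι)
    (hB : ∀ o ∈ B, ψ o ∈ Ideal.span {z c})
    (hB' : ∀ n, ∃ h, ∀ o, ψ o ∈ Ideal.span {z c} ⊔ Ideal.span (Set.range z) ^ h →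
      o ∈ B ⊔ IsLocalRing.maximalIdeal X ^ n) :
    ∃ (𝒜 : M → Submodule k (MvPowerSeries ι k)) (_ : GradedAlgebra 𝒜),
    (∀ c : M, c ≠ 0 → ∀ f ∈ 𝒜 c, f ∈ IsLocalRing.maximalIdeal (MvPowerSeries ι k)) ∧
    (∀ i, MvPowerSeries.X i ∈ 𝒜 (r i)) ∧
    ∃ e : 𝒜 0 ≃ₐ[k] AdicCompletion (IsLocalRing.maximalIdeal X) X,
      ∀ f : 𝒜 0,
        e f ∈ B.map (algebraMap X (AdicCompletion (IsLocalRing.maximalIdeal X) X)) ↔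
          (f : MvPowerSeries ι k) ∈ Ideal.span {MvPowerSeries.X c} := by
  refine ⟨psGrading k r, psGrading_gradedAlgebra k r, ?_, ?_, H.equiv, H.equiv_mem_iff B c hB hB'⟩
  · intro c hc f hf
    rw [IsLocalRing.mem_maximalIdeal, mem_nonunits_iff, MvPowerSeries.isUnit_iff_constantCoeff]
    have : MvPowerSeries.coeff 0 f = 0 := hf 0 (by rw [map_zero]; exact hc.symm)
    rw [← MvPowerSeries.coeff_zero_eq_constantCoeff_apply, this]
    exact not_isUnit_zero
  · intro i α hα
    classical
    rw [MvPowerSeries.coeff_X, if_neg]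
    rintro rfl
    simp [Finsupp.weight_single] at hα

end IsWeightedChart

end Completion

end AlphaP
end

noncomputable section

namespace AlphaP

/-! ### Derivations in characteristic `p` -/

section Derivations

variable {k F : Type*} [CommRing k] [Field F] [Algebra k F]

lemma iterate_add (Δ : Derivation k F F) (n : ℕ) (a b : F) :
    Δ^[n] (a + b) = Δ^[n] a + Δ^[n] b := by
  induction n generalizing a b with
  | zero => rfl
  | succ n ih => rw [Function.iterate_succ_apply, map_add, ih]; rfl

lemma iterate_const_mul (Δ : Derivation k F F) {c : F} (hc : Δ c = 0) (n : ℕ) (f : F) :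
    Δ^[n] (c * f) = c * Δ^[n] f := by
  induction n generalizing f with
  | zero => rfl
  | succ n ih =>
    rw [Function.iterate_succ_apply, Derivation.leibniz, hc, smul_zero, add_zero, smul_eq_mul, ih]
    rfl

lemma iterate_zero_eq (Δ : Derivation k F F) (n : ℕ) : Δ^[n] (0 : F) = 0 := by
  induction n with
  | zero => rfl
  | succ n ih => rw [Function.iterate_succ_apply, map_zero, ih]

lemma iterate_of_const (Δ : Derivation k F F) {c : F} (hc : Δ c = 0) {n : ℕ} (hn : n ≠ 0) :
    Δ^[n] c = 0 := by
  obtain ⟨m, rfl⟩ := Nat.exists_eq_succ_of_ne_zero hn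
  rw [Function.iterate_succ_apply, hc, iterate_zero_eq]

lemma leibniz_iterate (Δ : Derivation k F F) (n : ℕ) (a b : F) :
    Δ^[n] (a * b) = ∑ x ∈ Finset.HasAntidiagonal.antidiagonal n,
      (n.choose x.1 : F) * (Δ^[x.1] a * Δ^[x.2] b) := by
  induction n with
  | zero => simp
  | succ n ih =>
    rw [Function.iterate_succ_apply', ih, map_sum]
    have h : ∀ x : ℕ × ℕ, Δ ((n.choose x.1 : F) * (Δ^[x.1] a * Δ^[x.2] b)) =
        (n.choose x.1 : F) * (Δ^[x.1 + 1] a * Δ^[x.2] b) +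
          (n.choose x.1 : F) * (Δ^[x.1] a * Δ^[x.2 + 1] b) := by
      intro x
      rw [Derivation.leibniz, Derivation.map_natCast, Derivation.leibniz,
        Function.iterate_succ_apply', Function.iterate_succ_apply']
      simp only [smul_eq_mul]
      ring
    rw [Finset.sum_congr rfl fun x _ => h x, Finset.sum_add_distrib]
    rw [Finset.sum_antidiagonal_choose_succ_mul (fun i j => Δ^[i] a * Δ^[j] b), add_comm]
    refine congrArg _ (Finset.sum_congr rfl fun x hx => ?_)
    rw [Nat.choose_symm_of_eq_add (Finset.HasAntidiagonal.mem_antidiagonal.1 hx).symm]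

variable {p : ℕ} [hp : Fact p.Prime] [CharP F p]

/-- The `p`-th iterate of a derivation in characteristic `p` is a derivation. -/
def iterateDerivation (Δ : Derivation k F F) : Derivation k F F :=
  Derivation.mk' ((Δ : F →ₗ[k] F) ^ p) fun a b => by
    have hl : ∀ f : F, ((Δ : F →ₗ[k] F) ^ p) f = Δ^[p] f := fun f => by
      rw [Module.End.coe_pow]; rfl
    have hp0 : p ≠ 0 := hp.out.ne_zero
    rw [hl, hl, hl, leibniz_iterate, ← Finset.sum_subset (s₁ := {(0, p), (p, 0)})]
    · rw [Finset.sum_pair (by simp [hp0.symm])]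
      simp only [Nat.choose_zero_right, Nat.choose_self, Nat.cast_one, one_mul, smul_eq_mul,
        Function.iterate_zero, id]
      ring
    · intro x hx
      simp only [Finset.mem_insert, Finset.mem_singleton] at hx
      rw [Finset.HasAntidiagonal.mem_antidiagonal]
      rcases hx with rfl | rfl <;> simp
    · rintro ⟨i, j⟩ hx hx'
      rw [Finset.HasAntidiagonal.mem_antidiagonal] at hx
      simp only [Finset.mem_insert, Finset.mem_singleton, Prod.mk.injEq, not_or, not_and] at hx'
      have h1 : i ≠ 0 := fun h => hx'.1 h (by simpa [h] using hx)
      have h2 : i ≠ p := fun h => hx'.2 h (by simpa [h] using hx)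
      have h3 : (p.choose i : F) = 0 := by
        rw [CharP.cast_eq_zero_iff F p]
        exact hp.out.dvd_choose_self h1 (by simp only at hx; omega)
      simp only [h3, zero_mul]

lemma iterateDerivation_apply (Δ : Derivation k F F) (f : F) :
    iterateDerivation (p := p) Δ f = Δ^[p] f := by
  change ((Δ : F →ₗ[k] F) ^ p) f = _
  rw [Module.End.coe_pow]; rfl

omit hp in
lemma natCast_factorial_ne_zero [hp : Fact p.Prime] {n : ℕ} (hn : n < p) :
    (n.factorial : F) ≠ 0 := by
  rw [Ne, CharP.cast_eq_zero_iff F p, hp.out.dvd_factorial]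
  omega

/-- An element killed by `Δ^m`, `m ≤ p`, is a polynomial in `y`, where `Δ y = 1`, of degree less
than `m` with constant coefficients. -/
lemma exists_expansion (Δ : Derivation k F F) {y : F} (hy : Δ y = 1) :
    ∀ m, m ≤ p → ∀ f, Δ^[m] f = 0 → ∃ c : ℕ → F, (∀ n, Δ (c n) = 0) ∧
      f = ∑ n ∈ Finset.range m, c n * y ^ n := by
  have hpow : ∀ m, Δ^[m] (y ^ m) = m.factorial := by
    have hlt : ∀ m n, n < m → Δ^[m] (y ^ n) = 0 ∧ Δ^[n] (y ^ n) = n.factorial := by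
      intro m
      induction m with
      | zero => intro n hn; omega
      | succ m ih =>
        intro n hn
        rcases n with _ | n
        · refine ⟨?_, by simp⟩
          rw [pow_zero]
          exact iterate_of_const Δ (Derivation.map_one_eq_zero Δ) (Nat.succ_ne_zero m)
        · have h1 : Δ (y ^ (n + 1)) = ((n + 1 : ℕ) : F) * y ^ n := by
            rw [Derivation.leibniz_pow, hy]
            simp
          have hc : Δ (((n + 1 : ℕ) : F)) = 0 := Derivation.map_natCast _ _
          have h2 := ih n (by omega)
          refine ⟨?_, ?_⟩
          · rw [Function.iterate_succ_apply, h1, iterate_const_mul Δ hc, h2.1, mul_zero]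
          · rw [Function.iterate_succ_apply, h1, iterate_const_mul Δ hc, h2.2]
            push_cast [Nat.factorial_succ]
            ring
    exact fun m => (hlt (m + 1) m (Nat.lt_succ_self m)).2
  intro m
  induction m with
  | zero => intro _ f hf; exact ⟨fun _ => 0, fun _ => map_zero _, by simpa using hf⟩
  | succ m ih =>
    intro hm f hf
    have hfac : (m.factorial : F) ≠ 0 := natCast_factorial_ne_zero (p := p) (by omega)
    -- The leading Taylor coefficient. It is constant because Δ^{m+1} f = 0, and m < p makes m!
    -- invertible. Subtracting g y^m lowers the order.
    set g := Δ^[m] f * (m.factorial : F)⁻¹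
    have hg : Δ g = 0 := by
      have h1 : Δ (Δ^[m] f) = 0 := by rwa [Function.iterate_succ_apply'] at hf
      have h2 : Δ ((m.factorial : F)⁻¹) = 0 := by
        rw [Derivation.leibniz_inv, Derivation.map_natCast, smul_zero]
      rw [Derivation.leibniz, h1, h2, smul_zero, smul_zero, add_zero]
    obtain ⟨c, hc, hfc⟩ := ih (by omega) (f - g * y ^ m) (by
      rw [sub_eq_add_neg, iterate_add, ← neg_mul, iterate_const_mul Δ (by rw [map_neg, hg, neg_zero]),
        hpow, neg_mul, inv_mul_cancel_right₀ hfac, add_neg_cancel])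
    refine ⟨Function.update c m g, fun n => ?_, ?_⟩
    · by_cases h : n = m
      · subst h; rwa [Function.update_self]
      · rw [Function.update_of_ne h]; exact hc n
    · rw [Finset.sum_range_succ, Function.update_self, Finset.sum_congr rfl (g := fun n => c n * y ^ n)
        fun n hn => by rw [Function.update_of_ne (Finset.mem_range.1 hn).ne], ← hfc, sub_add_cancel]

/-- A multiple of a `p`-nilpotent derivation with a slice which has itself a slice is
`p`-nilpotent. -/
lemma iterate_smul_eq_zero (δ : Derivation k F F) (hδ : ∀ f, δ^[p] f = 0) {s : F} (hs : δ s = 1)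
    {a y : F} (hy : a * δ y = 1) (f : F) : (a • δ)^[p] f = 0 := by
  have h0 : ∀ c, δ c = 0 → iterateDerivation (p := p) (a • δ) c = 0 := fun c hc => by
    rw [iterateDerivation_apply]
    exact iterate_of_const _ (by rw [Derivation.smul_apply, hc, smul_zero]) hp.out.ne_zero
  -- The p-th iterate of aδ is again a derivation and it kills the constants of δ. The field is
  -- generated over these constants by s, so this iterate is a multiple of δ.
  have hE : ∀ f, iterateDerivation (p := p) (a • δ) f =
      iterateDerivation (p := p) (a • δ) s * δ f := by
    intro f
    obtain ⟨c, hc, rfl⟩ := exists_expansion δ hs p le_rfl f (hδ f)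
    rw [map_sum, map_sum, Finset.mul_sum]
    refine Finset.sum_congr rfl fun n _ => ?_
    rw [Derivation.leibniz, Derivation.leibniz, h0 _ (hc n), hc n, Derivation.leibniz_pow,
      Derivation.leibniz_pow, hs]
    simp only [smul_eq_mul, nsmul_eq_mul]
    ring
  -- Since (aδ)y = 1 and p ≥ 2, further iteration kills y. As δ y ≠ 0, the multiplier found above
  -- must be zero.
  have hy' : iterateDerivation (p := p) (a • δ) y = 0 := by
    rw [iterateDerivation_apply, ← Nat.succ_pred_eq_of_pos hp.out.pos,
      Function.iterate_succ_apply, Derivation.smul_apply, smul_eq_mul, hy]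
    exact iterate_of_const _ (Derivation.map_one_eq_zero _) (by have := hp.out.two_le; simp; omega)
  rw [hE y, mul_eq_zero] at hy'
  rw [← iterateDerivation_apply, hE f]
  rcases hy' with h | h
  · rw [h, zero_mul]
  · rw [h, mul_zero] at hy; exact absurd hy zero_ne_one

variable (p) in
/-- The projection `f ↦ ∑_{n < p} (-y)^n / n! * Δ^n f` to the constants of `Δ`. -/
def constProj (Δ : Derivation k F F) (y f : F) : F :=
  ∑ n ∈ Finset.range p, (-y) ^ n * (n.factorial : F)⁻¹ * Δ^[n] f

section constProj

variable (Δ : Derivation k F F) {y : F}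

omit hp [CharP F p] in
lemma constProj_add (f g : F) : constProj p Δ y (f + g) = constProj p Δ y f + constProj p Δ y g := by
  simp only [constProj, iterate_add, mul_add, Finset.sum_add_distrib]

omit hp [CharP F p] in
lemma constProj_const_mul {c : F} (hc : Δ c = 0) (f : F) :
    constProj p Δ y (c * f) = c * constProj p Δ y f := by
  simp only [constProj, Finset.mul_sum]
  refine Finset.sum_congr rfl fun n _ => ?_
  rw [iterate_const_mul Δ hc]; ring

omit [CharP F p] in
lemma constProj_of_const {c : F} (hc : Δ c = 0) : constProj p Δ y c = c := by
  rw [constProj, ← Nat.succ_pred_eq_of_pos hp.out.pos, Finset.sum_range_succ',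
    Finset.sum_eq_zero]
  · simp
  · intro n _
    rw [iterate_of_const Δ hc (Nat.succ_ne_zero n), mul_zero]

/-- Applying Δ to a partial sum telescopes to one term containing the next iterate of f; for the
full sum this iterate is Δ^p f. -/
lemma apply_constProj (hΔ : ∀ f, Δ^[p] f = 0) (hy : Δ y = 1) (f : F) :
    Δ (constProj p Δ y f) = 0 := by
  have h : ∀ m, m + 1 ≤ p → Δ (∑ n ∈ Finset.range (m + 1),
      (-y) ^ n * (n.factorial : F)⁻¹ * Δ^[n] f) =
        (-y) ^ m * (m.factorial : F)⁻¹ * Δ^[m + 1] f := by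
    intro m
    induction m with
    | zero => intro _; simp
    | succ m ih =>
      intro hm
      have hfac : (m.factorial : F) ≠ 0 := natCast_factorial_ne_zero (p := p) (by omega)
      have hm0 : ((m + 1 : ℕ) : F) ≠ 0 := fun h0 => by
        rw [CharP.cast_eq_zero_iff F p] at h0
        exact absurd (Nat.le_of_dvd (Nat.succ_pos m) h0) (by omega)
      have hinv : Δ (((m + 1).factorial : F)⁻¹) = 0 := by
        rw [Derivation.leibniz_inv, Derivation.map_natCast, smul_zero]
      rw [Finset.sum_range_succ, map_add, ih (by omega), Derivation.leibniz, Derivation.leibniz,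
        hinv, Derivation.leibniz_pow, map_neg, hy, Function.iterate_succ_apply' (f := Δ) (n := m + 1)]
      simp only [Nat.add_sub_cancel, smul_eq_mul, nsmul_eq_mul,
        Nat.factorial_succ, Nat.cast_mul, mul_inv]
      field_simp
      ring
  have h2 := h (p - 1) (by have := hp.out.pos; omega)
  rw [Nat.sub_add_cancel hp.out.pos, hΔ, mul_zero] at h2
  exact h2

/-- The partial sums telescope again, leaving y times the last term. As Δ^{p-1} f is constant when
Δ^p = 0, the projection of a multiple of y is then a constant multiple of y^p; this makes y^p a
coordinate of the constants. -/
lemma constProj_mul_self (hy : Δ y = 1) (f : F) :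
    constProj p Δ y (y * f) =
      y ^ p * (-(-1) ^ p * ((p - 1).factorial : F)⁻¹ * Δ^[p - 1] f) := by
  have hit : ∀ n, Δ^[n] (y * f) = y * Δ^[n] f + n * Δ^[n - 1] f := by
    intro n
    induction n with
    | zero => simp
    | succ n ih =>
      rw [Function.iterate_succ_apply', ih, map_add, Derivation.leibniz, Derivation.leibniz, hy,
        Derivation.map_natCast, ← Function.iterate_succ_apply' (f := Δ)]
      rcases n with _ | n
      · simp
      · rw [← Function.iterate_succ_apply' (f := Δ)]
        simp only [smul_eq_mul, Nat.add_sub_cancel]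
        push_cast
        ring
  have hpartial : ∀ m, m + 1 ≤ p → ∑ n ∈ Finset.range (m + 1),
      (-y) ^ n * (n.factorial : F)⁻¹ * Δ^[n] (y * f) =
        y * ((-y) ^ m * (m.factorial : F)⁻¹ * Δ^[m] f) := by
    intro m
    induction m with
    | zero => intro _; simp
    | succ m ih =>
      intro hm
      have hfac : (m.factorial : F) ≠ 0 := natCast_factorial_ne_zero (p := p) (by omega)
      have hm0 : ((m + 1 : ℕ) : F) ≠ 0 := fun h0 => by
        rw [CharP.cast_eq_zero_iff F p] at h0
        exact absurd (Nat.le_of_dvd (Nat.succ_pos m) h0) (by omega)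
      rw [Finset.sum_range_succ, ih (by omega), hit]
      simp only [Nat.add_sub_cancel, Nat.factorial_succ, Nat.cast_mul, mul_inv]
      field_simp
      ring
  have h2 := hpartial (p - 1) (by have := hp.out.pos; omega)
  rw [Nat.sub_add_cancel hp.out.pos] at h2
  rw [constProj, h2]
  have h3 : y * (-y) ^ (p - 1) = -(-1) ^ p * y ^ p := by
    obtain ⟨q, rfl⟩ : ∃ q, p = q + 1 := ⟨p - 1, (Nat.sub_add_cancel hp.out.pos).symm⟩
    rw [Nat.add_sub_cancel, neg_pow y q]
    ring
  linear_combination (((p - 1).factorial : F)⁻¹ * Δ^[p - 1] f) * h3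

end constProj

end Derivations

end AlphaP
end

noncomputable section

namespace AlphaP

set_option linter.unusedSectionVars false

/-! ### The local ring of a rational point, inside the fraction field -/

section LocRing

variable {k A : Type*} (F : Type*) [Field k] [CommRing A] [IsDomain A] [Algebra k A] [Field F]
  [Algebra k F] [Algebra A F] [IsScalarTower k A F] [IsFractionRing A F] (ev : A →ₐ[k] k)

/-- The local ring of the rational point `ev`, as a subring of the fraction field. -/
def locRing : Subalgebra A F where
  carrier := {x | ∃ g : A, ev g ≠ 0 ∧ ∃ a : A, algebraMap A F g * x = algebraMap A F a}
  mul_mem' := by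
    rintro x y ⟨g, hg, a, ha⟩ ⟨g', hg', a', ha'⟩
    exact ⟨g * g', by rw [map_mul]; exact mul_ne_zero hg hg', a * a', by
      rw [map_mul, map_mul, ← ha, ← ha']; ring⟩
  add_mem' := by
    rintro x y ⟨g, hg, a, ha⟩ ⟨g', hg', a', ha'⟩
    exact ⟨g * g', by rw [map_mul]; exact mul_ne_zero hg hg', g' * a + g * a', by
      rw [map_mul, map_add, map_mul, map_mul, ← ha, ← ha']; ring⟩
  algebraMap_mem' a := ⟨1, by simp, a, by simp⟩

variable {F ev} in
lemma mem_locRing {x : F} : x ∈ locRing F ev ↔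
    ∃ g : A, ev g ≠ 0 ∧ ∃ a : A, algebraMap A F g * x = algebraMap A F a := Iff.rfl

lemma algebraMap_mem_locRing (a : A) : algebraMap A F a ∈ locRing F ev :=
  (locRing F ev).algebraMap_mem a

lemma scalar_mem_locRing (c : k) : algebraMap k F c ∈ locRing F ev := by
  rw [IsScalarTower.algebraMap_apply k A F]; exact algebraMap_mem_locRing F ev _

lemma algebraMap_ne_zero_of_ev {g : A} (hg : ev g ≠ 0) : algebraMap A F g ≠ 0 := by
  rw [Ne, IsFractionRing.to_map_eq_zero_iff]
  rintro rfl
  exact hg (map_zero ev)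

lemma inv_mem_locRing {g : A} (hg : ev g ≠ 0) : (algebraMap A F g)⁻¹ ∈ locRing F ev :=
  ⟨g, hg, 1, by rw [mul_inv_cancel₀ (algebraMap_ne_zero_of_ev F ev hg), map_one]⟩

/-- The extension of an ideal to the local ring of the point `ev`. -/
def locIdeal (I : Ideal A) : Submodule (locRing F ev) F where
  carrier := {x | ∃ g : A, ev g ≠ 0 ∧ ∃ a ∈ I, algebraMap A F g * x = algebraMap A F a}
  zero_mem' := ⟨1, by simp, 0, zero_mem I, by simp⟩
  add_mem' := by
    rintro x y ⟨g, hg, a, ha, h⟩ ⟨g', hg', a', ha', h'⟩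
    exact ⟨g * g', by rw [map_mul]; exact mul_ne_zero hg hg', g' * a + g * a',
      add_mem (I.mul_mem_left _ ha) (I.mul_mem_left _ ha'), by
      rw [map_mul, map_add, map_mul, map_mul, ← h, ← h']; ring⟩
  smul_mem' := by
    rintro ⟨x, g, hg, a, ha⟩ y ⟨g', hg', a', ha', h'⟩
    refine ⟨g * g', by rw [map_mul]; exact mul_ne_zero hg hg', a * a', I.mul_mem_left _ ha', ?_⟩
    rw [map_mul, map_mul, ← ha, ← h']
    change _ * (x * y) = _
    ring

variable {F ev}

lemma mem_locIdeal {I : Ideal A} {x : F} : x ∈ locIdeal F ev I ↔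
    ∃ g : A, ev g ≠ 0 ∧ ∃ a ∈ I, algebraMap A F g * x = algebraMap A F a := Iff.rfl

lemma algebraMap_mem_locIdeal {I : Ideal A} {a : A} (ha : a ∈ I) :
    algebraMap A F a ∈ locIdeal F ev I := ⟨1, by simp, a, ha, by simp⟩

lemma mem_locRing_of_mem_locIdeal {I : Ideal A} {x : F} (hx : x ∈ locIdeal F ev I) :
    x ∈ locRing F ev := by
  obtain ⟨g, hg, a, -, h⟩ := hx
  exact ⟨g, hg, a, h⟩

lemma locIdeal_top {x : F} : x ∈ locIdeal F ev ⊤ ↔ x ∈ locRing F ev := by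
  simp [mem_locIdeal, mem_locRing]

lemma locIdeal_mono {I J : Ideal A} (h : I ≤ J) : locIdeal F ev I ≤ locIdeal F ev J := by
  rintro x ⟨g, hg, a, ha, hx⟩
  exact ⟨g, hg, a, h ha, hx⟩

lemma mul_mem_locIdeal {I J : Ideal A} {x y : F} (hx : x ∈ locIdeal F ev I)
    (hy : y ∈ locIdeal F ev J) : x * y ∈ locIdeal F ev (I * J) := by
  obtain ⟨g, hg, a, ha, h⟩ := hx
  obtain ⟨g', hg', a', ha', h'⟩ := hy
  refine ⟨g * g', by rw [map_mul]; exact mul_ne_zero hg hg', a * a', Ideal.mul_mem_mul ha ha', ?_⟩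
  rw [map_mul, map_mul, ← h, ← h']; ring

lemma mul_mem_locIdeal_of_mem_locRing {I : Ideal A} {x y : F} (hx : x ∈ locRing F ev)
    (hy : y ∈ locIdeal F ev I) : x * y ∈ locIdeal F ev I :=
  (locIdeal F ev I).smul_mem ⟨x, hx⟩ hy

lemma pow_mem_locIdeal {I : Ideal A} {x : F} (hx : x ∈ locIdeal F ev I) (n : ℕ) :
    x ^ n ∈ locIdeal F ev (I ^ n) := by
  induction n with
  | zero => rw [pow_zero, pow_zero, Ideal.one_eq_top, locIdeal_top]; exact one_mem _
  | succ n ih => rw [pow_succ, pow_succ]; exact mul_mem_locIdeal ih hx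

/-- Membership in the extension of a prime ideal contained in that of the point. -/
lemma algebraMap_mem_locIdeal_iff {Q : Ideal A} [Q.IsPrime] (hQ : Q ≤ RingHom.ker ev) {a : A} :
    algebraMap A F a ∈ locIdeal F ev Q ↔ a ∈ Q := by
  refine ⟨?_, algebraMap_mem_locIdeal⟩
  rintro ⟨g, hg, b, hb, h⟩
  rw [← map_mul] at h
  rw [← IsFractionRing.injective A F h] at hb
  exact (‹Q.IsPrime›.mem_or_mem hb).resolve_left fun h' => hg (hQ h')

lemma mem_locIdeal_or_mem_locIdeal {Q : Ideal A} [Q.IsPrime] (hQ : Q ≤ RingHom.ker ev) {x y : F}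
    (hx : x ∈ locRing F ev) (hy : y ∈ locRing F ev) (h : x * y ∈ locIdeal F ev Q) :
    x ∈ locIdeal F ev Q ∨ y ∈ locIdeal F ev Q := by
  obtain ⟨g, hg, a, ha⟩ := hx
  obtain ⟨g', hg', a', ha'⟩ := hy
  have h2 := mul_mem_locIdeal_of_mem_locRing (algebraMap_mem_locRing F ev (g * g')) h
  have h3 : algebraMap A F (g * g') * (x * y) = algebraMap A F (a * a') := by
    rw [map_mul, map_mul, ← ha, ← ha']; ring
  rw [h3, algebraMap_mem_locIdeal_iff hQ] at h2
  exact (‹Q.IsPrime›.mem_or_mem h2).imp (fun h => ⟨g, hg, a, h, ha⟩) fun h => ⟨g', hg', a', h, ha'⟩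

lemma one_notMem_locIdeal {Q : Ideal A} [Q.IsPrime] (hQ : Q ≤ RingHom.ker ev) :
    (1 : F) ∉ locIdeal F ev Q := by
  rw [← map_one (algebraMap A F), algebraMap_mem_locIdeal_iff hQ]
  exact fun h => (Ideal.ne_top_iff_one Q).1 ‹Q.IsPrime›.ne_top h

lemma inv_mem_locRing_of_notMem {x : F} (hx : x ∈ locRing F ev)
    (hx' : x ∉ locIdeal F ev (RingHom.ker ev)) : x⁻¹ ∈ locRing F ev := by
  obtain ⟨g, hg, a, ha⟩ := hx
  have ha0 : ev a ≠ 0 := fun h => hx' ⟨g, hg, a, h, ha⟩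
  have hx0 : x ≠ 0 := by
    rintro rfl
    exact hx' (zero_mem _)
  refine ⟨a, ha0, g, ?_⟩
  rw [← ha, mul_inv_cancel_right₀ hx0]

lemma exists_scalar_sub_mem {x : F} (hx : x ∈ locRing F ev) :
    ∃ c : k, x - algebraMap k F c ∈ locIdeal F ev (RingHom.ker ev) := by
  obtain ⟨g, hg, a, ha⟩ := hx
  refine ⟨(ev g)⁻¹ * ev a, g, hg, a - g * algebraMap k A ((ev g)⁻¹ * ev a), ?_, ?_⟩
  · rw [RingHom.mem_ker, map_sub, map_mul, AlgHom.commutes, Algebra.algebraMap_self_apply,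
      mul_inv_cancel_left₀ hg, sub_self]
  · rw [mul_sub, ha, map_sub, map_mul (algebraMap A F), ← IsScalarTower.algebraMap_apply]

/-- Elements of the local ring are congruent to elements of `A` modulo every power of the maximal
ideal. -/
lemma exists_sub_mem_locIdeal_pow {x : F} (hx : x ∈ locRing F ev) (n : ℕ) :
    ∃ a : A, x - algebraMap A F a ∈ locIdeal F ev (RingHom.ker ev ^ n) := by
  obtain ⟨g, hg, a, ha⟩ := hx
  set e : A := 1 - algebraMap k A (ev g)⁻¹ * g
  have he : e ∈ RingHom.ker ev := by
    rw [RingHom.mem_ker, map_sub, map_one, map_mul, AlgHom.commutes,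
      Algebra.algebraMap_self_apply, inv_mul_cancel₀ hg, sub_self]
  -- With e = 1 - g / ev g in the maximal ideal, the truncated geometric series in e gives an
  -- inverse b of g modulo its n-th power.
  obtain ⟨b, hb⟩ : g ∣ 1 - e ^ n := by
    have h1 : (1 - e) ∣ 1 - e ^ n := by simpa using sub_dvd_pow_sub_pow 1 e n
    exact (Dvd.intro_left (algebraMap k A (ev g)⁻¹) (by simp [e])).trans h1
  refine ⟨b * a, g, hg, e ^ n * a, Ideal.mul_mem_right _ _ (Ideal.pow_mem_pow he n), ?_⟩
  have h2 : e ^ n = 1 - g * b := by rw [← hb]; ring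
  rw [mul_sub, ha, h2]
  simp only [map_mul, map_sub, map_one]
  ring

instance ker_isMaximal : (RingHom.ker ev).IsMaximal :=
  RingHom.ker_isMaximal_of_surjective ev fun c => ⟨algebraMap k A c, by simp⟩

variable (F ev) in
instance locRing_isLocalization : IsLocalization.AtPrime (locRing F ev) (RingHom.ker ev) where
  map_units g := by
    refine .of_mul_eq_one ⟨_, inv_mem_locRing F ev g.2⟩ (Subtype.ext ?_)
    exact mul_inv_cancel₀ (algebraMap_ne_zero_of_ev F ev g.2)
  surj := by
    rintro ⟨x, g, hg, a, ha⟩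
    refine ⟨⟨a, ⟨g, hg⟩⟩, Subtype.ext ?_⟩
    exact (mul_comm _ _).trans ha
  exists_of_eq {a b} h := ⟨1, by
    rw [IsFractionRing.injective A F (congrArg Subtype.val h)]⟩

variable (F ev) in
lemma locRing_integrallyClosed [IsIntegrallyClosed A] {x : F}
    (hx : IsIntegral (locRing F ev) x) : x ∈ locRing F ev := by
  have h1 : IsIntegrallyClosed (locRing F ev) :=
    isIntegrallyClosed_of_isLocalization (locRing F ev) (RingHom.ker ev).primeCompl
      (RingHom.ker ev).primeCompl_le_nonZeroDivisors
  have h2 : IsFractionRing (locRing F ev) F :=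
    IsFractionRing.isFractionRing_of_isDomain_of_isLocalization (RingHom.ker ev).primeCompl _ _
  obtain ⟨y, hy⟩ := IsIntegrallyClosed.isIntegral_iff.1 hx
  rw [← hy]; exact y.2

/-- Divisibility of elements of `A` by a prime element vanishing at the point. -/
lemma dvd_of_mem_mul_locRing {h f : A} (hh : Prime h) (h0 : ev h = 0) {c : F}
    (hc : c ∈ locRing F ev) (hf : algebraMap A F f = algebraMap A F h * c) : h ∣ f := by
  obtain ⟨g, hg, a, ha⟩ := hc
  have h1 : g * f = h * a := by
    refine IsFractionRing.injective A F ?_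
    rw [map_mul, map_mul, hf, ← ha]; ring
  refine (hh.dvd_or_dvd (Dvd.intro a h1.symm)).resolve_left ?_
  rintro ⟨b, rfl⟩
  exact hg (by rw [map_mul, h0, zero_mul])

end LocRing

end AlphaP
end

noncomputable section

namespace AlphaP

set_option linter.unusedSectionVars false

/-! ### A rational point with a cyclic action and a `p`-nilpotent derivation -/

section FoliatedChart

/-- A rational point `ev` of `Spec A`, an automorphism `rot` of finite order prime to the
characteristic, a `p`-nilpotent derivation `Δ` with a slice on the fraction field, regular at the
point and equivariant up to a scalar, and an invariant prime divisor through the point. -/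
structure FoliatedChart (p : ℕ) (k A F : Type*) [Field k] [CommRing A] [IsDomain A] [Algebra k A]
    [Field F] [Algebra k F] [Algebra A F] [IsScalarTower k A F] [IsFractionRing A F] where
  /-- the point -/
  ev : A →ₐ[k] k
  /-- the automorphism -/
  rot : A ≃ₐ[k] A
  /-- its extension to the fraction field -/
  rotF : F ≃ₐ[k] F
  rotF_algebraMap : ∀ a, rotF (algebraMap A F a) = algebraMap A F (rot a)
  /-- the order of the automorphism -/
  order : ℕ
  order_ne_zero : (order : k) ≠ 0
  rot_iterate_order : ∀ a, rot^[order] a = a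
  /-- the derivation -/
  Δ : Derivation k F F
  Δ_iterate : ∀ f, Δ^[p] f = 0
  /-- the slice -/
  slice : A
  Δ_slice : Δ (algebraMap A F slice) = 1
  /-- the weight of the slice -/
  slope : k
  slope_ne_zero : slope ≠ 0
  rot_slice : rot slice = slope • slice
  Δ_rotF : ∀ f, Δ (rotF f) = slope • rotF (Δ f)
  Δ_mem : ∀ a, Δ (algebraMap A F a) ∈ locRing F ev
  /-- the equation of the divisor -/
  div : A
  div_prime : Prime div
  ev_div : ev div = 0
  /-- the weight of the equation of the divisor -/
  divWeight : k
  rot_div : rot div = divWeight • div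
  Δ_div : ∃ e ∈ locRing F ev, Δ (algebraMap A F div) = algebraMap A F div * e

variable {p : ℕ} {k A F : Type*} [Field k] [CommRing A] [IsDomain A] [Algebra k A]
    [Field F] [Algebra k F] [Algebra A F] [IsScalarTower k A F] [IsFractionRing A F]

namespace FoliatedChart

variable (S : FoliatedChart p k A F)

lemma order_pos : 0 < S.order := Nat.pos_of_ne_zero fun h => S.order_ne_zero (by simp [h])

lemma order_ne_zero' : (S.order : F) ≠ 0 := by
  rw [← map_natCast (algebraMap k F)]
  exact (map_ne_zero _).2 S.order_ne_zero

lemma rotF_iterate_algebraMap (n : ℕ) (a : A) :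
    S.rotF^[n] (algebraMap A F a) = algebraMap A F (S.rot^[n] a) := by
  induction n with
  | zero => rfl
  | succ n ih => rw [Function.iterate_succ_apply', Function.iterate_succ_apply', ih,
      S.rotF_algebraMap]

lemma rotF_iterate_order (x : F) : S.rotF^[S.order] x = x := by
  obtain ⟨a, b, -, rfl⟩ := IsFractionRing.div_surjective (A := A) x
  have h : ∀ n, S.rotF^[n] (algebraMap A F a / algebraMap A F b) =
      S.rotF^[n] (algebraMap A F a) / S.rotF^[n] (algebraMap A F b) := by
    intro n
    induction n with
    | zero => rfl
    | succ n ih => simp only [Function.iterate_succ_apply', ih, map_div₀]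
  rw [h, rotF_iterate_algebraMap, rotF_iterate_algebraMap, S.rot_iterate_order,
    S.rot_iterate_order]

lemma rotF_smul_iterate {c : k} {x : F} (hx : S.rotF x = c • x) (n : ℕ) :
    S.rotF^[n] x = c ^ n • x := by
  induction n with
  | zero => simp
  | succ n ih => rw [Function.iterate_succ_apply', ih, map_smul, hx, smul_smul, pow_succ]

lemma rotF_slice : S.rotF (algebraMap A F S.slice) = S.slope • algebraMap A F S.slice := by
  rw [S.rotF_algebraMap, S.rot_slice, algebraMap_smul_eq]
where
  algebraMap_smul_eq {c : k} {a : A} : algebraMap A F (c • a) = c • algebraMap A F a := by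
    rw [Algebra.smul_def, map_mul, ← IsScalarTower.algebraMap_apply, Algebra.smul_def]

lemma rotF_div : S.rotF (algebraMap A F S.div) = S.divWeight • algebraMap A F S.div := by
  rw [S.rotF_algebraMap, S.rot_div, rotF_slice.algebraMap_smul_eq]

lemma Δ_rotF_iterate (n : ℕ) (f : F) : S.Δ (S.rotF^[n] f) = S.slope ^ n • S.rotF^[n] (S.Δ f) := by
  induction n with
  | zero => simp
  | succ n ih => rw [Function.iterate_succ_apply', Function.iterate_succ_apply', S.Δ_rotF, ih,
      map_smul, smul_smul, pow_succ']

/-- The derivation acts on the local ring of the point. -/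
lemma Δ_mem_locRing {x : F} (hx : x ∈ locRing F S.ev) : S.Δ x ∈ locRing F S.ev := by
  obtain ⟨g, hg, a, ha⟩ := hx
  have hg0 := algebraMap_ne_zero_of_ev F S.ev hg
  have h1 : x = (algebraMap A F g)⁻¹ * algebraMap A F a := by rw [← ha, inv_mul_cancel_left₀ hg0]
  rw [h1, Derivation.leibniz, Derivation.leibniz_inv]
  have hi := inv_mem_locRing F S.ev hg
  simp only [smul_eq_mul, neg_mul]
  refine add_mem (mul_mem hi (S.Δ_mem a)) (mul_mem (algebraMap_mem_locRing F _ a) ?_)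
  exact neg_mem (mul_mem (pow_mem hi 2) (S.Δ_mem g))

/-- By the Leibniz rule a derivation lowers the order of vanishing by at most one. -/
lemma Δ_mem_locIdeal_pow (n : ℕ) {x : F} (hx : x ∈ locIdeal F S.ev (RingHom.ker S.ev ^ (n + 1))) :
    S.Δ x ∈ locIdeal F S.ev (RingHom.ker S.ev ^ n) := by
  have hA : ∀ (n : ℕ) (a : A), a ∈ RingHom.ker S.ev ^ (n + 1) →
      S.Δ (algebraMap A F a) ∈ locIdeal F S.ev (RingHom.ker S.ev ^ n) := by
    intro n
    induction n with
    | zero =>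
      intro a _
      rw [pow_zero, Ideal.one_eq_top, locIdeal_top]; exact S.Δ_mem a
    | succ n ih =>
      intro a ha
      rw [pow_succ] at ha
      induction ha using Submodule.mul_induction_on' with
      | mem_mul_mem a ha b hb =>
        rw [map_mul, Derivation.leibniz]
        refine add_mem ?_ ?_
        · rw [smul_eq_mul, mul_comm]
          exact mul_mem_locIdeal_of_mem_locRing (S.Δ_mem b) (algebraMap_mem_locIdeal ha)
        · rw [pow_succ, mul_comm]
          exact mul_mem_locIdeal (algebraMap_mem_locIdeal hb) (ih a ha)
      | add x _ y _ hx hy => rw [map_add, map_add]; exact add_mem hx hy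
  obtain ⟨g, hg, a, ha, h⟩ := hx
  have hg0 := algebraMap_ne_zero_of_ev F S.ev hg
  have h1 : x = (algebraMap A F g)⁻¹ * algebraMap A F a := by rw [← h, inv_mul_cancel_left₀ hg0]
  have hi := inv_mem_locRing F S.ev hg
  rw [h1, Derivation.leibniz]
  refine add_mem (mul_mem_locIdeal_of_mem_locRing hi (hA n a ha)) ?_
  rw [smul_eq_mul, mul_comm]
  exact mul_mem_locIdeal_of_mem_locRing (S.Δ_mem_locRing hi)
    (algebraMap_mem_locIdeal (Ideal.pow_le_pow_right n.le_succ ha))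

/-- The elements regular at all points of the orbit. -/
def aLoc : Subalgebra A F where
  carrier := {x | ∀ n, S.rotF^[n] x ∈ locRing F S.ev}
  mul_mem' hx hy n := by rw [iterate_map_mul]; exact mul_mem (hx n) (hy n)
  add_mem' hx hy n := by rw [iterate_map_add]; exact add_mem (hx n) (hy n)
  algebraMap_mem' a n := by rw [rotF_iterate_algebraMap]; exact algebraMap_mem_locRing F _ _

lemma mem_locRing_of_mem_aLoc {x : F} (hx : x ∈ S.aLoc) : x ∈ locRing F S.ev := hx 0

lemma rotF_iterate_fixed {x : F} (hx : S.rotF x = x) (n : ℕ) : S.rotF^[n] x = x :=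
  Function.iterate_fixed hx n

/-- An invariant function regular at one point is regular along the orbit. For this reason `inv`
asks for regularity at the chosen point only. -/
lemma mem_aLoc_of_fixed {x : F} (hx : x ∈ locRing F S.ev) (hx' : S.rotF x = x) : x ∈ S.aLoc :=
  fun n => by rwa [S.rotF_iterate_fixed hx']

lemma rotF_iterate_mem_aLoc {x : F} (hx : x ∈ S.aLoc) (n : ℕ) : S.rotF^[n] x ∈ S.aLoc := fun m => by
  rw [← Function.iterate_add_apply]; exact hx _

lemma scalar_mem_aLoc (c : k) : algebraMap k F c ∈ S.aLoc := by
  rw [IsScalarTower.algebraMap_apply k A F]; exact S.aLoc.algebraMap_mem _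

lemma scalar_smul_mem_iff {R : Subalgebra A F} {c : k} (hc : c ≠ 0) {x : F} :
    c • x ∈ R ↔ x ∈ R := by
  have key : ∀ (c : k) (x : F), x ∈ R → c • x ∈ R := fun c x hx => by
    rw [Algebra.smul_def, IsScalarTower.algebraMap_apply k A F]
    exact mul_mem (R.algebraMap_mem _) hx
  refine ⟨fun h => ?_, key c x⟩
  have := key c⁻¹ _ h
  rwa [smul_smul, inv_mul_cancel₀ hc, one_smul] at this

lemma Δ_mem_aLoc {x : F} (hx : x ∈ S.aLoc) : S.Δ x ∈ S.aLoc := fun n => by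
  have h := S.Δ_mem_locRing (hx n)
  rwa [Δ_rotF_iterate, scalar_smul_mem_iff (pow_ne_zero n S.slope_ne_zero)] at h

lemma Δ_iterate_mem {R : Subalgebra A F} (hR : ∀ x ∈ R, S.Δ x ∈ R) (n : ℕ) {x : F} (hx : x ∈ R) :
    S.Δ^[n] x ∈ R := by
  induction n with
  | zero => exact hx
  | succ n ih => rw [Function.iterate_succ_apply']; exact hR _ ih

lemma constProj_mem {R : Subalgebra A F} (hR : ∀ x ∈ R, S.Δ x ∈ R) (y : A) {x : F} (hx : x ∈ R) :
    constProj p S.Δ (algebraMap A F y) x ∈ R := by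
  refine sum_mem fun n _ => mul_mem (mul_mem (pow_mem (neg_mem (R.algebraMap_mem y)) _) ?_)
    (S.Δ_iterate_mem hR n hx)
  rw [← map_natCast (algebraMap k F), ← map_inv₀, IsScalarTower.algebraMap_apply k A F]
  exact R.algebraMap_mem _

/-- The invariant constants which are regular at the point. -/
def inv : Subalgebra k F where
  carrier := {x | x ∈ locRing F S.ev ∧ S.rotF x = x ∧ S.Δ x = 0}
  mul_mem' := by
    rintro x y ⟨hx, hx', hx''⟩ ⟨hy, hy', hy''⟩
    exact ⟨mul_mem hx hy, by rw [map_mul, hx', hy'], by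
      rw [Derivation.leibniz, hx'', hy'', smul_zero, smul_zero, add_zero]⟩
  add_mem' := by
    rintro x y ⟨hx, hx', hx''⟩ ⟨hy, hy', hy''⟩
    exact ⟨add_mem hx hy, by rw [map_add, hx', hy'], by rw [map_add, hx'', hy'', add_zero]⟩
  algebraMap_mem' c := ⟨scalar_mem_locRing F _ c, AlgEquiv.commutes _ _,
    Derivation.map_algebraMap _ _⟩

lemma mem_inv {x : F} : x ∈ S.inv ↔ x ∈ locRing F S.ev ∧ S.rotF x = x ∧ S.Δ x = 0 := Iff.rfl

/-- The constants which are regular at the point. -/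
def const : Subalgebra k F where
  carrier := {x | x ∈ locRing F S.ev ∧ S.Δ x = 0}
  mul_mem' := by
    rintro x y ⟨hx, hx''⟩ ⟨hy, hy''⟩
    exact ⟨mul_mem hx hy, by
      rw [Derivation.leibniz, hx'', hy'', smul_zero, smul_zero, add_zero]⟩
  add_mem' := by
    rintro x y ⟨hx, hx''⟩ ⟨hy, hy''⟩
    exact ⟨add_mem hx hy, by rw [map_add, hx'', hy'', add_zero]⟩
  algebraMap_mem' c := ⟨scalar_mem_locRing F _ c, Derivation.map_algebraMap _ _⟩

lemma inv_le_const : S.inv ≤ S.const := fun _ hx => ⟨hx.1, hx.2.2⟩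

/-! #### The retraction onto the invariant constants -/

/-- The average over the orbits. -/
def avg (x : F) : F := (S.order : F)⁻¹ * ∑ n ∈ Finset.range S.order, S.rotF^[n] x

lemma avg_add (x y : F) : S.avg (x + y) = S.avg x + S.avg y := by
  simp only [avg, iterate_map_add, Finset.sum_add_distrib, mul_add]

lemma rotF_avg (x : F) : S.rotF (S.avg x) = S.avg x := by
  rw [avg, map_mul, map_inv₀, map_natCast, map_sum]
  congr 1
  simp only [← Function.iterate_succ_apply' S.rotF]
  have h := Finset.sum_range_succ' (fun n => S.rotF^[n] x) S.order
  rw [Finset.sum_range_succ, S.rotF_iterate_order, Function.iterate_zero, id] at h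
  exact (add_right_cancel h).symm

lemma avg_fixed_mul {c : F} (hc : S.rotF c = c) (x : F) : S.avg (c * x) = c * S.avg x := by
  simp only [avg, iterate_map_mul, S.rotF_iterate_fixed hc, ← Finset.mul_sum]
  ring

lemma avg_of_fixed {c : F} (hc : S.rotF c = c) : S.avg c = c := by
  simp only [avg, S.rotF_iterate_fixed hc, Finset.sum_const, Finset.card_range, nsmul_eq_mul]
  exact inv_mul_cancel_left₀ S.order_ne_zero' c

lemma Δ_avg {x : F} (hx : S.Δ x = 0) : S.Δ (S.avg x) = 0 := by
  rw [avg, ← map_natCast (algebraMap k F), ← map_inv₀, ← Algebra.smul_def, Derivation.map_smul, map_sum,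
    Finset.sum_eq_zero, smul_zero]
  intro n _
  rw [Δ_rotF_iterate, hx, iterate_map_zero, smul_zero]

lemma avg_mem_aLoc {x : F} (hx : x ∈ S.aLoc) : S.avg x ∈ S.aLoc := by
  refine mul_mem ?_ (sum_mem fun n _ => S.rotF_iterate_mem_aLoc hx n)
  rw [← map_natCast (algebraMap k F), ← map_inv₀]
  exact S.scalar_mem_aLoc _

/-- The retraction of the elements regular along the orbit onto the invariant constants. -/
def retract (x : F) : F := S.avg (constProj p S.Δ (algebraMap A F S.slice) x)

lemma retract_add (x y : F) : S.retract (x + y) = S.retract x + S.retract y := by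
  rw [retract, constProj_add, avg_add]; rfl

/-- Linearity over the invariant constants: together with `retract_of_mem_inv` it makes `retract` a
Reynolds operator. -/
lemma retract_inv_mul {c : F} (hc : c ∈ S.inv) (x : F) :
    S.retract (c * x) = c * S.retract x := by
  rw [retract, constProj_const_mul _ hc.2.2, S.avg_fixed_mul hc.2.1]; rfl

variable [hp : Fact p.Prime]

lemma retract_of_mem_inv {c : F} (hc : c ∈ S.inv) : S.retract c = c := by
  rw [retract, constProj_of_const _ hc.2.2, S.avg_of_fixed hc.2.1]

variable [CharP F p]

lemma Δ_constProj {y : A} (hy : S.Δ (algebraMap A F y) = 1) (x : F) :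
    S.Δ (constProj p S.Δ (algebraMap A F y) x) = 0 := apply_constProj _ S.Δ_iterate hy x

lemma retract_mem_inv {x : F} (hx : x ∈ S.aLoc) : S.retract x ∈ S.inv :=
  ⟨S.mem_locRing_of_mem_aLoc (S.avg_mem_aLoc (S.constProj_mem (fun _ => S.Δ_mem_aLoc) _ hx)),
    S.rotF_avg _, S.Δ_avg (S.Δ_constProj S.Δ_slice x)⟩

/-- The equation of the divisor divides its own derivative and is an eigenfunction of the
automorphism. Hence neither the Taylor projection nor the average leaves its multiples. -/
lemma retract_div_mul {x : F} (hx : x ∈ S.aLoc) :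
    ∃ c ∈ locRing F S.ev, S.retract (algebraMap A F S.div * x) = algebraMap A F S.div * c := by
  have hd0 : algebraMap A F S.div ≠ 0 := by
    rw [Ne, IsFractionRing.to_map_eq_zero_iff]; exact S.div_prime.ne_zero
  have hw0 : S.divWeight ≠ 0 := by
    intro h
    have := S.rotF_div
    rw [h, zero_smul, map_eq_zero] at this
    exact hd0 this
  obtain ⟨e, he, hde⟩ := S.Δ_div
  -- The logarithmic derivative e is known to be regular only at the point. Comparing the rotated
  -- equation with the commutation rule for Δ shows that every rotation of e is a scalar multiple of
  -- e.
  have heA : e ∈ S.aLoc := by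
    intro n
    have h1 := congrArg (S.rotF^[n]) hde
    have h2 := S.Δ_rotF_iterate n (algebraMap A F S.div)
    rw [iterate_map_mul, S.rotF_smul_iterate S.rotF_div] at h1
    rw [S.rotF_smul_iterate S.rotF_div, h1, Derivation.map_smul, hde, smul_mul_assoc,
      smul_comm (S.slope ^ n), ← mul_smul_comm (S.slope ^ n)] at h2
    have h3 := smul_right_injective F (pow_ne_zero n hw0) h2
    have h4 := mul_left_cancel₀ hd0 h3
    rw [← scalar_smul_mem_iff (pow_ne_zero n S.slope_ne_zero), ← h4]
    exact he
  have hΔ : ∀ n, ∃ c ∈ S.aLoc, S.Δ^[n] (algebraMap A F S.div * x) = algebraMap A F S.div * c := by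
    intro n
    induction n with
    | zero => exact ⟨x, hx, rfl⟩
    | succ n ih =>
      obtain ⟨c, hc, h⟩ := ih
      refine ⟨S.Δ c + c * e, add_mem (S.Δ_mem_aLoc hc) (mul_mem hc heA), ?_⟩
      rw [Function.iterate_succ_apply', h, Derivation.leibniz, hde]
      simp only [smul_eq_mul]
      ring
  choose c hc h using hΔ
  have hπ : ∃ b ∈ S.aLoc, constProj p S.Δ (algebraMap A F S.slice) (algebraMap A F S.div * x) =
      algebraMap A F S.div * b := by
    refine ⟨∑ n ∈ Finset.range p, (-algebraMap A F S.slice) ^ n * (n.factorial : F)⁻¹ * c n,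
      sum_mem fun n _ => mul_mem (mul_mem (pow_mem (neg_mem (S.aLoc.algebraMap_mem _)) _) ?_)
        (hc n), ?_⟩
    · rw [← map_natCast (algebraMap k F), ← map_inv₀]
      exact S.scalar_mem_aLoc _
    · simp only [constProj, h, Finset.mul_sum]
      refine Finset.sum_congr rfl fun n _ => ?_
      ring
  obtain ⟨b, hb, hπ⟩ := hπ
  refine ⟨(S.order : F)⁻¹ * ∑ n ∈ Finset.range S.order, S.divWeight ^ n • S.rotF^[n] b,
    mul_mem ?_ (sum_mem fun n _ => ?_), ?_⟩
  · rw [← map_natCast (algebraMap k F), ← map_inv₀]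
    exact scalar_mem_locRing F _ _
  · rw [Algebra.smul_def]
    exact mul_mem (scalar_mem_locRing F _ _) (hb n)
  · rw [retract, hπ, avg]
    simp only [iterate_map_mul, S.rotF_smul_iterate S.rotF_div, Finset.mul_sum]
    refine Finset.sum_congr rfl fun n _ => ?_
    simp only [Algebra.smul_def]
    ring

end FoliatedChart

end FoliatedChart

end AlphaP
end

noncomputable section

namespace AlphaP

set_option linter.unusedSectionVars false

/-! ### Systems of parameters in the local ring of a rational point -/

section Parameters

variable {k A F : Type*} [Field k] [CommRing A] [IsDomain A] [Algebra k A] [Field F]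
  [Algebra k F] [Algebra A F] [IsScalarTower k A F] [IsFractionRing A F] {ev : A →ₐ[k] k}

lemma mem_of_algebraMap_mul_mem {V : Submodule (locRing F ev) F} {g : A} (hg : ev g ≠ 0) {x : F}
    (h : algebraMap A F g * x ∈ V) : x ∈ V := by
  have h1 := V.smul_mem ⟨_, inv_mem_locRing F ev hg⟩ h
  change (algebraMap A F g)⁻¹ * (algebraMap A F g * x) ∈ V at h1
  rwa [inv_mul_cancel_left₀ (algebraMap_ne_zero_of_ev F ev hg)] at h1

lemma algebraMap_mul_mem {V : Submodule (locRing F ev) F} (g : A) {x : F} (h : x ∈ V) :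
    algebraMap A F g * x ∈ V :=
  V.smul_mem ⟨_, algebraMap_mem_locRing F ev g⟩ h

lemma locIdeal_mul (I J : Ideal A) : locIdeal F ev (I * J) = locIdeal F ev I * locIdeal F ev J := by
  refine le_antisymm ?_ (Submodule.mul_le.2 fun x hx y hy => mul_mem_locIdeal hx hy)
  rintro x ⟨g, hg, a, ha, h⟩
  refine mem_of_algebraMap_mul_mem hg ?_
  rw [h]
  clear h
  induction ha using Submodule.mul_induction_on' with
  | mem_mul_mem a ha b hb =>
    rw [map_mul]
    exact Submodule.mul_mem_mul (algebraMap_mem_locIdeal ha) (algebraMap_mem_locIdeal hb)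
  | add x _ y _ hx hy => rw [map_add]; exact add_mem hx hy

lemma locIdeal_pow (I : Ideal A) (n : ℕ) : locIdeal F ev (I ^ n) = locIdeal F ev I ^ n := by
  induction n with
  | zero =>
    ext x
    rw [pow_zero, pow_zero, Ideal.one_eq_top, locIdeal_top, Submodule.mem_one]
    exact ⟨fun h => ⟨⟨x, h⟩, rfl⟩, by rintro ⟨y, rfl⟩; exact y.2⟩
  | succ n ih => rw [pow_succ, pow_succ, locIdeal_mul, ih]

lemma mem_locIdeal_span_singleton {h : A} {x : F} : x ∈ locIdeal F ev (Ideal.span {h}) ↔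
    ∃ c ∈ locRing F ev, x = algebraMap A F h * c := by
  constructor
  · rintro ⟨g, hg, a, ha, hx⟩
    obtain ⟨b, rfl⟩ := Ideal.mem_span_singleton'.1 ha
    have hg0 := algebraMap_ne_zero_of_ev F ev hg
    refine ⟨(algebraMap A F g)⁻¹ * algebraMap A F b, mul_mem (inv_mem_locRing F ev hg)
      (algebraMap_mem_locRing F ev b), ?_⟩
    apply mul_left_cancel₀ hg0
    rw [hx, map_mul]
    field_simp
  · rintro ⟨c, ⟨g, hg, a, ha⟩, rfl⟩
    exact ⟨g, hg, h * a, Ideal.mul_mem_right _ _ (Ideal.mem_span_singleton_self h), by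
      rw [map_mul, ← ha]; ring⟩

variable (ev) in
/-- The elements `Z` of the local ring generate an ideal primary to the maximal ideal: the only
prime ideal containing them is maximal. -/
def IsParameters (Z : Set F) : Prop :=
  ∀ Q : Ideal A, Q.IsPrime → Q ≤ RingHom.ker ev → (∀ x ∈ Z, x ∈ locIdeal F ev Q) →
    Q = RingHom.ker ev

/-- The numerators of the ideal generated by a set. -/
def numerators (ev : A →ₐ[k] k) (Z : Set F) : Ideal A where
  carrier := {a | algebraMap A F a ∈ Submodule.span (locRing F ev) Z}
  zero_mem' := by simp
  add_mem' {a b} ha hb := by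
    change algebraMap A F (a + b) ∈ Submodule.span (locRing F ev) Z
    rw [map_add]; exact add_mem ha hb
  smul_mem' c a ha := by
    change algebraMap A F (c * a) ∈ Submodule.span (locRing F ev) Z
    rw [map_mul]; exact algebraMap_mul_mem c ha

lemma mem_numerators {Z : Set F} {a : A} :
    a ∈ numerators ev Z ↔ algebraMap A F a ∈ Submodule.span (locRing F ev) Z := Iff.rfl

/-- The ideal generated by parameters contains a power of the maximal ideal. -/
lemma IsParameters.exists_pow_le [IsNoetherianRing A] {Z : Set F} (hZ : ∀ x ∈ Z, x ∈ locRing F ev)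
    (h : IsParameters ev Z) :
    ∃ M, locIdeal F ev (RingHom.ker ev ^ M) ≤ Submodule.span (locRing F ev) Z := by
  have hrad : RingHom.ker ev ≤ (numerators ev Z).radical := by
    intro a ha
    by_contra hna
    -- If no power of a is a numerator, the multiplicative set generated by a and the functions not
    -- vanishing at the point avoids the numerators. A prime separating the two contains Z locally
    -- and lies in the ideal of the point, but misses a.
    have hdis : Disjoint (numerators ev Z : Set A)
        ((RingHom.ker ev).primeCompl ⊔ Submonoid.powers a : Submonoid A) := by
      rw [Set.disjoint_left]
      intro x hx hx'
      obtain ⟨g, hg, _, ⟨n, rfl⟩, rfl⟩ := Submonoid.mem_sup.1 hx'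
      refine hna ⟨n, ?_⟩
      rw [mem_numerators]
      refine mem_of_algebraMap_mul_mem (g := g) hg ?_
      rw [← map_mul]; exact hx
    obtain ⟨Q, hQ, hJ, hd⟩ := Ideal.exists_le_prime_disjoint _ _ hdis
    rw [Set.disjoint_left] at hd
    have hQm : Q ≤ RingHom.ker ev := by
      intro g hg
      by_contra hg'
      exact hd hg (Submonoid.mem_sup_left (show g ∈ (RingHom.ker ev).primeCompl from hg'))
    have := h Q hQ hQm fun x hx => by
      obtain ⟨g, hg, b, hb⟩ := hZ x hx
      refine ⟨g, hg, b, hJ ?_, hb⟩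
      rw [mem_numerators, ← hb]
      exact algebraMap_mul_mem g (Submodule.subset_span hx)
    rw [← this] at ha
    exact hd ha (Submonoid.mem_sup_right (Submonoid.mem_powers a))
  obtain ⟨M, hM⟩ := Ideal.exists_pow_le_of_le_radical_of_fg hrad (IsNoetherian.noetherian _)
  refine ⟨M, ?_⟩
  rintro x ⟨g, hg, a, ha, hx⟩
  refine mem_of_algebraMap_mul_mem hg ?_
  rw [hx]
  exact hM ha

lemma IsParameters.exists_pow_le_pow [IsNoetherianRing A] {Z : Set F}
    (hZ : ∀ x ∈ Z, x ∈ locRing F ev) (h : IsParameters ev Z) :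
    ∃ M, ∀ n, locIdeal F ev (RingHom.ker ev ^ (M * n)) ≤ Submodule.span (locRing F ev) Z ^ n := by
  obtain ⟨M, hM⟩ := h.exists_pow_le hZ
  refine ⟨M, fun n => ?_⟩
  rw [pow_mul, locIdeal_pow]
  exact pow_le_pow_left' hM n

/-- There are at least as many parameters as the height of the point. -/
lemma IsParameters.height_le [IsNoetherianRing A] {κ : Type*} [Fintype κ] {z : κ → F}
    (hz : ∀ v, z v ∈ locIdeal F ev (RingHom.ker ev)) (h : IsParameters ev (Set.range z)) :
    (RingHom.ker ev).height ≤ Fintype.card κ := by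
  choose g hg a ha hga using hz
  -- Clearing denominators by functions invertible at the point replaces the parameters by elements
  -- of A, to which Krull's height theorem applies.
  have hmin : RingHom.ker ev ∈ (Ideal.span (Set.range a)).minimalPrimes := by
    refine ⟨⟨inferInstance, Ideal.span_le.2 ?_⟩, ?_⟩
    · rintro _ ⟨v, rfl⟩; exact ha v
    · rintro Q ⟨hQ, hQa⟩ hQm
      refine (h Q hQ hQm ?_).ge
      rintro _ ⟨v, rfl⟩
      exact ⟨g v, hg v, a v, hQa (Ideal.subset_span ⟨v, rfl⟩), hga v⟩
  refine (Ideal.height_le_card_of_mem_minimalPrimes_span (Set.finite_range a) hmin).trans ?_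
  have : (Set.range a).ncard ≤ Fintype.card κ := by
    rw [← Set.image_univ, ← Nat.card_eq_fintype_card, ← Set.ncard_univ]
    exact Set.ncard_image_le
  exact_mod_cast this

end Parameters

/-! ### Invariant denominators and purity -/

namespace FoliatedChart

variable {p : ℕ} {k A F : Type*} [Field k] [CommRing A] [IsDomain A] [Algebra k A]
    [Field F] [Algebra k F] [Algebra A F] [IsScalarTower k A F] [IsFractionRing A F]

variable (S : FoliatedChart p k A F)

/-- The product over an orbit. -/
def norm (h : A) : A := ∏ n ∈ Finset.range S.order, S.rot^[n] h

lemma norm_mul (a b : A) : S.norm (a * b) = S.norm a * S.norm b := by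
  simp only [norm, iterate_map_mul, Finset.prod_mul_distrib]

lemma rot_norm (h : A) : S.rot (S.norm h) = S.norm h := by
  rw [norm, map_prod]
  simp only [← Function.iterate_succ_apply' S.rot]
  have e := Finset.prod_range_succ' (fun n => S.rot^[n] h) S.order
  rw [Finset.prod_range_succ, S.rot_iterate_order, Function.iterate_zero, id] at e
  by_cases hh : h = 0
  · subst hh
    simp [iterate_map_zero]
  · exact (mul_right_cancel₀ hh e).symm

lemma dvd_norm (h : A) : h ∣ S.norm h :=
  Finset.dvd_prod_of_mem (fun n => S.rot^[n] h) (Finset.mem_range.2 S.order_pos)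

lemma norm_of_fixed {h : A} (hh : S.rot h = h) : S.norm h = h ^ S.order := by
  simp [norm, Function.iterate_fixed hh]

lemma norm_rot (h : A) : S.norm (S.rot h) = S.norm h := by
  rw [← S.rot_norm h, norm, norm, map_prod]
  simp only [← Function.iterate_succ_apply, ← Function.iterate_succ_apply']

lemma norm_rot_iterate (n : ℕ) (h : A) : S.norm (S.rot^[n] h) = S.norm h := by
  induction n with
  | zero => rfl
  | succ n ih => rw [Function.iterate_succ_apply', norm_rot, ih]

lemma ev_norm_ne_zero {h : A} (hh : ∀ n, S.ev (S.rot^[n] h) ≠ 0) : S.ev (S.norm h) ≠ 0 := by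
  rw [norm, map_prod]
  exact Finset.prod_ne_zero_iff.2 fun n _ => hh n

/-- The ideal of a point of the orbit. -/
def orbitIdeal (n : ℕ) : Ideal A := (RingHom.ker S.ev).comap (S.rot ^ n : A ≃ₐ[k] A)

lemma rot_pow_apply (n : ℕ) (a : A) : (S.rot ^ n) a = S.rot^[n] a := by
  rw [AlgEquiv.coe_pow]

lemma mem_orbitIdeal {n : ℕ} {a : A} : a ∈ S.orbitIdeal n ↔ S.ev (S.rot^[n] a) = 0 := by
  rw [orbitIdeal, Ideal.mem_comap, RingHom.mem_ker, ← rot_pow_apply]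

instance orbitIdeal_isMaximal (n : ℕ) : (S.orbitIdeal n).IsMaximal :=
  Ideal.comap_isMaximal_of_equiv (S.rot ^ n : A ≃ₐ[k] A)

lemma rot_iterate_mod (n : ℕ) (a : A) : S.rot^[n] a = S.rot^[n % S.order] a := by
  conv_lhs => rw [← Nat.mod_add_div n S.order, Function.iterate_add_apply, Function.iterate_mul]
  rw [Function.iterate_fixed (S.rot_iterate_order a)]

/-- The denominators of x form an ideal stable under the automorphism. By prime avoidance it
contains an element vanishing at no point of the finite orbit, and the norm of this element is an
invariant denominator. -/
lemma exists_fixed_denominator {V : Submodule A F} (hV : ∀ x ∈ V, S.rotF x ∈ V) {x : F}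
    (hx : S.rotF x = x) {g : A} (hg : S.ev g ≠ 0) (hgx : algebraMap A F g * x ∈ V) :
    ∃ h : A, S.ev h ≠ 0 ∧ S.rot h = h ∧ algebraMap A F h * x ∈ V := by
  let J : Ideal A := 
    { carrier := {a | algebraMap A F a * x ∈ V}
      zero_mem' := by simp
      add_mem' := fun {a b} ha hb => by
        change algebraMap A F (a + b) * x ∈ V
        rw [map_add, add_mul]; exact add_mem ha hb
      smul_mem' := fun c a ha => by
        change algebraMap A F (c * a) * x ∈ V
        rw [map_mul, mul_assoc, ← Algebra.smul_def]; exact V.smul_mem c ha }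
  have hJ : ∀ n a, a ∈ J → S.rot^[n] a ∈ J := by
    intro n a ha
    induction n with
    | zero => exact ha
    | succ n ih =>
      rw [Function.iterate_succ_apply']
      have := hV _ ih
      rwa [map_mul, hx, S.rotF_algebraMap] at this
  have hnot : ¬ (J : Set A) ⊆ ⋃ n ∈ (Finset.range S.order : Set ℕ), (S.orbitIdeal n : Set A) := by
    intro h
    have h2 := (Ideal.subset_union_prime (s := Finset.range S.order) (f := S.orbitIdeal) 0 0
      (fun n _ _ _ => (S.orbitIdeal_isMaximal n).isPrime)).1 h
    obtain ⟨n, hn, hJn⟩ := h2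
    have h3 := hJn (hJ (S.order - n) g hgx)
    rw [mem_orbitIdeal, ← Function.iterate_add_apply,
      Nat.add_sub_cancel' (Finset.mem_range.1 hn).le, S.rot_iterate_order] at h3
    exact hg h3
  obtain ⟨b, hb, hb'⟩ := Set.not_subset.1 hnot
  have hb2 : ∀ n, S.ev (S.rot^[n] b) ≠ 0 := by
    intro n h
    rw [rot_iterate_mod] at h
    refine hb' (Set.mem_biUnion (x := n % S.order) ?_ (S.mem_orbitIdeal.2 h))
    simpa using Nat.mod_lt n S.order_pos
  refine ⟨S.norm b, S.ev_norm_ne_zero hb2, S.rot_norm b, ?_⟩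
  exact J.mem_of_dvd (S.dvd_norm b) hb

variable {X : Type*} [CommRing X] [Algebra k X] (ψ : X →ₐ[k] F)
  (hψ : ∀ x, x ∈ S.inv ↔ ∃ o, ψ o = x)

include hψ

lemma rotF_apply (o : X) : S.rotF (ψ o) = ψ o := ((hψ _).2 ⟨o, rfl⟩).2.1

lemma Δ_apply (o : X) : S.Δ (ψ o) = 0 := ((hψ _).2 ⟨o, rfl⟩).2.2

lemma apply_mem_locRing (o : X) : ψ o ∈ locRing F S.ev := ((hψ _).2 ⟨o, rfl⟩).1

variable [hp : Fact p.Prime] [CharP F p]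

/-- Purity: the extension to the local ring of an ideal, enlarged by an eigenfunction `w`,
contracts to the ideal, enlarged by the multiples of `w`. -/
lemma purity (I : Ideal X) {w : F} {χ : k} (hw : S.rotF w = χ • w)
    (hw' : ∀ a ∈ S.aLoc, ∃ c ∈ locRing F S.ev, S.retract (w * a) = w * c) {o : X}
    (ho : ψ o ∈ Submodule.span (locRing F S.ev) (insert w (ψ '' I))) :
    ∃ b ∈ I, ∃ c ∈ locRing F S.ev, ψ (o - b) = w * c := by
  -- The span over A, unlike the one over the local ring of a single point, is stable under the
  -- automorphism. Denominators are restored afterwards by invariant ones.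
  set V : Submodule A F := Submodule.span A (insert w (ψ '' I)) with hVdef
  have hV : ∀ x ∈ V, S.rotF x ∈ V := by
    intro x hx
    induction hx using Submodule.span_induction with
    | mem x hx =>
      rcases hx with rfl | ⟨o, ho, rfl⟩
      · rw [hw, Algebra.smul_def, IsScalarTower.algebraMap_apply k A F, ← Algebra.smul_def]
        exact V.smul_mem _ (Submodule.subset_span (Set.mem_insert _ _))
      · rw [S.rotF_apply ψ hψ]
        exact Submodule.subset_span (Set.mem_insert_of_mem _ ⟨o, ho, rfl⟩)
    | zero => rw [map_zero]; exact zero_mem _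
    | add x y _ _ hx hy => rw [map_add]; exact add_mem hx hy
    | smul a x _ hx =>
      rw [Algebra.smul_def, map_mul, S.rotF_algebraMap, ← Algebra.smul_def]
      exact V.smul_mem _ hx
  have hden : ∀ x ∈ Submodule.span (locRing F S.ev) (insert w (ψ '' I)),
      ∃ g : A, S.ev g ≠ 0 ∧ algebraMap A F g * x ∈ V := by
    intro x hx
    induction hx using Submodule.span_induction with
    | mem x hx => exact ⟨1, by simp, by rw [map_one, one_mul]; exact Submodule.subset_span hx⟩
    | zero => exact ⟨1, by simp, by rw [mul_zero]; exact zero_mem _⟩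
    | add x y _ _ hx hy =>
      obtain ⟨g, hg, hx⟩ := hx
      obtain ⟨g', hg', hy⟩ := hy
      refine ⟨g * g', by rw [map_mul]; exact mul_ne_zero hg hg', ?_⟩
      have : algebraMap A F (g * g') * (x + y) =
          g' • (algebraMap A F g * x) + g • (algebraMap A F g' * y) := by
        rw [Algebra.smul_def, Algebra.smul_def, map_mul]; ring
      rw [this]
      exact add_mem (V.smul_mem _ hx) (V.smul_mem _ hy)
    | smul c x _ hx =>
      obtain ⟨g, hg, hx⟩ := hx
      obtain ⟨c, g', hg', a, ha⟩ := c
      refine ⟨g * g', by rw [map_mul]; exact mul_ne_zero hg hg', ?_⟩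
      have : algebraMap A F (g * g') * (c * x) = a • (algebraMap A F g * x) := by
        rw [Algebra.smul_def, map_mul, ← ha]; ring
      change algebraMap A F (g * g') * (c * x) ∈ V
      rw [this]
      exact V.smul_mem _ hx
  obtain ⟨g, hg, hgo⟩ := hden _ ho
  obtain ⟨h, hh, hh', hho⟩ := S.exists_fixed_denominator hV (S.rotF_apply ψ hψ o) hg hgo
  -- The retraction sends multiples of an element of I to elements of I by linearity, and multiples
  -- of w to multiples of w by `hw'`. The factor a absorbs coefficients during the induction.
  have key : ∀ x ∈ V, ∀ a ∈ S.aLoc, ∃ b ∈ I, ∃ c ∈ locRing F S.ev,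
      S.retract (a * x) = ψ b + w * c := by
    intro x hx
    induction hx using Submodule.span_induction with
    | mem x hx =>
      intro a ha
      rcases hx with rfl | ⟨o, ho, rfl⟩
      · obtain ⟨c, hc, h⟩ := hw' a ha
        exact ⟨0, zero_mem _, c, hc, by rw [mul_comm, h, map_zero, zero_add]⟩
      · obtain ⟨r, hr⟩ := (hψ _).1 (S.retract_mem_inv ha)
        refine ⟨o * r, I.mul_mem_right _ ho, 0, zero_mem _, ?_⟩
        rw [mul_comm, S.retract_inv_mul ((hψ _).2 ⟨o, rfl⟩), ← hr, map_mul, mul_zero, add_zero]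
    | zero =>
      intro a _
      refine ⟨0, zero_mem _, 0, zero_mem _, ?_⟩
      rw [mul_zero, mul_zero, map_zero, add_zero]
      simpa using S.retract_inv_mul (zero_mem S.inv) 0
    | add x y _ _ hx hy =>
      intro a ha
      obtain ⟨b, hb, c, hc, h⟩ := hx a ha
      obtain ⟨b', hb', c', hc', h'⟩ := hy a ha
      refine ⟨b + b', add_mem hb hb', c + c', add_mem hc hc', ?_⟩
      rw [mul_add, S.retract_add, h, h', map_add]; ring
    | smul e x _ hx =>
      intro a ha
      obtain ⟨b, hb, c, hc, h⟩ := hx (a * algebraMap A F e) (mul_mem ha (S.aLoc.algebraMap_mem e))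
      refine ⟨b, hb, c, hc, ?_⟩
      rw [Algebra.smul_def, ← mul_assoc, h]
  -- Invariance of h makes its inverse regular along the whole orbit, so it is an admissible
  -- coefficient in `key`; the retraction then returns o itself.
  have hinv : (algebraMap A F h)⁻¹ ∈ S.aLoc := by
    refine S.mem_aLoc_of_fixed (inv_mem_locRing F S.ev hh) ?_
    rw [map_inv₀, S.rotF_algebraMap, hh']
  obtain ⟨b, hb, c, hc, h⟩ := key _ hho _ hinv
  rw [inv_mul_cancel_left₀ (algebraMap_ne_zero_of_ev F S.ev hh),
    S.retract_of_mem_inv ((hψ _).2 ⟨o, rfl⟩)] at h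
  exact ⟨b, hb, c, hc, by rw [map_sub, h]; ring⟩

/-- The case w = 0 of `purity`: extending an ideal of X to the local ring upstairs and contracting
it loses nothing. -/
lemma purity_zero (hinj : Function.Injective ψ) (I : Ideal X) {o : X} :
    ψ o ∈ Submodule.span (locRing F S.ev) (ψ '' I) ↔ o ∈ I := by
  refine ⟨fun ho => ?_, fun ho => Submodule.subset_span ⟨o, ho, rfl⟩⟩
  obtain ⟨b, hb, c, -, h⟩ := S.purity ψ hψ I (w := 0) (χ := 1) (by simp)
    (fun a ha => ⟨0, zero_mem _, by
      rw [zero_mul, zero_mul]; simpa using S.retract_inv_mul (zero_mem S.inv) 0⟩)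
    (Submodule.span_mono (Set.subset_insert _ _) ho)
  rw [zero_mul, ← map_zero ψ] at h
  rw [sub_eq_zero.1 (hinj h)]
  exact hb

lemma purity_div (I : Ideal X) {o : X}
    (ho : ψ o ∈ Submodule.span (locRing F S.ev) (insert (algebraMap A F S.div) (ψ '' I))) :
    ∃ b ∈ I, ψ (o - b) ∈ locIdeal F S.ev (Ideal.span {S.div}) := by
  obtain ⟨b, hb, c, hc, h⟩ := S.purity ψ hψ I S.rotF_div (fun a ha => S.retract_div_mul ha) ho
  exact ⟨b, hb, mem_locIdeal_span_singleton.2 ⟨c, hc, h⟩⟩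

end FoliatedChart

end AlphaP
end

noncomputable section

namespace AlphaP

set_option linter.unusedSectionVars false

namespace FoliatedChart

/-! ### The local ring of invariant constants -/

variable {p : ℕ} {k A F : Type*} [Field k] [CommRing A] [IsDomain A] [Algebra k A]
    [Field F] [Algebra k F] [Algebra A F] [IsScalarTower k A F] [IsFractionRing A F]
variable (S : FoliatedChart p k A F)
variable {X : Type*} [CommRing X] [Algebra k X] (ψ : X →ₐ[k] F)
  (hψ : ∀ x, x ∈ S.inv ↔ ∃ o, ψ o = x)

include hψ

/-- The contraction of an ideal to the ring of invariant constants. -/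
def contraction (Q : Ideal A) : Ideal X where
  carrier := {o | ψ o ∈ locIdeal F S.ev Q}
  zero_mem' := by simp
  add_mem' {a b} ha hb := by
    change ψ (a + b) ∈ locIdeal F S.ev Q
    rw [map_add]; exact add_mem ha hb
  smul_mem' c a ha := by
    change ψ (c * a) ∈ locIdeal F S.ev Q
    rw [map_mul]; exact mul_mem_locIdeal_of_mem_locRing (S.apply_mem_locRing ψ hψ c) ha

lemma mem_contraction {Q : Ideal A} {o : X} :
    o ∈ S.contraction ψ hψ Q ↔ ψ o ∈ locIdeal F S.ev Q := Iff.rfl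

lemma contraction_isPrime {Q : Ideal A} [Q.IsPrime] (hQ : Q ≤ RingHom.ker S.ev) :
    (S.contraction ψ hψ Q).IsPrime where
  ne_top' := by
    rw [Ideal.ne_top_iff_one, mem_contraction, map_one]
    exact one_notMem_locIdeal hQ
  mem_or_mem' {x y} h := by
    rw [mem_contraction, map_mul] at h
    exact mem_locIdeal_or_mem_locIdeal hQ (S.apply_mem_locRing ψ hψ x)
      (S.apply_mem_locRing ψ hψ y) h

lemma exists_inv (hinj : Function.Injective ψ) {o : X}
    (h : ψ o ∉ locIdeal F S.ev (RingHom.ker S.ev)) : IsUnit o := by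
  have hinv : (ψ o)⁻¹ ∈ S.inv := by
    refine ⟨inv_mem_locRing_of_notMem (S.apply_mem_locRing ψ hψ o) h, ?_, ?_⟩
    · rw [map_inv₀, S.rotF_apply ψ hψ]
    · rw [Derivation.leibniz_inv, S.Δ_apply ψ hψ, smul_zero]
  obtain ⟨o', ho'⟩ := (hψ _).1 hinv
  refine .of_mul_eq_one o' (hinj ?_)
  rw [map_mul, ho', map_one, mul_inv_cancel₀]
  intro h0
  rw [h0] at h
  exact h (zero_mem _)

lemma mem_maximalIdeal_iff [IsLocalRing X] (hinj : Function.Injective ψ) {o : X} :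
    o ∈ IsLocalRing.maximalIdeal X ↔ ψ o ∈ locIdeal F S.ev (RingHom.ker S.ev) := by
  rw [IsLocalRing.mem_maximalIdeal, mem_nonunits_iff]
  constructor
  · intro h
    by_contra h'
    exact h (S.exists_inv ψ hψ hinj h')
  · rintro h ⟨u, rfl⟩
    refine one_notMem_locIdeal (F := F) (ev := S.ev) le_rfl ?_
    rw [← map_one ψ, ← u.inv_mul, map_mul]
    exact mul_mem_locIdeal_of_mem_locRing (S.apply_mem_locRing ψ hψ _) h

variable [hp : Fact p.Prime] [CharP F p]

/-- The invariant constant `norm h ^ p`. -/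
lemma norm_pow_mem_inv (h : A) : algebraMap A F (S.norm h ^ p) ∈ S.inv := by
  refine ⟨algebraMap_mem_locRing F _ _, ?_, ?_⟩
  · rw [S.rotF_algebraMap, map_pow, rot_norm]
  · rw [map_pow, Derivation.leibniz_pow, ← Nat.cast_smul_eq_nsmul F, CharP.cast_eq_zero, zero_smul]

lemma exists_norm_pow (h : A) : ∃ o, ψ o = algebraMap A F (S.norm h ^ p) :=
  (hψ _).1 (S.norm_pow_mem_inv ψ hψ h)

/-- If a prime element `h` divides an invariant constant, then `norm h` divides a power. -/
lemma exists_pow_eq_mul (hinj : Function.Injective ψ) {h : A} (hh : Prime h) (h0 : S.ev h = 0)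
    {o r : X} (ho : ψ o ∈ locIdeal F S.ev (Ideal.span {h}))
    (hr : ψ r = algebraMap A F (S.norm h ^ p)) : r ∣ o ^ (S.order * p) := by
  obtain ⟨c, hc, hoc⟩ := mem_locIdeal_span_singleton.1 ho
  obtain ⟨g₀, hg₀, a, ha⟩ := S.apply_mem_locRing ψ hψ o
  obtain ⟨g, hg, hgr, b, hb⟩ := S.exists_fixed_denominator
    (V := LinearMap.range (Algebra.linearMap A F))
    (by rintro _ ⟨x, rfl⟩; exact ⟨S.rot x, (S.rotF_algebraMap x).symm⟩)
    (S.rotF_apply ψ hψ o) hg₀ ⟨a, ha.symm⟩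
  rw [Algebra.linearMap_apply] at hb
  -- Divisibility by h in the local ring descends to the numerator over an invariant denominator,
  -- because h is prime and vanishes at the point.
  obtain ⟨c', rfl⟩ : h ∣ b := by
    refine dvd_of_mem_mul_locRing (F := F) hh h0
      (mul_mem (algebraMap_mem_locRing F _ g) hc) ?_
    rw [hb, hoc]; ring
  have hfix : S.rot (h * c') = h * c' := by
    refine IsFractionRing.injective A F ?_
    rw [← S.rotF_algebraMap, hb, map_mul, S.rotF_apply ψ hψ, S.rotF_algebraMap, hgr]
  obtain ⟨s, hs⟩ := S.exists_norm_pow ψ hψ c'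
  obtain ⟨t, ht⟩ := S.exists_norm_pow ψ hψ g
  have htu : IsUnit t := by
    refine S.exists_inv ψ hψ hinj ?_
    rw [ht, algebraMap_mem_locIdeal_iff le_rfl, S.norm_of_fixed hgr, RingHom.mem_ker, map_pow,
      map_pow]
    exact pow_ne_zero _ (pow_ne_zero _ hg)
  -- The norm of an invariant element is its power of exponent `order`, and p-th powers are
  -- constants. Taking both turns the factorization of the numerator into one between elements of X.
  have key : t * o ^ (S.order * p) = r * s := by
    refine hinj ?_
    rw [map_mul, map_mul, map_pow, ht, hr, hs, ← map_mul (algebraMap A F), ← mul_pow, ← norm_mul,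
      S.norm_of_fixed hfix, S.norm_of_fixed hgr, map_pow, map_pow, map_pow, map_pow, hb]
    ring
  rw [← htu.dvd_mul_left, key]
  exact dvd_mul_right r s

lemma isDomain (hinj : Function.Injective ψ) : IsDomain X :=
  hinj.isDomain ψ.toRingHom

/-- Sending an ideal to the numerators of its extension embeds the ordered set of ideals of X into
that of A; injectivity is purity. -/
lemma isNoetherianRing [IsNoetherianRing A] (hinj : Function.Injective ψ) : IsNoetherianRing X := by
  have hle : ∀ I J : Ideal X, numerators S.ev (ψ '' I) ≤ numerators S.ev (ψ '' J) → I ≤ J := by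
    intro I J h o ho
    rw [← S.purity_zero ψ hψ hinj]
    obtain ⟨g, hg, a, ha⟩ := S.apply_mem_locRing ψ hψ o
    refine mem_of_algebraMap_mul_mem hg ?_
    rw [ha]
    refine h ?_
    rw [mem_numerators, ← ha]
    exact algebraMap_mul_mem g (Submodule.subset_span ⟨o, ho, rfl⟩)
  have hmono : Monotone fun I : Ideal X => numerators S.ev (ψ '' (I : Set X)) := by
    intro I J h a ha
    exact Submodule.span_mono (Set.image_mono h) ha
  have : StrictMono fun I : Ideal X => numerators S.ev (ψ '' (I : Set X)) :=
    hmono.strictMono_of_injective fun I J h => le_antisymm (hle _ _ h.le) (hle _ _ h.ge)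
  exact isNoetherian_iff'.2 this.wellFoundedGT

/-- An integral fraction is regular at the point because the local ring upstairs is normal. A
quotient of invariant constants is again invariant and constant. -/
lemma isIntegrallyClosed [IsIntegrallyClosed A] (hinj : Function.Injective ψ) :
    IsIntegrallyClosed X := by
  have := S.isDomain ψ hψ hinj
  refine (isIntegrallyClosed_iff (FractionRing X)).2 fun {x} hx => ?_
  have hinj' : Function.Injective ψ.toRingHom := hinj
  set L : FractionRing X →+* F := IsFractionRing.lift hinj' with hL
  have hLo : ∀ o, L (algebraMap X _ o) = ψ o := fun o => IsFractionRing.lift_algebraMap hinj' o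
  have h1 : L x ∈ locRing F S.ev := by
    refine locRing_integrallyClosed F S.ev ?_
    refine IsIntegral.map_of_comp_eq
      (ψ.toRingHom.codRestrict (locRing F S.ev).toSubring (S.apply_mem_locRing ψ hψ)) L ?_ hx
    ext o
    exact (hLo o).symm
  obtain ⟨a, b, hb, rfl⟩ := IsFractionRing.div_surjective (A := X) x
  rw [map_div₀, hLo, hLo] at h1
  have h2 : ψ a / ψ b ∈ S.inv := by
    refine ⟨h1, ?_, ?_⟩
    · rw [map_div₀, S.rotF_apply ψ hψ, S.rotF_apply ψ hψ]
    · rw [div_eq_mul_inv, Derivation.leibniz, Derivation.leibniz_inv, S.Δ_apply ψ hψ,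
        S.Δ_apply ψ hψ, smul_zero, smul_zero, smul_zero, add_zero]
  obtain ⟨o, ho⟩ := (hψ _).1 h2
  refine ⟨o, L.injective ?_⟩
  rw [hLo, map_div₀, hLo, hLo, ho]

/-- The radical of the norm of a prime element through the point. -/
lemma radical_span_norm (hinj : Function.Injective ψ) {h : A} (hh : Prime h) (h0 : S.ev h = 0)
    {r : X} (hr : ψ r = algebraMap A F (S.norm h ^ p)) :
    (Ideal.span {r}).radical = S.contraction ψ hψ (Ideal.span {h}) := by
  have hle : Ideal.span {h} ≤ RingHom.ker S.ev := by
    rw [Ideal.span_le, Set.singleton_subset_iff]; exact h0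
  have : (Ideal.span {h}).IsPrime := (Ideal.span_singleton_prime hh.ne_zero).2 hh
  have hP := S.contraction_isPrime ψ hψ hle
  refine le_antisymm ?_ fun o ho => ?_
  · rw [hP.radical_le_iff, Ideal.span_le, Set.singleton_subset_iff, SetLike.mem_coe,
      mem_contraction, hr]
    refine algebraMap_mem_locIdeal (Ideal.mem_span_singleton.2 ?_)
    exact (S.dvd_norm h).trans (dvd_pow_self _ hp.out.ne_zero)
  · exact ⟨S.order * p, Ideal.mem_span_singleton.2 (S.exists_pow_eq_mul ψ hψ hinj hh h0 ho hr)⟩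

lemma contraction_ne_bot {h : A} (hh : Prime h) :
    S.contraction ψ hψ (Ideal.span {h}) ≠ ⊥ := by
  intro hbot
  obtain ⟨r, hr⟩ := S.exists_norm_pow ψ hψ h
  have : r ∈ S.contraction ψ hψ (Ideal.span {h}) := by
    rw [mem_contraction, hr]
    refine algebraMap_mem_locIdeal (Ideal.mem_span_singleton.2 ?_)
    exact (S.dvd_norm h).trans (dvd_pow_self _ hp.out.ne_zero)
  rw [hbot, Ideal.mem_bot] at this
  rw [this, map_zero, eq_comm, IsFractionRing.to_map_eq_zero_iff] at hr
  have h1 := eq_zero_of_pow_eq_zero hr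
  rw [norm, Finset.prod_eq_zero_iff] at h1
  obtain ⟨n, -, hn⟩ := h1
  rw [← rot_pow_apply, map_eq_zero_iff _ (S.rot ^ n).injective] at hn
  exact hh.ne_zero hn

lemma contraction_height [IsNoetherianRing A] (hinj : Function.Injective ψ) {h : A} (hh : Prime h)
    (h0 : S.ev h = 0) : (S.contraction ψ hψ (Ideal.span {h})).height = 1 := by
  have := S.isNoetherianRing ψ hψ hinj
  have := S.isDomain ψ hψ hinj
  have hle : Ideal.span {h} ≤ RingHom.ker S.ev := by
    rw [Ideal.span_le, Set.singleton_subset_iff]; exact h0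
  have : (Ideal.span {h}).IsPrime := (Ideal.span_singleton_prime hh.ne_zero).2 hh
  have hP := S.contraction_isPrime ψ hψ hle
  obtain ⟨r, hr⟩ := S.exists_norm_pow ψ hψ h
  have hrad := S.radical_span_norm ψ hψ hinj hh h0 hr
  refine le_antisymm (Ideal.height_le_one_of_isPrincipal_of_mem_minimalPrimes (Ideal.span {r}) _
    ⟨⟨hP, ?_⟩, ?_⟩) ?_
  · rw [← hrad]; exact Ideal.le_radical
  · rintro Q ⟨hQ, hrQ⟩ -
    rw [← hrad]; exact hQ.radical_le_iff.2 hrQ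
  · rw [Order.one_le_iff_ne_zero, Ne, Ideal.height_eq_zero_iff_eq_bot]
    exact S.contraction_ne_bot ψ hψ hh

/-- Let ν be the p-th power of the norm, viewed in X. A height one prime P contains ν of the
numerator of a nonzero element, hence ν h for a prime factor h. Some conjugate of h passes through
the point, and its contraction is a height one prime inside P. -/
lemma exists_radical_span [IsNoetherianRing A] [UniqueFactorizationMonoid A]
    (hinj : Function.Injective ψ) {P : Ideal X} (hP : P.IsPrime) (hP1 : P.height = 1) :
    ∃ r, (Ideal.span {r}).radical = P := by
  have := S.isDomain ψ hψ hinj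
  have := S.isNoetherianRing ψ hψ hinj
  obtain ⟨o, hoP, ho0⟩ := Submodule.exists_mem_ne_zero_of_ne_bot
    (Ideal.ne_bot_of_height_eq_one hP1)
  obtain ⟨g, hg, a, ha⟩ := S.apply_mem_locRing ψ hψ o
  have hψ0 : ψ o ≠ 0 := by rwa [Ne, map_eq_zero_iff _ hinj]
  have ha0 : a ≠ 0 := by
    rintro rfl
    rw [map_zero, mul_eq_zero] at ha
    exact ha.elim (algebraMap_ne_zero_of_ev F S.ev hg) hψ0
  choose ν hν using S.exists_norm_pow ψ hψ
  have hνmul : ∀ a b, ν (a * b) = ν a * ν b := fun a b => hinj (by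
    rw [map_mul, hν, hν, hν, norm_mul, mul_pow, map_mul])
  have hrotF : ∀ n, algebraMap A F (S.rot^[n] a) = algebraMap A F (S.rot^[n] g) * ψ o := by
    intro n
    rw [← rotF_iterate_algebraMap, ← rotF_iterate_algebraMap, ← ha, iterate_map_mul,
      S.rotF_iterate_fixed (S.rotF_apply ψ hψ o)]
  -- Multiplying a = g·o over all rotations, with o invariant, gives ν a = ν g · o^(order · p).
  have hνa : ν a ∈ P := by
    have : ν a = ν g * o ^ (S.order * p) := hinj (by
      rw [hν, map_mul, hν, map_pow, map_pow, map_pow, norm, norm, map_prod, map_prod,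
        Finset.prod_congr rfl fun n _ => hrotF n, Finset.prod_mul_distrib, Finset.prod_const,
        Finset.card_range, mul_pow, pow_mul])
    rw [this]
    exact P.mul_mem_left _ (Ideal.pow_mem_of_mem _ hoP _
      (Nat.mul_pos S.order_pos hp.out.pos))
  have hprime : ∀ a : A, a ≠ 0 → ν a ∈ P → ∃ h, Prime h ∧ ν h ∈ P := by
    intro a
    induction a using UniqueFactorizationMonoid.induction_on_prime with
    | h₁ => intro h; exact absurd rfl h
    | h₂ x hx =>
      intro _ hxP
      obtain ⟨y, hy⟩ := hx.exists_right_inv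
      have h1 : ν x * ν y = 1 := by
        rw [← hνmul, hy]
        refine hinj ?_
        rw [hν, map_one, norm]
        simp [iterate_map_one]
      exact absurd (P.mul_mem_right (ν y) hxP) (by
        rw [h1]; exact (Ideal.ne_top_iff_one P).1 hP.ne_top)
    | h₃ b q hb hq ih =>
      intro _ hqb
      rw [hνmul] at hqb
      rcases hP.mem_or_mem hqb with h | h
      · exact ⟨q, hq, h⟩
      · exact ih hb h
  obtain ⟨h, hh, hhP⟩ := hprime a ha0 hνa
  -- If h vanished nowhere on the orbit, ν h would be a unit of X and could not lie in P.
  obtain ⟨n, hn⟩ : ∃ n, S.ev (S.rot^[n] h) = 0 := by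
    by_contra! hne
    have h1 : IsUnit (ν h) := by
      refine S.exists_inv ψ hψ hinj ?_
      rw [hν, algebraMap_mem_locIdeal_iff le_rfl, RingHom.mem_ker, map_pow]
      exact pow_ne_zero _ (S.ev_norm_ne_zero hne)
    exact hP.ne_top (P.eq_top_of_isUnit_mem hhP h1)
  have hh' : Prime (S.rot^[n] h) := by
    rw [← rot_pow_apply]; exact (MulEquiv.prime_iff (S.rot ^ n).toMulEquiv).2 hh
  have hr : ψ (ν h) = algebraMap A F (S.norm (S.rot^[n] h) ^ p) := by rw [norm_rot_iterate, hν]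
  have hrad := S.radical_span_norm ψ hψ hinj hh' hn hr
  refine ⟨ν h, hrad.trans ?_⟩
  have hle : S.contraction ψ hψ (Ideal.span {S.rot^[n] h}) ≤ P := by
    rw [← hrad, hP.radical_le_iff, Ideal.span_le, Set.singleton_subset_iff]; exact hhP
  have hle' : Ideal.span {S.rot^[n] h} ≤ RingHom.ker S.ev := by
    rw [Ideal.span_le, Set.singleton_subset_iff]; exact hn
  have : (Ideal.span {S.rot^[n] h}).IsPrime := (Ideal.span_singleton_prime hh'.ne_zero).2 hh'
  have := S.contraction_isPrime ψ hψ hle'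
  exact Ideal.eq_of_le_of_height_le _ hle (by rw [hP1, S.contraction_height ψ hψ hinj hh' hn])

/-- The dimension of the ring of invariant constants, if there are enough invariant constant
parameters. -/
lemma ringKrullDim_eq [IsLocalRing X] [IsNoetherianRing A] (hinj : Function.Injective ψ)
    {ι : Type*} [Fintype ι] {q : ι → X}
    (hq : ∀ v, q v ∈ IsLocalRing.maximalIdeal X)
    (hpar : IsParameters S.ev (Set.range fun v => ψ (q v)))
    (hht : (RingHom.ker S.ev).height = Fintype.card ι) : ringKrullDim X = Fintype.card ι := by
  have := S.isNoetherianRing ψ hψ hinj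
  have hmin : IsLocalRing.maximalIdeal X ∈ (Ideal.span (Set.range q)).minimalPrimes := by
    refine ⟨⟨inferInstance, Ideal.span_le.2 (by rintro _ ⟨v, rfl⟩; exact hq v)⟩, ?_⟩
    rintro Q ⟨hQ, hqQ⟩ -
    -- A power of the maximal ideal upstairs lies in the extension of (q), and purity brings this
    -- back to X.
    obtain ⟨M, hM⟩ := hpar.exists_pow_le (by
      rintro _ ⟨v, rfl⟩; exact S.apply_mem_locRing ψ hψ _)
    intro o ho
    refine hQ.mem_of_pow_mem M (hqQ ?_)
    rw [← S.purity_zero ψ hψ hinj, map_pow]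
    refine Submodule.span_mono ?_ (hM (pow_mem_locIdeal
      ((S.mem_maximalIdeal_iff ψ hψ hinj).1 ho) M))
    rintro _ ⟨v, rfl⟩
    exact ⟨q v, Ideal.subset_span ⟨v, rfl⟩, rfl⟩
  rw [← IsLocalRing.maximalIdeal_height_eq_ringKrullDim]
  have h1 : (IsLocalRing.maximalIdeal X).height ≤ Fintype.card ι := by
    refine (Ideal.height_le_card_of_mem_minimalPrimes_span (Set.finite_range q) hmin).trans ?_
    have : (Set.range q).ncard ≤ Fintype.card ι := by
      rw [← Set.image_univ, ← Nat.card_eq_fintype_card, ← Set.ncard_univ]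
      exact Set.ncard_image_le
    exact_mod_cast this
  -- A minimal set of parameters of X also consists of parameters upstairs: a prime there containing
  -- them contracts to the maximal ideal of X, so it contains the q v. Krull's theorem upstairs then
  -- bounds the number from below.
  have h2 : (Fintype.card ι : ℕ∞) ≤ (IsLocalRing.maximalIdeal X).height := by
    obtain ⟨s, hs, hcard⟩ := Ideal.exists_finset_card_eq_height_of_isNoetherianRing
      (IsLocalRing.maximalIdeal X)
    rw [← hht, ← hcard]
    have hsm : ∀ e ∈ s, e ∈ IsLocalRing.maximalIdeal X := fun e he =>
      hs.1.2 (Ideal.subset_span he)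
    have := IsParameters.height_le (ev := S.ev) (F := F) (κ := s) (z := fun e => ψ e)
      (fun e => (S.mem_maximalIdeal_iff ψ hψ hinj).1 (hsm e e.2)) (by
        intro Q hQ hQm hQs
        refine hpar Q hQ hQm ?_
        rintro _ ⟨v, rfl⟩
        have hP := S.contraction_isPrime ψ hψ hQm
        have hle : IsLocalRing.maximalIdeal X ≤ S.contraction ψ hψ Q := by
          refine hs.2 ⟨hP, Ideal.span_le.2 fun e he => hQs _ ⟨⟨e, he⟩, rfl⟩⟩ ?_
          exact IsLocalRing.le_maximalIdeal hP.ne_top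
        exact hle (hq v))
    simpa using this
  have h3 := le_antisymm h1 h2
  rw [h3]; rfl

end FoliatedChart
end AlphaP
end

noncomputable section

namespace AlphaP

set_option linter.unusedSectionVars false

/-! ### Coordinates on the ring of constants -/

section

variable {k A F : Type*} [Field k] [CommRing A] [IsDomain A] [Algebra k A]
    [Field F] [Algebra k F] [Algebra A F] [IsScalarTower k A F] [IsFractionRing A F]
    {ev : A →ₐ[k] k}

lemma span_image_pow_le {R : Type*} [CommRing R] (φ : R →+* F) (I : Ideal R) (n : ℕ) :
    Submodule.span (locRing F ev) (φ '' I) ^ n ≤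
      Submodule.span (locRing F ev) (φ '' (I ^ n : Ideal R)) := by
  induction n with
  | zero =>
    rw [pow_zero, pow_zero, Submodule.one_le]
    exact Submodule.subset_span ⟨1, by simp, map_one φ⟩
  | succ n ih =>
    rw [pow_succ]
    refine (mul_le_mul' ih le_rfl).trans ?_
    rw [Submodule.span_mul_span, Submodule.span_le]
    rintro _ ⟨_, ⟨a, ha, rfl⟩, _, ⟨b, hb, rfl⟩, rfl⟩
    refine Submodule.subset_span ⟨a * b, ?_, map_mul φ a b⟩
    rw [pow_succ]
    exact Ideal.mul_mem_mul ha hb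

end

namespace FoliatedChart

variable {p : ℕ} {k A F : Type*} [Field k] [CommRing A] [IsDomain A] [Algebra k A]
    [Field F] [Algebra k F] [Algebra A F] [IsScalarTower k A F] [IsFractionRing A F]

/-- Ideals of constants are contracted from the local ring of the point. -/
lemma mem_of_mem_span [Fact p.Prime] [CharP F p] (S : FoliatedChart p k A F) (J : Ideal S.const)
    {t : S.const}
    (ht : (t : F) ∈ Submodule.span (locRing F S.ev) (S.const.val.toRingHom '' J)) : t ∈ J := by
  have hmem : ∀ x ∈ locRing F S.ev, constProj p S.Δ (algebraMap A F S.slice) x ∈ S.const :=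
    fun x hx => ⟨S.constProj_mem (fun _ => S.Δ_mem_locRing) _ hx, S.Δ_constProj S.Δ_slice x⟩
  have key : ∀ x ∈ Submodule.span (locRing F S.ev) (S.const.val.toRingHom '' J),
      ∀ a ∈ locRing F S.ev,
        ∃ b ∈ J, constProj p S.Δ (algebraMap A F S.slice) (a * x) = (b : F) := by
    intro x hx
    induction hx using Submodule.span_induction with
    | mem x hx =>
      intro a ha
      obtain ⟨o, ho, rfl⟩ := hx
      refine ⟨o * ⟨_, hmem a ha⟩, J.mul_mem_right _ ho, ?_⟩
      change constProj p S.Δ _ (a * (o : F)) = o * constProj p S.Δ _ a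
      rw [mul_comm, constProj_const_mul _ o.2.2]
    | zero =>
      intro a _
      refine ⟨0, zero_mem _, ?_⟩
      rw [mul_zero, constProj_of_const _ (map_zero S.Δ)]; rfl
    | add x y _ _ hx hy =>
      intro a ha
      obtain ⟨b, hb, h⟩ := hx a ha
      obtain ⟨b', hb', h'⟩ := hy a ha
      exact ⟨b + b', add_mem hb hb', by rw [mul_add, constProj_add, h, h']; rfl⟩
    | smul e x _ hx =>
      intro a ha
      obtain ⟨b, hb, h⟩ := hx (a * e) (mul_mem ha e.2)
      refine ⟨b, hb, ?_⟩
      rw [← h, mul_assoc]; rfl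
  obtain ⟨b, hb, h⟩ := key _ ht 1 (one_mem _)
  rw [one_mul, constProj_of_const _ t.2.2] at h
  rwa [Subtype.ext h]

/-- The elements `z` are coordinates of the ring of constants; the stabilizer of the point is
generated by `rot^[m]`, is cyclic of order `g`, and acts on `z` with weights `r`. -/
structure ConstCoords (S : FoliatedChart p k A F) {ι M : Type*} [Fintype ι] [AddCommGroup M]
    (z : ι → S.const) (r : ι → M) (χ : AddChar M k) (m g : ℕ) : Prop where
  mem_iff : ∀ t : S.const, (t : F) ∈ locIdeal F S.ev (RingHom.ker S.ev) ↔
    t ∈ Ideal.span (Set.range z)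
  height : (RingHom.ker S.ev).height = Fintype.card ι
  faithful : ∀ x, χ x = 1 → x = 0
  order_eq : S.order = m * g
  ev_rot : ∀ a, S.ev (S.rot^[m] a) = S.ev a
  exists_ne : ∀ s, ¬ m ∣ s → ∃ a, S.ev (S.rot^[s] a) ≠ S.ev a
  rot_coord : ∀ v, S.rotF^[m] (z v) = χ (r v) • (z v : F)

lemma rotF_iterate_mem_locIdeal (S : FoliatedChart p k A F) {n : ℕ}
    (hn : ∀ a, S.ev (S.rot^[n] a) = S.ev a) {L : ℕ} {x : F}
    (hx : x ∈ locIdeal F S.ev (RingHom.ker S.ev ^ L)) :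
    S.rotF^[n] x ∈ locIdeal F S.ev (RingHom.ker S.ev ^ L) := by
  obtain ⟨g, hg, a, ha, h⟩ := hx
  refine ⟨S.rot^[n] g, by rwa [hn], S.rot^[n] a, ?_, ?_⟩
  · have h1 : RingHom.ker S.ev ≤ (RingHom.ker S.ev).comap ((S.rot ^ n : A ≃ₐ[k] A) : A →+* A) := by
      intro b hb
      rw [Ideal.mem_comap, RingHom.mem_ker]
      change S.ev ((S.rot ^ n) b) = 0
      rw [rot_pow_apply, hn]; exact hb
    have h2 := Ideal.le_comap_pow _ L (Ideal.pow_right_mono h1 L ha)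
    rw [← rot_pow_apply]
    exact h2
  · rw [← rotF_iterate_algebraMap, ← iterate_map_mul, h, rotF_iterate_algebraMap]

namespace ConstCoords

variable {S : FoliatedChart p k A F} {ι M : Type*} [Fintype ι] [AddCommGroup M]
  {z : ι → S.const} {r : ι → M} {χ : AddChar M k} {m g : ℕ} (H : S.ConstCoords z r χ m g)

include H

lemma coe_mem_of_mem_pow {n : ℕ} {t : S.const} (ht : t ∈ Ideal.span (Set.range z) ^ n) :
    (t : F) ∈ locIdeal F S.ev (RingHom.ker S.ev ^ n) := by
  have h : (t : F) ∈ Submodule.span (locRing F S.ev)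
      (S.const.val.toRingHom '' (Ideal.span (Set.range z))) ^ n := by
    clear H
    induction n generalizing t with
    | zero =>
      rw [pow_zero, Submodule.mem_one]
      exact ⟨⟨t, t.2.1⟩, rfl⟩
    | succ n ih =>
      rw [pow_succ] at ht ⊢
      induction ht using Submodule.mul_induction_on' with
      | mem_mul_mem a ha b hb =>
        exact Submodule.mul_mem_mul (ih ha) (Submodule.subset_span ⟨b, hb, rfl⟩)
      | add x _ y _ hx hy => exact add_mem hx hy
  rw [locIdeal_pow]
  refine pow_le_pow_left' (Submodule.span_le.2 ?_) n h
  rintro _ ⟨b, hb, rfl⟩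
  exact (H.mem_iff b).2 hb

lemma scalar_notMem {c : k} (hc : c ≠ 0) : algebraMap k S.const c ∉ Ideal.span (Set.range z) := by
  intro h
  rw [← H.mem_iff] at h
  change algebraMap k F c ∈ _ at h
  rw [IsScalarTower.algebraMap_apply k A F, algebraMap_mem_locIdeal_iff le_rfl, RingHom.mem_ker,
    AlgHom.commutes] at h
  exact hc h

lemma exp (t : S.const) : ∃ c : k, t - algebraMap k S.const c ∈ Ideal.span (Set.range z) := by
  obtain ⟨c, hc⟩ := exists_scalar_sub_mem t.2.1
  exact ⟨c, (H.mem_iff _).1 hc⟩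

/-- The prime ideal of constants defined by a prime ideal through the point. -/
lemma exists_prime {Q : Ideal A} [Q.IsPrime] (hQ : Q ≤ RingHom.ker S.ev) :
    ∃ P : Ideal S.const, P.IsPrime ∧ ∀ t, t ∈ P ↔ (t : F) ∈ locIdeal F S.ev Q := by
  refine ⟨⟨⟨⟨{t | (t : F) ∈ locIdeal F S.ev Q}, fun ha hb =>
    (locIdeal F S.ev Q).add_mem ha hb⟩, zero_mem (locIdeal F S.ev Q)⟩,
    fun c t ht => mul_mem_locIdeal_of_mem_locRing c.2.1 ht⟩, ⟨?_, ?_⟩, fun t => Iff.rfl⟩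
  · rw [Ideal.ne_top_iff_one]
    exact one_notMem_locIdeal hQ
  · intro x y h
    exact mem_locIdeal_or_mem_locIdeal hQ x.2.1 y.2.1 h

variable [hp : Fact p.Prime] [CharP F p]

/-- The p-th power of any element of A is a constant. If the element vanishes at the point, its p-th
power lies in the ideal of the coordinates, so a prime containing them contains the element. -/
lemma isParameters : IsParameters S.ev (Set.range fun v => (z v : F)) := by
  intro Q hQ hQm hz
  refine le_antisymm hQm fun a ha => ?_
  obtain ⟨P, hP, hPQ⟩ := H.exists_prime hQm
  have hle : Ideal.span (Set.range z) ≤ P := by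
    rw [Ideal.span_le]
    rintro _ ⟨v, rfl⟩
    exact (hPQ _).2 (hz _ ⟨v, rfl⟩)
  have hc : algebraMap A F (a ^ p) ∈ S.const := by
    refine ⟨algebraMap_mem_locRing F _ _, ?_⟩
    rw [map_pow, Derivation.leibniz_pow, ← Nat.cast_smul_eq_nsmul F, CharP.cast_eq_zero, zero_smul]
  have h1 : (⟨_, hc⟩ : S.const) ∈ P := hle ((H.mem_iff _).1
    (algebraMap_mem_locIdeal (Ideal.pow_mem_of_mem _ ha p hp.out.pos)))
  rw [hPQ] at h1
  exact hQ.mem_of_pow_mem p ((algebraMap_mem_locIdeal_iff hQm).1 h1)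

/-- Constants vanishing to high order at the point vanish to high order in the coordinates. -/
lemma exists_cofinal [IsNoetherianRing A] : ∃ N, ∀ n, ∀ t : S.const,
    (t : F) ∈ locIdeal F S.ev (RingHom.ker S.ev ^ (N * n)) →
      t ∈ Ideal.span (Set.range z) ^ n := by
  obtain ⟨N, hN⟩ := H.isParameters.exists_pow_le_pow (by rintro _ ⟨v, rfl⟩; exact (z v).2.1)
  refine ⟨N, fun n t ht => S.mem_of_mem_span _ (span_image_pow_le _ _ n ?_)⟩
  refine pow_le_pow_left' (Submodule.span_mono ?_) n (hN n ht)
  rintro _ ⟨v, rfl⟩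
  exact ⟨z v, Ideal.subset_span ⟨v, rfl⟩, rfl⟩

end ConstCoords
end FoliatedChart
end AlphaP
end

/-! ### Analytic independence of the coordinates. -/

noncomputable section

namespace AlphaP

set_option linter.unusedSectionVars false

lemma aeval_mul_of_isHomogeneous {k ι R : Type*} [CommRing k] [CommRing R] [Algebra k R]
    {f : MvPolynomial ι k} {e : ℕ} (hf : f.IsHomogeneous e) (μ : ι → k) (y : R) :
    MvPolynomial.aeval (fun v => algebraMap k R (μ v) * y) f =
      algebraMap k R (MvPolynomial.eval μ f) * y ^ e := by
  rw [MvPolynomial.aeval_def, MvPolynomial.eval₂_eq, MvPolynomial.eval_eq, map_sum, Finset.sum_mul]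
  refine Finset.sum_congr rfl fun α hα => ?_
  have h1 : α.degree = e := by
    rw [← hf (MvPolynomial.mem_support_iff.1 hα), Finsupp.degree_eq_weight_one]
    rfl
  simp only [mul_pow, Finset.prod_mul_distrib, Finset.prod_pow_eq_pow_sum, map_mul, map_prod,
    map_pow]
  rw [← h1, Finsupp.degree_apply, mul_assoc]

namespace FoliatedChart

variable {p : ℕ} {k A F : Type*} [Field k] [CommRing A] [IsDomain A] [Algebra k A]
    [Field F] [Algebra k F] [Algebra A F] [IsScalarTower k A F] [IsFractionRing A F]

namespace ConstCoords

variable {S : FoliatedChart p k A F} {ι M : Type*} [Fintype ι] [AddCommGroup M]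
  {z : ι → S.const} {r : ι → M} {χ : AddChar M k} {m g : ℕ} (H : S.ConstCoords z r χ m g)
  [hp : Fact p.Prime] [CharP F p]

include H

/-- The coordinates are analytically independent. -/
lemma ind [IsNoetherianRing A] [Infinite k] (n : ℕ) (f : MvPolynomial ι k)
    (hf : MvPolynomial.aeval z f ∈ Ideal.span (Set.range z) ^ n) (α : ι →₀ ℕ) (hα : α.degree < n) :
    f.coeff α = 0 := by
  classical
  by_contra hα0
  have hex : ∃ e, ∃ α : ι →₀ ℕ, α.degree = e ∧ f.coeff α ≠ 0 := ⟨_, α, rfl, hα0⟩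
  -- The least degree in which f has a nonzero term; f₀ will be the initial form of f, whose value
  -- lies in the power e + 1.
  set e := Nat.find hex with he
  obtain ⟨β, hβ, hβ0⟩ := Nat.find_spec hex
  have hmin : ∀ γ : ι →₀ ℕ, γ.degree < e → f.coeff γ = 0 := by
    intro γ hγ
    by_contra h
    exact Nat.find_min hex hγ ⟨γ, rfl, h⟩
  have hen : e < n := (Nat.find_min' hex ⟨α, rfl, hα0⟩).trans_lt hα
  set f₀ := MvPolynomial.homogeneousComponent e f with hf₀
  have hhom : f₀.IsHomogeneous e := MvPolynomial.homogeneousComponent_isHomogeneous e f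
  have hf₀0 : f₀ ≠ 0 := by
    intro h
    refine hβ0 ?_
    have h1 := congrArg (MvPolynomial.coeff β) h
    rwa [hf₀, MvPolynomial.coeff_homogeneousComponent, if_pos hβ, MvPolynomial.coeff_zero] at h1
  have hf₀mem : MvPolynomial.aeval z f₀ ∈ Ideal.span (Set.range z) ^ (e + 1) := by
    have h1 : MvPolynomial.aeval z (f - f₀) ∈ Ideal.span (Set.range z) ^ (e + 1) := by
      refine aeval_mem_pow z _ fun γ hγ => ?_
      rw [MvPolynomial.coeff_sub, hf₀, MvPolynomial.coeff_homogeneousComponent]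
      split_ifs with h
      · rw [sub_self]
      · rw [sub_zero]; exact hmin γ (by omega)
    rw [map_sub] at h1
    exact (Submodule.sub_mem_iff_right _ (Ideal.pow_le_pow_right (by omega) hf)).1 h1
  -- A direction in which the initial form does not vanish; it exists because k is infinite.
  obtain ⟨lam, hlam⟩ : ∃ lam : ι → k, MvPolynomial.eval lam f₀ ≠ 0 := by
    by_contra! h
    exact hf₀0 (MvPolynomial.funext fun x => by rw [h x, map_zero])
  -- The zero direction works only in degree e = 0, where a nonzero scalar would lie in the ideal of
  -- the coordinates.
  by_cases hlam0 : ∀ j, lam j = 0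
  · have he0 : e = 0 := by
      by_contra he0
      refine hlam ?_
      have h0 := aeval_mul_of_isHomogeneous hhom lam (0 : k)
      rw [zero_pow he0, mul_zero] at h0
      rw [← MvPolynomial.coe_aeval_eq_eval]
      simpa [hlam0, show lam = fun _ => 0 from funext hlam0] using h0
    rw [hf₀, he0, MvPolynomial.homogeneousComponent_zero, MvPolynomial.eval_C] at hlam
    rw [hf₀, he0, MvPolynomial.homogeneousComponent_zero, MvPolynomial.aeval_C, pow_one] at hf₀mem
    exact H.scalar_notMem hlam hf₀mem
  · push Not at hlam0
    obtain ⟨j, hj⟩ := hlam0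
    set μ : ι → k := fun v => lam v / lam j with hμ
    have hμf : MvPolynomial.eval μ f₀ ≠ 0 := by
      intro h0
      have h1 := aeval_mul_of_isHomogeneous hhom μ (lam j)
      have h2 : (fun v => algebraMap k k (μ v) * lam j) = lam := by
        ext v
        exact div_mul_cancel₀ _ hj
      rw [h0, map_zero, zero_mul, h2] at h1
      exact hlam h1
    -- The equations of the line spanned by μ are one fewer than the coordinates. Modulo a prime
    -- containing them every coordinate is a multiple of y = z j, so f₀(z) = f₀(μ) y^e lies in
    -- (y^(e+1)). As f₀(μ) ≠ 0, this forces y = 0. So too few parameters would suffice, against the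
    -- height.
    have hpar : IsParameters S.ev (Set.range fun v : {v // v ≠ j} =>
        ((z v - μ v • z j : S.const) : F)) := by
      intro Q hQ hQm hQl
      refine H.isParameters Q hQ hQm ?_
      obtain ⟨P, hP, hPQ⟩ := H.exists_prime hQm
      have hPle : P ≤ Ideal.span (Set.range z) := by
        intro t ht
        rw [← H.mem_iff]
        exact locIdeal_mono hQm ((hPQ t).1 ht)
      set π := Ideal.Quotient.mkₐ k P
      have hπ : ∀ t, π t = 0 ↔ t ∈ P := fun t => Ideal.Quotient.eq_zero_iff_mem
      have hzv : ∀ v, π (z v) = algebraMap k _ (μ v) * π (z j) := by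
        intro v
        have : z v - μ v • z j ∈ P := by
          by_cases hv : v = j
          · rw [hv, hμ]
            simp only
            rw [div_self hj, one_smul, sub_self]; exact zero_mem _
          · exact (hPQ _).2 (hQl _ ⟨⟨v, hv⟩, rfl⟩)
        rw [← hπ, Algebra.smul_def, map_sub, map_mul, AlgHom.commutes, sub_eq_zero] at this
        exact this
      have hzj : z j ∈ P := by
        set y := π (z j) with hy
        have h1 : π (MvPolynomial.aeval z f₀) = algebraMap k _ (MvPolynomial.eval μ f₀) * y ^ e := by
          rw [← aeval_mul_of_isHomogeneous hhom, ← funext hzv]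
          exact (MvPolynomial.comp_aeval_apply z π f₀)
        have h2 : π (MvPolynomial.aeval z f₀) ∈ Ideal.span {y ^ (e + 1)} := by
          rw [← Ideal.span_singleton_pow]
          have h3 := Ideal.mem_map_of_mem π hf₀mem
          rw [Ideal.map_pow] at h3
          refine Ideal.pow_right_mono ?_ _ h3
          rw [Ideal.map_span, Ideal.span_le]
          rintro _ ⟨_, ⟨v, rfl⟩, rfl⟩
          rw [SetLike.mem_coe, hzv]
          exact Ideal.mul_mem_left _ _ (Ideal.mem_span_singleton_self y)
        obtain ⟨c, hc⟩ := Ideal.mem_span_singleton'.1 h2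
        obtain ⟨t, rfl⟩ := Ideal.Quotient.mkₐ_surjective k P c
        rw [h1, pow_succ] at hc
        have h4 : (algebraMap k (S.const ⧸ P) (MvPolynomial.eval μ f₀) - π t * y) * y ^ e = 0 := by
          linear_combination -hc
        rcases mul_eq_zero.1 h4 with h5 | h5
        · exfalso
          refine H.scalar_notMem hμf ?_
          have h6 : algebraMap k S.const (MvPolynomial.eval μ f₀) - t * z j ∈ P := by
            rw [← hπ, map_sub, map_mul, AlgHom.commutes]
            exact h5
          exact (Submodule.sub_mem_iff_left _ (Ideal.mul_mem_left _ _
            (Ideal.subset_span (Set.mem_range_self j)))).1 (hPle h6)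
        · exact (hπ _).1 (eq_zero_of_pow_eq_zero h5)
      rintro _ ⟨v, rfl⟩
      refine (hPQ _).1 ((hπ _).1 ?_)
      rw [hzv, (hπ _).2 hzj, mul_zero]
    have hht := hpar.height_le (κ := {v // v ≠ j}) (fun v => (H.mem_iff _).2 (by
      refine sub_mem (Ideal.subset_span ⟨_, rfl⟩) ?_
      rw [Algebra.smul_def]
      exact Ideal.mul_mem_left _ _ (Ideal.subset_span ⟨_, rfl⟩)))
    rw [H.height] at hht
    have : Fintype.card {v // v ≠ j} < Fintype.card ι := Fintype.card_subtype_lt (x := j) (by simp)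
    have h2 : Fintype.card ι ≤ Fintype.card {v // v ≠ j} := by exact_mod_cast hht
    omega

end ConstCoords
end FoliatedChart
end AlphaP
end

/-! ### Approximation of weight-zero monomials, and weights of expansions. -/

noncomputable section

namespace AlphaP

set_option linter.unusedSectionVars false

namespace FoliatedChart

variable {p : ℕ} {k A F : Type*} [Field k] [CommRing A] [IsDomain A] [Algebra k A]
    [Field F] [Algebra k F] [Algebra A F] [IsScalarTower k A F] [IsFractionRing A F]

lemma Δ_iterate_rotF (S : FoliatedChart p k A F) (n : ℕ) (x : F) :
    S.Δ^[n] (S.rotF x) = S.slope ^ n • S.rotF (S.Δ^[n] x) := by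
  induction n with
  | zero => simp
  | succ n ih =>
    rw [Function.iterate_succ_apply', ih, Function.iterate_succ_apply', Derivation.map_smul,
      S.Δ_rotF, smul_smul, pow_succ]

lemma rotF_constProj (S : FoliatedChart p k A F) (x : F) :
    S.rotF (constProj p S.Δ (algebraMap A F S.slice) x) =
      constProj p S.Δ (algebraMap A F S.slice) (S.rotF x) := by
  simp only [constProj, map_sum]
  refine Finset.sum_congr rfl fun n _ => ?_
  rw [map_mul, map_mul, map_pow, map_neg, map_inv₀, map_natCast, S.rotF_slice, Δ_iterate_rotF,
    ← smul_neg, smul_pow, smul_mul_assoc, smul_mul_assoc, mul_smul_comm]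

lemma Δ_iterate_mem_locIdeal (S : FoliatedChart p k A F) (n L : ℕ) {x : F}
    (hx : x ∈ locIdeal F S.ev (RingHom.ker S.ev ^ (L + n))) :
    S.Δ^[n] x ∈ locIdeal F S.ev (RingHom.ker S.ev ^ L) := by
  induction n generalizing x with
  | zero => exact hx
  | succ n ih => rw [Function.iterate_succ_apply]; exact ih (S.Δ_mem_locIdeal_pow _ hx)

/-- Each application of Δ costs one order and fewer than p applications occur, so a reserve of p
orders is enough. -/
lemma constProj_mem_locIdeal (S : FoliatedChart p k A F) (L : ℕ) (y : A) {x : F}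
    (hx : x ∈ locIdeal F S.ev (RingHom.ker S.ev ^ (L + p))) :
    constProj p S.Δ (algebraMap A F y) x ∈ locIdeal F S.ev (RingHom.ker S.ev ^ L) := by
  refine sum_mem fun n hn => mul_mem_locIdeal_of_mem_locRing (mul_mem ?_ ?_)
    (S.Δ_iterate_mem_locIdeal n L (locIdeal_mono (Ideal.pow_le_pow_right ?_) hx))
  · exact pow_mem (neg_mem (algebraMap_mem_locRing F _ y)) _
  · rw [← map_natCast (algebraMap k F), ← map_inv₀]
    exact scalar_mem_locRing F _ _
  · have := Finset.mem_range.1 hn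
    omega

namespace ConstCoords

variable {S : FoliatedChart p k A F} {ι M : Type*} [Fintype ι] [AddCommGroup M]
  {z : ι → S.const} {r : ι → M} {χ : AddChar M k} {m g : ℕ} (H : S.ConstCoords z r χ m g)

include H

/-- An element of `A` equal to one at the point and to zero at the other points of its orbit, to
high order. -/
lemma exists_bump (L : ℕ) : ∃ e : A, e - 1 ∈ RingHom.ker S.ev ^ L ∧
    ∀ s, s < S.order → ¬ m ∣ s → S.rot^[s] e ∈ RingHom.ker S.ev ^ L := by
  classical
  set bad := (Finset.range S.order).filter fun s => ¬ m ∣ s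
  -- By `exists_ne` the rotations not divisible by m move the point. The corresponding maximal
  -- ideals are therefore different from that of the point, and the Chinese remainder theorem
  -- applies.
  have hco : IsCoprime (RingHom.ker S.ev ^ L) (∏ s ∈ bad, S.orbitIdeal s ^ L) := by
    refine IsCoprime.prod_right fun s hs => IsCoprime.pow ?_
    refine Ideal.isCoprime_of_isMaximal ?_
    intro h
    obtain ⟨a, ha⟩ := H.exists_ne s (Finset.mem_filter.1 hs).2
    refine ha ?_
    have h1 : a - algebraMap k A (S.ev a) ∈ RingHom.ker S.ev := by
      rw [RingHom.mem_ker, map_sub, AlgHom.commutes, Algebra.algebraMap_self_apply, sub_self]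
    rw [h, mem_orbitIdeal, ← rot_pow_apply, map_sub, AlgEquiv.commutes, map_sub, AlgHom.commutes,
      sub_eq_zero, rot_pow_apply] at h1
    exact h1
  obtain ⟨i, hi, j, hj, hij⟩ := Ideal.isCoprime_iff_exists.1 hco
  refine ⟨j, ?_, fun s hs hms => ?_⟩
  · have : j - 1 = -i := by rw [← hij]; ring
    rw [this]; exact neg_mem hi
  · have h1 : j ∈ S.orbitIdeal s ^ L :=
      Ideal.le_of_dvd (Finset.dvd_prod_of_mem _ (Finset.mem_filter.2
        ⟨Finset.mem_range.2 hs, hms⟩)) hj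
    have h2 := Ideal.le_comap_pow _ L h1
    rw [← rot_pow_apply]
    exact h2

lemma order_factors_ne_zero : (m : k) ≠ 0 ∧ (g : k) ≠ 0 := by
  have := S.order_ne_zero
  rw [H.order_eq, Nat.cast_mul] at this
  exact ⟨left_ne_zero_of_mul this, right_ne_zero_of_mul this⟩

lemma rot_monomial (α : ι →₀ ℕ) :
    S.rotF^[m] ((MvPolynomial.aeval z (MvPolynomial.monomial α (1 : k)) : S.const) : F) =
      χ (Finsupp.weight r α) •
        ((MvPolynomial.aeval z (MvPolynomial.monomial α (1 : k)) : S.const) : F) := by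
  have hcoe : ((MvPolynomial.aeval z (MvPolynomial.monomial α (1 : k)) : S.const) : F) =
      α.prod fun v n => (z v : F) ^ n := by
    rw [MvPolynomial.aeval_monomial, map_one, one_mul]
    exact map_finsuppProd S.const.val α _
  have hχ : χ (Finsupp.weight r α) = α.prod fun v n => χ (r v) ^ n := by
    rw [Finsupp.weight_apply, Finsupp.sum, Finsupp.prod]
    simp only [← AddChar.map_nsmul_eq_pow]
    exact map_prod χ.toMonoidHom (fun v => Multiplicative.ofAdd (α v • r v)) α.support
  rw [hcoe, hχ, Finsupp.prod, Finsupp.prod, ← AlgEquiv.coe_pow, map_prod, Algebra.smul_def,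
    map_prod, ← Finset.prod_mul_distrib]
  refine Finset.prod_congr rfl fun v _ => ?_
  rw [map_pow, AlgEquiv.coe_pow, H.rot_coord, Algebra.smul_def, mul_pow, map_pow]

variable [hp : Fact p.Prime] [CharP F p]

/-- Monomials of weight zero are approximated by invariant constants. -/
lemma dense [IsNoetherianRing A] (α : ι →₀ ℕ) (hα : Finsupp.weight r α = 0) (n : ℕ) :
    ∃ o : S.const, (o : F) ∈ S.inv ∧
      MvPolynomial.aeval z (MvPolynomial.monomial α (1 : k)) - o ∈ Ideal.span (Set.range z) ^ n := by
  obtain ⟨N, hN⟩ := H.exists_cofinal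
  set t := MvPolynomial.aeval z (MvPolynomial.monomial α (1 : k)) with ht
  -- The order N n is what `exists_cofinal` requires; the additional p is lost in the Taylor
  -- projection.
  set L := N * n + p
  obtain ⟨e, he1, he⟩ := H.exists_bump L
  obtain ⟨f, hf⟩ := exists_sub_mem_locIdeal_pow t.2.1 L
  have htη : ∀ j, S.rotF^[m * j] (t : F) = t := by
    intro j
    rw [Function.iterate_mul]
    refine Function.iterate_fixed ?_ j
    rw [ht, H.rot_monomial, hα, AddChar.map_zero_eq_one, one_smul]
  have hm0 : 0 < m := Nat.pos_of_ne_zero fun h => H.order_factors_ne_zero.1 (by simp [h])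
  -- Near the point e f approximates t. Rotations in the stabilizer fix t, because its weight is
  -- zero, and preserve the order of vanishing.
  have hgood : ∀ s, m ∣ s → S.rotF^[s] (algebraMap A F (e * f)) - t ∈
      locIdeal F S.ev (RingHom.ker S.ev ^ L) := by
    rintro s ⟨j, rfl⟩
    conv => enter [2, 2]; rw [← htη j]
    rw [← iterate_map_sub]
    refine S.rotF_iterate_mem_locIdeal (fun a => ?_) ?_
    · rw [Function.iterate_mul]
      clear * - H
      induction j generalizing a with
      | zero => rfl
      | succ j ih => rw [Function.iterate_succ_apply, ih, H.ev_rot]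
    · have : algebraMap A F (e * f) - t = algebraMap A F ((e - 1) * f) - (t - algebraMap A F f) := by
        rw [map_mul, map_mul, map_sub, map_one]; ring
      rw [this]
      exact sub_mem (algebraMap_mem_locIdeal (Ideal.mul_mem_right _ _ he1)) hf
  have hbad : ∀ s, s < S.order → ¬ m ∣ s → S.rotF^[s] (algebraMap A F (e * f)) ∈
      locIdeal F S.ev (RingHom.ker S.ev ^ L) := by
    intro s hs hms
    rw [rotF_iterate_algebraMap, iterate_map_mul]
    exact algebraMap_mem_locIdeal (Ideal.mul_mem_right _ _ (he s hs hms))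
  -- Exactly g rotations lie in the stabilizer and each contributes t; the others are negligible
  -- because of the factor e.
  have hsum : ∑ s ∈ Finset.range S.order, S.rotF^[s] (algebraMap A F (e * f)) - (g : F) * t ∈
      locIdeal F S.ev (RingHom.ker S.ev ^ L) := by
    classical
    have hcard : (((Finset.range S.order).filter (m ∣ ·)).card : F) = g := by
      congr 1
      rw [H.order_eq, show (Finset.range (m * g)).filter (m ∣ ·) =
        (Finset.range g).image (m * ·) from ?_, Finset.card_image_of_injective _
          (mul_right_injective₀ hm0.ne'), Finset.card_range]
      ext s
      simp only [Finset.mem_filter, Finset.mem_range, Finset.mem_image]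
      constructor
      · rintro ⟨h1, j, rfl⟩
        exact ⟨j, lt_of_mul_lt_mul_left h1 (Nat.zero_le m), rfl⟩
      · rintro ⟨j, hj, rfl⟩
        exact ⟨Nat.mul_lt_mul_of_pos_left hj hm0, dvd_mul_right _ _⟩
    rw [← hcard, ← nsmul_eq_mul, ← Finset.sum_const, ← Finset.sum_filter_add_sum_filter_not _
      (m ∣ ·), add_sub_right_comm, ← Finset.sum_sub_distrib]
    refine add_mem (sum_mem fun s hs => hgood s (Finset.mem_filter.1 hs).2)
      (sum_mem fun s hs => hbad s (Finset.mem_range.1 (Finset.mem_filter.1 hs).1)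
        (Finset.mem_filter.1 hs).2)
  -- The average divides by the order m g, whereas the sum is close to g t; the factor m corrects
  -- this.
  set h : F := (m : F) * S.avg (algebraMap A F (e * f)) with hh
  have hg0 : (g : F) ≠ 0 := by
    rw [← map_natCast (algebraMap k F)]
    exact (map_ne_zero _).2 H.order_factors_ne_zero.2
  have hmF : (m : F) ≠ 0 := by
    rw [← map_natCast (algebraMap k F)]
    exact (map_ne_zero _).2 H.order_factors_ne_zero.1
  have hht : (t : F) - h ∈ locIdeal F S.ev (RingHom.ker S.ev ^ L) := by
    have h1 : (t : F) - h = -((g : F)⁻¹ *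
        (∑ s ∈ Finset.range S.order, S.rotF^[s] (algebraMap A F (e * f)) - (g : F) * t)) := by
      rw [hh, avg, H.order_eq, Nat.cast_mul]
      field_simp
      ring
    rw [h1]
    refine neg_mem (mul_mem_locIdeal_of_mem_locRing ?_ hsum)
    rw [← map_natCast (algebraMap k F), ← map_inv₀]
    exact scalar_mem_locRing F _ _
  have hloc : h ∈ locRing F S.ev := by
    refine mul_mem (natCast_mem _ m) (S.mem_locRing_of_mem_aLoc (S.avg_mem_aLoc ?_))
    exact S.aLoc.algebraMap_mem _
  -- The average is invariant but need not be constant. The Taylor projection makes it constant,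
  -- commutes with the rotation and leaves the constant t unchanged.
  have hinv : constProj p S.Δ (algebraMap A F S.slice) h ∈ S.inv := by
    refine ⟨S.constProj_mem (fun _ => S.Δ_mem_locRing) _ hloc, ?_, S.Δ_constProj S.Δ_slice h⟩
    rw [rotF_constProj, hh, map_mul, map_natCast, S.rotF_avg]
  refine ⟨⟨_, S.inv_le_const hinv⟩, hinv, hN n _ ?_⟩
  change (t : F) - constProj p S.Δ (algebraMap A F S.slice) h ∈ _
  have h2 : (t : F) - constProj p S.Δ (algebraMap A F S.slice) h =
      constProj p S.Δ (algebraMap A F S.slice) (t - h) := by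
    have h3 := constProj_add (p := p) (Δ := S.Δ) (y := algebraMap A F S.slice) ((t : F) - h) h
    rw [sub_add_cancel, constProj_of_const _ t.2.2] at h3
    exact sub_eq_of_eq_add h3
  rw [h2]
  exact S.constProj_mem_locIdeal _ _ hht

lemma exists_rotConst : ∃ η : S.const →ₐ[k] S.const, ∀ t, (η t : F) = S.rotF^[m] (t : F) := by
  refine ⟨((S.rotF ^ m : F ≃ₐ[k] F).toAlgHom.comp S.const.val).codRestrict S.const ?_, fun t => ?_⟩
  · intro t
    change (S.rotF ^ m) (t : F) ∈ _
    rw [AlgEquiv.coe_pow]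
    refine ⟨mem_locRing_of_mem_locIdeal (S.rotF_iterate_mem_locIdeal H.ev_rot (L := 0) ?_), ?_⟩
    · rw [pow_zero, Ideal.one_eq_top, locIdeal_top]; exact t.2.1
    · rw [Δ_rotF_iterate, t.2.2, iterate_map_zero, smul_zero]
  · change (S.rotF ^ m) (t : F) = _
    rw [AlgEquiv.coe_pow]

/-- The expansions of invariant constants have weight zero. -/
lemma hom [IsNoetherianRing A] [Infinite k] {o : S.const} (ho : (o : F) ∈ S.inv) (n : ℕ)
    (f : MvPolynomial ι k) (hf : o - MvPolynomial.aeval z f ∈ Ideal.span (Set.range z) ^ n)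
    (α : ι →₀ ℕ) (hα : α.degree < n) (hα0 : Finsupp.weight r α ≠ 0) : f.coeff α = 0 := by
  classical
  obtain ⟨η, hη⟩ := H.exists_rotConst
  have hstab : ∀ t ∈ Ideal.span (Set.range z) ^ n, η t ∈ Ideal.span (Set.range z) ^ n := by
    intro t ht
    have h1 := Ideal.mem_map_of_mem η ht
    rw [Ideal.map_pow] at h1
    refine Ideal.pow_right_mono ?_ n h1
    rw [Ideal.map_span, Ideal.span_le]
    rintro _ ⟨_, ⟨v, rfl⟩, rfl⟩
    have h2 : η (z v) = algebraMap k S.const (χ (r v)) * z v := Subtype.ext (by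
      rw [hη, H.rot_coord, Algebra.smul_def]; rfl)
    rw [SetLike.mem_coe, h2]
    exact Ideal.mul_mem_left _ _ (Ideal.subset_span ⟨v, rfl⟩)
  have hηo : η o = o := Subtype.ext (by rw [hη, S.rotF_iterate_fixed ho.2.1])
  have hmon : ∀ β (c : k), η (MvPolynomial.aeval z (MvPolynomial.monomial β c)) =
      MvPolynomial.aeval z (MvPolynomial.monomial β (χ (Finsupp.weight r β) * c)) := by
    intro β c
    have h1 : ∀ c : k, MvPolynomial.monomial β c = c • MvPolynomial.monomial β (1 : k) := by
      intro c; rw [MvPolynomial.smul_monomial, smul_eq_mul, mul_one]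
    rw [h1 c, h1 (_ * c), map_smul, map_smul, map_smul, mul_comm, ← smul_smul]
    congr 1
    refine Subtype.ext ?_
    rw [hη, H.rot_monomial]
    rfl
  -- Applying the generator of the stabilizer to f(z) scales each coefficient by the character of
  -- its weight. As o is fixed, f and G both approximate it, and independence compares their
  -- coefficients.
  set G : MvPolynomial ι k := ∑ β ∈ f.support,
    MvPolynomial.monomial β (χ (Finsupp.weight r β) * f.coeff β) with hG
  have hGf : MvPolynomial.aeval z G = η (MvPolynomial.aeval z f) := by
    conv_rhs => rw [f.as_sum]
    rw [hG, map_sum, map_sum, map_sum]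
    exact Finset.sum_congr rfl fun β _ => (hmon β _).symm
  have hcoeff : G.coeff α = χ (Finsupp.weight r α) * f.coeff α := by
    rw [hG, MvPolynomial.coeff_sum]
    simp only [MvPolynomial.coeff_monomial, Finset.sum_ite_eq']
    split_ifs with h
    · rfl
    · rw [MvPolynomial.notMem_support_iff.1 h, mul_zero]
  have h1 : MvPolynomial.aeval z (G - f) ∈ Ideal.span (Set.range z) ^ n := by
    have h2 := sub_mem hf (hstab _ hf)
    rw [map_sub, hηo, ← hGf] at h2
    rw [map_sub]
    convert h2 using 1
    ring
  have h3 := H.ind n _ h1 α hα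
  rw [MvPolynomial.coeff_sub, hcoeff, ← sub_one_mul] at h3
  exact (mul_eq_zero.1 h3).resolve_left fun h => hα0 (H.faithful _ (sub_eq_zero.1 h))

/-! ### The chart of the local ring of invariant constants -/

variable {X : Type*} [CommRing X] [Algebra k X] [IsLocalRing X] (ψ : X →ₐ[k] F)
  (hψ : ∀ x, x ∈ S.inv ↔ ∃ o, ψ o = x)

include hψ

/-- Invariant constants vanishing to high order at the point modulo `w`, where `w` is zero or the
equation of the divisor. -/
lemma exists_cofinal_inv [IsNoetherianRing A] (q : ι → X)
    (hq : ∀ v, q v ∈ IsLocalRing.maximalIdeal X)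
    (hpar : IsParameters S.ev (Set.range fun v => ψ (q v))) :
    ∃ N, ∀ n, locIdeal F S.ev (RingHom.ker S.ev ^ (N * n)) ≤
      Submodule.span (locRing F S.ev) (ψ '' (IsLocalRing.maximalIdeal X ^ n : Ideal X)) := by
  obtain ⟨N, hN⟩ := hpar.exists_pow_le_pow (by
    rintro _ ⟨v, rfl⟩; exact S.apply_mem_locRing ψ hψ _)
  refine ⟨N, fun n => (hN n).trans (le_trans ?_ (span_image_pow_le (ψ : X →+* F) _ n))⟩
  refine pow_le_pow_left' (Submodule.span_mono ?_) n
  rintro _ ⟨v, rfl⟩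
  exact ⟨q v, hq v, rfl⟩

/-- The invariant constants as constants. -/
def toConst : X →ₐ[k] S.const :=
  ψ.codRestrict S.const fun o => S.inv_le_const ((hψ _).2 ⟨o, rfl⟩)

lemma isWeightedChart [IsNoetherianRing A] [Infinite k] (hinj : Function.Injective ψ) (q : ι → X)
    (hq : ∀ v, q v ∈ IsLocalRing.maximalIdeal X)
    (hpar : IsParameters S.ev (Set.range fun v => ψ (q v))) :
    IsWeightedChart (toConst ψ hψ) z r where
  exp := H.exp
  ind := H.ind
  loc o ho := (H.mem_iff _).1 ((S.mem_maximalIdeal_iff ψ hψ hinj).1 ho)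
  cof n := by
    obtain ⟨N, hN⟩ := H.exists_cofinal_inv ψ hψ q hq hpar
    refine ⟨N * n, fun o ho => ?_⟩
    rw [← S.purity_zero ψ hψ hinj]
    exact hN n (H.coe_mem_of_mem_pow ho)
  dense α hα n := by
    obtain ⟨o, ho, h⟩ := H.dense α hα n
    obtain ⟨x, hx⟩ := (hψ _).1 ho
    have : toConst ψ hψ x = o := Subtype.ext hx
    exact ⟨x, by rwa [this]⟩
  hom o n f hf α hα hα0 := H.hom ((hψ _).2 ⟨o, rfl⟩) n f hf α hα hα0

/-- The pair of the local ring of invariant constants and the divisor is a cyclic quotient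
singularity. -/
lemma isCyclicQuotient [IsNoetherianRing A] [UniqueFactorizationMonoid A] [Infinite k]
    {n : ℕ} [NeZero n] {a : ι → ℤ} {χ : AddChar (ZMod n) k}
    (H : S.ConstCoords z (fun v => (a v : ZMod n)) χ m g)
    (hinj : Function.Injective ψ) (q : ι → X)
    (hq : ∀ v, q v ∈ IsLocalRing.maximalIdeal X)
    (hpar : IsParameters S.ev (Set.range fun v => ψ (q v))) (c : ι)
    (hc : ∃ e ∈ locRing F S.ev, e ≠ 0 ∧ e⁻¹ ∈ locRing F S.ev ∧ (z c : F) = algebraMap A F S.div * e)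
    (B : Ideal X) (hB : ∀ o, o ∈ B ↔ ψ o ∈ locIdeal F S.ev (Ideal.span {S.div})) :
    IsCyclicQuotient k X B n a c := by
  obtain rfl : B = S.contraction ψ hψ (Ideal.span {S.div}) := Ideal.ext hB
  have hle : Ideal.span {S.div} ≤ RingHom.ker S.ev := by
    rw [Ideal.span_le, Set.singleton_subset_iff]; exact S.ev_div
  have : (Ideal.span {S.div}).IsPrime :=
    (Ideal.span_singleton_prime S.div_prime.ne_zero).2 S.div_prime
  have := S.isNoetherianRing ψ hψ hinj
  obtain ⟨e, he, he0, he', hce⟩ := hc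
  have hd0 : algebraMap A F S.div ≠ 0 := by
    rw [Ne, IsFractionRing.to_map_eq_zero_iff]; exact S.div_prime.ne_zero
  exact
  { pos := Nat.pos_of_ne_zero (NeZero.ne n)
    noetherian := this
    dim := S.ringKrullDim_eq ψ hψ hinj hq hpar H.height
    domain := S.isDomain ψ hψ hinj
    normal := S.isIntegrallyClosed ψ hψ hinj
    qfactorial := fun P hP hP1 => S.exists_radical_span ψ hψ hinj hP hP1
    prime := S.contraction_isPrime ψ hψ hle
    height := S.contraction_height ψ hψ hinj S.div_prime S.ev_div
    exists_action := by
      refine (H.isWeightedChart ψ hψ hinj q hq hpar).exists_action _ c ?_ ?_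
      · intro o ho
        obtain ⟨x, hx, hox⟩ := mem_locIdeal_span_singleton.1 ho
        have hoz : ψ o = z c * (e⁻¹ * x) := by rw [hox, hce]; field_simp
        have hz0 : (z c : F) ≠ 0 := by rw [hce]; exact mul_ne_zero hd0 he0
        -- A quotient of two constants is constant, so divisibility by the divisor upstairs becomes
        -- divisibility by z c within the ring of constants.
        have hΔ : S.Δ (e⁻¹ * x) = 0 := by
          have h1 := S.Δ_apply ψ hψ o
          rw [hoz, Derivation.leibniz, (z c).2.2, smul_zero, add_zero, smul_eq_mul] at h1
          exact (mul_eq_zero.1 h1).resolve_left hz0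
        rw [Ideal.mem_span_singleton]
        exact ⟨⟨e⁻¹ * x, mul_mem he' hx, hΔ⟩, Subtype.ext hoz⟩
      · intro n
        obtain ⟨N, hN⟩ := H.exists_cofinal_inv ψ hψ q hq hpar
        refine ⟨N * n, fun o ho => ?_⟩
        obtain ⟨y, hy, s, hs, hys⟩ := Submodule.mem_sup.1 ho
        obtain ⟨t, rfl⟩ := Ideal.mem_span_singleton'.1 hy
        have h1 := H.coe_mem_of_mem_pow hs
        -- Upstairs o is a multiple of the divisor plus an element of the extended n-th power;
        -- purity relative to the divisor realizes such a splitting inside X.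
        obtain ⟨b, hb, hob⟩ := S.purity_div ψ hψ (IsLocalRing.maximalIdeal X ^ n) (o := o) (by
          have : ψ o = (t : F) * (algebraMap A F S.div * e) + s := by
            rw [← hce]; exact (congrArg Subtype.val hys).symm
          rw [this]
          refine add_mem ?_ (Submodule.span_mono (Set.subset_insert _ _) (hN n h1))
          have := (Submodule.span (locRing F S.ev) (insert (algebraMap A F S.div)
            (ψ '' (IsLocalRing.maximalIdeal X ^ n : Ideal X)))).smul_mem
            ⟨_, mul_mem t.2.1 he⟩ (Submodule.subset_span (Set.mem_insert _ _))
          refine (congrArg (· ∈ _) ?_).mp this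
          change (t : F) * e * algebraMap A F S.div = _
          ring)
        exact Submodule.mem_sup.2 ⟨o - b, hob, b, hb, sub_add_cancel o b⟩ }

/-- If all weights are zero, then the local ring of invariant constants is regular. -/
lemma isRegularLocalRing [IsNoetherianRing A] [Infinite k] (hr : ∀ v, r v = 0)
    (hinj : Function.Injective ψ) (q : ι → X) (hq : ∀ v, q v ∈ IsLocalRing.maximalIdeal X)
    (hpar : IsParameters S.ev (Set.range fun v => ψ (q v))) : IsRegularLocalRing X := by
  have := S.isNoetherianRing ψ hψ hinj
  have C := H.isWeightedChart ψ hψ hinj q hq hpar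
  obtain ⟨h, hh⟩ := C.cof 2
  have hw : ∀ α : ι →₀ ℕ, Finsupp.weight r α = 0 := by
    intro α
    rw [Finsupp.weight_apply]
    simp [hr]
  -- Every monomial has weight zero, so the coordinates themselves are approximated by elements of
  -- X. The order h + 1 makes the error both at least h, as `hh` needs, and positive.
  have hd : ∀ v, ∃ o, z v - toConst ψ hψ o ∈ Ideal.span (Set.range z) ^ (h + 1) := by
    intro v
    obtain ⟨o, ho⟩ := C.dense (Finsupp.single v 1) (hw _) (h + 1)
    exact ⟨o, by simpa [MvPolynomial.aeval_monomial] using ho⟩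
  choose o ho using hd
  have hmem : ∀ x, toConst ψ hψ x ∈ Ideal.span (Set.range z) →
      x ∈ IsLocalRing.maximalIdeal X := fun x hx =>
    (S.mem_maximalIdeal_iff ψ hψ hinj).2 ((H.mem_iff _).2 hx)
  have hom : ∀ v, o v ∈ IsLocalRing.maximalIdeal X := by
    intro v
    refine hmem _ ?_
    rw [← Submodule.sub_mem_iff_right _ (Ideal.subset_span (Set.mem_range_self v))]
    exact Ideal.pow_le_self (Nat.succ_ne_zero h) (ho v)
  -- Expand x in the coordinates z and substitute the elements o. The error has order at least h
  -- upstairs, so it lies in the square of the maximal ideal of X, and Nakayama's lemma applies.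
  have hle : IsLocalRing.maximalIdeal X ≤ Ideal.span (Set.range o) ⊔
      IsLocalRing.maximalIdeal X • IsLocalRing.maximalIdeal X := by
    intro x hx
    obtain ⟨f, hf⟩ := exists_aeval_sub_mem C.exp (h + 1) (toConst ψ hψ x)
    have hf0 : f.coeff 0 = 0 := by
      refine C.ind 1 f ?_ 0 (by simp)
      rw [pow_one]
      exact (Submodule.sub_mem_iff_right _ (C.loc x hx)).1
        (Ideal.pow_le_self (Nat.succ_ne_zero h) hf)
    have h1 : x - MvPolynomial.aeval o f ∈ IsLocalRing.maximalIdeal X ^ 2 := by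
      refine hh _ (Ideal.pow_le_pow_right (Nat.le_succ h) ?_)
      rw [map_sub, MvPolynomial.comp_aeval_apply]
      have h2 : MvPolynomial.aeval z f - MvPolynomial.aeval (fun v => toConst ψ hψ (o v)) f ∈
          Ideal.span (Set.range z) ^ (h + 1) := by
        rw [← Ideal.Quotient.eq_zero_iff_mem, map_sub, sub_eq_zero]
        have h3 := MvPolynomial.comp_aeval_apply (R := k) z
          (Ideal.Quotient.mkₐ k (Ideal.span (Set.range z) ^ (h + 1))) f
        have h4 := MvPolynomial.comp_aeval_apply (R := k) (fun v => toConst ψ hψ (o v))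
          (Ideal.Quotient.mkₐ k (Ideal.span (Set.range z) ^ (h + 1))) f
        refine (h3.trans ?_).trans h4.symm
        congr 2
        ext v
        exact Ideal.Quotient.eq.2 (ho v)
      have := add_mem hf h2
      rwa [sub_add_sub_cancel] at this
    rw [smul_eq_mul, ← pow_two]
    refine Submodule.mem_sup.2 ⟨MvPolynomial.aeval o f, ?_, _, h1, by ring⟩
    have := aeval_mem_pow (n := 1) o f fun α hα => by
      rw [(Finsupp.degree_eq_zero_iff α).1 (by omega), hf0]
    rwa [pow_one] at this
  have hspan : IsLocalRing.maximalIdeal X = Ideal.span (Set.range o) := by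
    refine le_antisymm (Submodule.le_of_le_smul_of_le_jacobson_bot (IsNoetherian.noetherian _)
      (IsLocalRing.maximalIdeal_le_jacobson _) hle) (Ideal.span_le.2 ?_)
    rintro _ ⟨v, rfl⟩
    exact hom v
  refine IsRegularLocalRing.of_spanFinrank_maximalIdeal_le X ?_
  rw [S.ringKrullDim_eq ψ hψ hinj hq hpar H.height, hspan]
  have h1 : (Ideal.span (Set.range o)).spanFinrank ≤ (Set.range o).ncard :=
    Submodule.spanFinrank_span_le_ncard_of_finite (Set.finite_range o)
  have h2 : (Set.range o).ncard ≤ Fintype.card ι := by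
    rw [← Set.image_univ, ← Nat.card_eq_fintype_card, ← Set.ncard_univ]
    exact Set.ncard_image_le
  exact_mod_cast h1.trans h2

end ConstCoords
end FoliatedChart
end AlphaP
end

noncomputable section

namespace AlphaP

set_option linter.unusedSectionVars false

/-! ### Derivations, scalings and points of polynomial rings -/

section Extension

variable {k A F : Type*} [Field k] [CommRing A] [IsDomain A] [Algebra k A] [Field F]
  [Algebra k F] [Algebra A F] [IsScalarTower k A F] [IsFractionRing A F]

/-- A derivation extends to the fraction field. -/
lemma exists_derivation_extension (D : Derivation k A A) :
    ∃ D' : Derivation k F F, ∀ a, D' (algebraMap A F a) = algebraMap A F (D a) := by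
  have hsm : ∀ (c : k) (a : A), algebraMap A F (c • a) = c • algebraMap A F a := fun c a => by
    rw [Algebra.smul_def, map_mul, ← IsScalarTower.algebraMap_apply, Algebra.smul_def]
  -- A derivation is a homomorphism a ↦ a + ε D a to the dual numbers. Nonzero elements become units
  -- there, so the homomorphism extends to the fraction field.
  let φ : A →ₐ[k] TrivSqZeroExt F F := AlgHom.ofLinearMap
    { toFun := fun a => (algebraMap A F a, algebraMap A F (D a))
      map_add' := fun a b => Prod.ext (map_add _ _ _)
        ((congrArg (algebraMap A F) (map_add D a b)).trans (map_add _ _ _))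
      map_smul' := fun c a => Prod.ext (hsm c a)
        ((congrArg (algebraMap A F) (D.map_smul c a)).trans (hsm c (D a))) }
    (Prod.ext (map_one _) ((congrArg (algebraMap A F) D.map_one_eq_zero).trans (map_zero _)))
    (fun a b => TrivSqZeroExt.ext (map_mul _ _ _) (by
      change algebraMap A F (D (a * b)) = algebraMap A F a * algebraMap A F (D b) +
        algebraMap A F (D a) * algebraMap A F b
      rw [D.leibniz, map_add, smul_eq_mul, smul_eq_mul, map_mul, map_mul,
        mul_comm (algebraMap A F b)]))
  have hfstφ : ∀ a, TrivSqZeroExt.fst (φ a) = algebraMap A F a := fun _ => rfl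
  have hsndφ : ∀ a, TrivSqZeroExt.snd (φ a) = algebraMap A F (D a) := fun _ => rfl
  have hφ : ∀ y : nonZeroDivisors A, IsUnit (φ y) := by
    intro y
    rw [TrivSqZeroExt.isUnit_iff_isUnit_fst, hfstφ]
    exact IsLocalization.map_units F y
  let Φ : F →ₐ[k] TrivSqZeroExt F F := IsLocalization.liftAlgHom (M := nonZeroDivisors A) hφ
  have hΦ : ∀ a, Φ (algebraMap A F a) = φ a := fun a => IsLocalization.lift_eq hφ a
  have hfst : ∀ x, TrivSqZeroExt.fst (Φ x) = x := by
    intro x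
    obtain ⟨a, b, -, rfl⟩ := IsFractionRing.div_surjective (A := A) x
    have h : ∀ x, TrivSqZeroExt.fst (Φ x) = (TrivSqZeroExt.fstHom k F F).comp Φ x := fun _ => rfl
    rw [h, map_div₀, ← h, ← h, hΦ, hΦ, hfstφ, hfstφ]
  refine ⟨Derivation.mk' ((TrivSqZeroExt.sndHom F F).restrictScalars k ∘ₗ Φ.toLinearMap) ?_, ?_⟩
  · intro a b
    change TrivSqZeroExt.snd (Φ (a * b)) = a * TrivSqZeroExt.snd (Φ b) +
      b * TrivSqZeroExt.snd (Φ a)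
    rw [map_mul, TrivSqZeroExt.snd_mul, hfst, hfst]
    exact congrArg _ (mul_comm (TrivSqZeroExt.snd (Φ a)) b)
  · intro a
    change TrivSqZeroExt.snd (Φ (algebraMap A F a)) = _
    rw [hΦ, hsndφ]

end Extension

section Scale

variable {k σ : Type*} [Field k]

/-- The automorphism of a polynomial ring which multiplies the variables by scalars. -/
def scaleVars (c : σ → kˣ) : MvPolynomial σ k ≃ₐ[k] MvPolynomial σ k :=
  AlgEquiv.ofAlgHom (MvPolynomial.aeval fun v => (c v : k) • MvPolynomial.X v)
    (MvPolynomial.aeval fun v => ((c v)⁻¹ : kˣ).1 • MvPolynomial.X v)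
    (by ext v; simp [smul_smul])
    (by ext v; simp [smul_smul])

lemma scaleVars_X (c : σ → kˣ) (v : σ) :
    scaleVars c (MvPolynomial.X v) = (c v : k) • MvPolynomial.X v := by
  simp [scaleVars]

lemma scaleVars_iterate_X (c : σ → kˣ) (n : ℕ) (v : σ) :
    (scaleVars c)^[n] (MvPolynomial.X v) = ((c v : k) ^ n) • MvPolynomial.X v := by
  induction n with
  | zero => simp
  | succ n ih => rw [Function.iterate_succ_apply', ih, map_smul, scaleVars_X, smul_smul, pow_succ]

lemma scaleVars_iterate_eq (c : σ → kˣ) {n : ℕ} (h : ∀ v, c v ^ n = 1) (f : MvPolynomial σ k) :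
    (scaleVars c)^[n] f = f := by
  rw [← AlgEquiv.coe_pow]
  have h1 : ((scaleVars c ^ n : MvPolynomial σ k ≃ₐ[k] _) : MvPolynomial σ k →ₐ[k] _) =
      AlgHom.id k _ := by
    ext v
    have h2 : (c v : k) ^ n = 1 := by rw [← Units.val_pow_eq_pow_val, h v, Units.val_one]
    simp [AlgEquiv.coe_pow, scaleVars_iterate_X, h2]
  exact DFunLike.congr_fun h1 f

lemma aeval_scaleVars_iterate (c : σ → kˣ) (n : ℕ) (a : σ → k) (f : MvPolynomial σ k) :
    MvPolynomial.aeval a ((scaleVars c)^[n] f) =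
      MvPolynomial.aeval (fun v => (c v : k) ^ n * a v) f := by
  rw [← AlgEquiv.coe_pow]
  have h1 : (MvPolynomial.aeval a).comp
      ((scaleVars c ^ n : MvPolynomial σ k ≃ₐ[k] _) : MvPolynomial σ k →ₐ[k] _) =
      (MvPolynomial.aeval (fun v => (c v : k) ^ n * a v) : MvPolynomial σ k →ₐ[k] k) := by
    ext v
    simp [AlgEquiv.coe_pow, scaleVars_iterate_X]
  exact DFunLike.congr_fun h1 f

/-- The translation of a polynomial ring. -/
def translate (a : σ → k) : MvPolynomial σ k ≃ₐ[k] MvPolynomial σ k :=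
  AlgEquiv.ofAlgHom (MvPolynomial.aeval fun v => MvPolynomial.X v + MvPolynomial.C (a v))
    (MvPolynomial.aeval fun v => MvPolynomial.X v - MvPolynomial.C (a v))
    (by ext v; simp)
    (by ext v; simp)

/-- The height of a rational point of affine space. -/
lemma height_ker_aeval [IsAlgClosed k] [Fintype σ] (a : σ → k) :
    (RingHom.ker (MvPolynomial.aeval a : MvPolynomial σ k →ₐ[k] k)).height = Fintype.card σ := by
  have hdim : ringKrullDim (MvPolynomial σ k) = Fintype.card σ := by
    rw [MvPolynomial.ringKrullDim_of_isNoetherianRing, ringKrullDim_eq_zero_of_field, zero_add]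
    simp
  have : FiniteRingKrullDim (MvPolynomial σ k) := by
    refine Order.finiteDimensionalOrder_iff_krullDim_ne_bot_and_top.2 ⟨?_, ?_⟩
    · change ringKrullDim _ ≠ ⊥
      rw [hdim]; exact WithBot.coe_ne_bot
    · change ringKrullDim _ ≠ ⊤
      rw [hdim]; exact (WithBot.coe_lt_coe.2 (ENat.natCast_lt_top _)).ne
  -- Some maximal ideal has height equal to the dimension; by the Nullstellensatz it is a rational
  -- point, and translations carry it to any other.
  obtain ⟨P, hP, hPh⟩ := Ideal.exists_isMaximal_height (R := MvPolynomial σ k)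
  obtain ⟨x, rfl⟩ := MvPolynomial.isMaximal_iff_eq_vanishingIdeal_singleton.1 hP
  rw [hdim] at hPh
  have h1 : RingHom.ker (MvPolynomial.aeval a : MvPolynomial σ k →ₐ[k] k) =
      (MvPolynomial.vanishingIdeal k {x}).comap
        ((translate (fun v => a v - x v) : MvPolynomial σ k ≃ₐ[k] MvPolynomial σ k) : _ ≃+* _) := by
    ext f
    rw [RingHom.mem_ker, Ideal.mem_comap, MvPolynomial.mem_vanishingIdeal_singleton_iff]
    have h2 : (MvPolynomial.aeval x : MvPolynomial σ k →ₐ[k] k).comp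
        (translate fun v => a v - x v : MvPolynomial σ k ≃ₐ[k] _).toAlgHom =
        MvPolynomial.aeval a := by
      ext v
      simp [translate]
    exact (congrArg (· = 0) (DFunLike.congr_fun h2 f)).symm.to_iff
  rw [h1, RingEquiv.height_comap]
  exact_mod_cast hPh

end Scale

end AlphaP
end

noncomputable section

namespace AlphaP

set_option linter.unusedSectionVars false

/-! ### The affine charts of the weighted blow-up -/

section Chart

universe u

variable (k : Type u) [Field k] {l : ℕ} {d : Fin l → ℕ} (c : PosIdx d)

/-- The homogeneous coordinate `U_v` on the chart where `U_c = 1`. -/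
def homogVar (v : Idx d) : Coord k d := if v = c.1 then 1 else MvPolynomial.X v

/-- The homogeneous coordinate with the next index, or zero. -/
def nextVar (v : Idx d) : Coord k d :=
  if h : (v.2 : ℕ) + 1 < d v.1 + 1 then homogVar k c ⟨v.1, ⟨(v.2 : ℕ) + 1, h⟩⟩ else 0

/-- The equation of the exceptional divisor on the chart. -/
def chartEq : Coord k d := MvPolynomial.X c.1

/-- The blow-up in the chart. -/
def chartMap : Coord k d →ₐ[k] Coord k d :=
  MvPolynomial.aeval fun v => homogVar k c v * chartEq k c ^ (v.2 : ℕ)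

/-- The derivation generating the foliation on the chart. -/
def chartDer : Derivation k (Coord k d) (Coord k d) :=
  MvPolynomial.mkDerivation k fun v =>
    if v = c.1 then ((c.1.2 : ℕ) : k)⁻¹ • (chartEq k c * nextVar k c c.1)
    else nextVar k c v - (((v.2 : ℕ) : k) * ((c.1.2 : ℕ) : k)⁻¹) •
      (MvPolynomial.X v * nextVar k c c.1)

lemma chartDer_chartEq :
    chartDer k c (chartEq k c) = ((c.1.2 : ℕ) : k)⁻¹ • (chartEq k c * nextVar k c c.1) := by
  rw [chartDer, chartEq, MvPolynomial.mkDerivation_X, if_pos rfl]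

lemma chartDer_X_of_ne {v : Idx d} (hv : v ≠ c.1) :
    chartDer k c (MvPolynomial.X v) = nextVar k c v - (((v.2 : ℕ) : k) * ((c.1.2 : ℕ) : k)⁻¹) •
      (MvPolynomial.X v * nextVar k c c.1) := by
  rw [chartDer, MvPolynomial.mkDerivation_X, if_neg hv]

variable {k c}

/-- For v = c the coordinate is 1 and the correction term cancels the next coordinate, so one
formula covers all indices. -/
lemma chartDer_homogVar (hi : ((c.1.2 : ℕ) : k) ≠ 0) (v : Idx d) :
    chartDer k c (homogVar k c v) = nextVar k c v - (((v.2 : ℕ) : k) * ((c.1.2 : ℕ) : k)⁻¹) •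
      (homogVar k c v * nextVar k c c.1) := by
  unfold homogVar
  split_ifs with h
  · rw [h, Derivation.map_one_eq_zero, mul_inv_cancel₀ hi, one_smul, one_mul, sub_self]
  · exact chartDer_X_of_ne k c h

lemma chartDer_chartEq_pow (j : ℕ) : chartDer k c (chartEq k c ^ j) =
    ((j : k) * ((c.1.2 : ℕ) : k)⁻¹) • (chartEq k c ^ j * nextVar k c c.1) := by
  rw [Derivation.leibniz_pow, chartDer_chartEq]
  cases j with
  | zero => simp
  | succ j =>
    rw [Nat.add_sub_cancel, mul_smul, Nat.cast_smul_eq_nsmul, smul_eq_mul, mul_smul_comm, pow_succ, mul_assoc]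

/-- In the derivative of U_v E^j the term coming from E^j cancels the correction in D U_v. Thus D =
E⁻¹ ∂ is regular: dividing by the exceptional equation gives the pulled back foliation. -/
lemma chartDer_chartMap (hi : ((c.1.2 : ℕ) : k) ≠ 0) (f : Coord k d) :
    chartEq k c * chartDer k c (chartMap k c f) = chartMap k c (del k d f) := by
  induction f using MvPolynomial.induction_on with
  | C a =>
    rw [MvPolynomial.algHom_C, MvPolynomial.derivation_C, Derivation.map_algebraMap, map_zero,
      mul_zero]
  | add f g hf hg => rw [map_add, map_add, map_add, map_add, mul_add, hf, hg]
  | mul_X f v hf =>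
    have hX : chartMap k c (MvPolynomial.X v) = homogVar k c v * chartEq k c ^ (v.2 : ℕ) := by
      rw [chartMap, MvPolynomial.aeval_X]
    have h1 : chartEq k c * chartDer k c (chartMap k c (MvPolynomial.X v)) =
        chartMap k c (del k d (MvPolynomial.X v)) := by
      rw [hX, Derivation.leibniz, chartDer_chartEq_pow, chartDer_homogVar hi, del,
        MvPolynomial.mkDerivation_X]
      have h2 : chartMap k c (if h : (v.2 : ℕ) + 1 < d v.1 + 1 then
          MvPolynomial.X ⟨v.1, ⟨(v.2 : ℕ) + 1, h⟩⟩ else 0) =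
            nextVar k c v * chartEq k c ^ ((v.2 : ℕ) + 1) := by
        unfold nextVar
        split_ifs with h
        · rw [chartMap, MvPolynomial.aeval_X]
        · rw [map_zero, zero_mul]
      rw [h2]
      simp only [smul_eq_mul, Algebra.smul_def]
      ring
    rw [map_mul, Derivation.leibniz, Derivation.leibniz, map_add, smul_eq_mul, smul_eq_mul,
      smul_eq_mul, smul_eq_mul, map_mul, map_mul, ← h1, ← hf]
    ring

/-! #### The cyclic group acting on the chart -/

/-- The weights of the coordinates of the chart. -/
def chartWeight (c : PosIdx d) (v : Idx d) : ℤ := if v = c.1 then 1 else -((v.2 : ℕ) : ℤ)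

/-- The automorphism of the chart given by a root of unity. -/
def chartRot (c : PosIdx d) (ζ : kˣ) : Coord k d ≃ₐ[k] Coord k d :=
  scaleVars fun v => ζ ^ chartWeight c v

variable {ζ : kˣ} (hζ : ζ ^ (c.1.2 : ℕ) = 1)

lemma chartRot_chartEq : chartRot c ζ (chartEq k c) = (ζ : k) • chartEq k c := by
  rw [chartRot, chartEq, scaleVars_X, chartWeight, if_pos rfl, zpow_one]

include hζ

lemma chartRot_homogVar (v : Idx d) :
    chartRot c ζ (homogVar k c v) = ((ζ ^ (-((v.2 : ℕ) : ℤ)) : kˣ) : k) • homogVar k c v := by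
  unfold homogVar
  split_ifs with h
  · rw [h, map_one, zpow_neg, zpow_natCast, hζ, inv_one, Units.val_one, one_smul]
  · rw [chartRot, scaleVars_X, chartWeight, if_neg h]

lemma chartRot_nextVar (v : Idx d) : chartRot c ζ (nextVar k c v) =
    ((ζ ^ (-((v.2 : ℕ) : ℤ) - 1) : kˣ) : k) • nextVar k c v := by
  unfold nextVar
  split_ifs with h
  · rw [chartRot_homogVar hζ]
    congr 3
    push_cast
    ring
  · rw [map_zero, smul_zero]

lemma chartRot_chartMap (f : Coord k d) : chartRot c ζ (chartMap k c f) = chartMap k c f := by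
  have h : (chartRot c ζ : Coord k d →ₐ[k] Coord k d).comp (chartMap k c) = chartMap k c := by
    ext1 v
    rw [AlgHom.comp_apply, chartMap, MvPolynomial.aeval_X]
    change chartRot c ζ _ = _
    rw [map_mul, map_pow, chartRot_homogVar hζ, chartRot_chartEq, smul_pow, smul_mul_smul_comm,
      ← Units.val_pow_eq_pow_val, ← Units.val_mul, ← zpow_natCast, ← zpow_add, neg_add_cancel,
      zpow_zero, Units.val_one, one_smul]
  exact DFunLike.congr_fun h f

/-- The derivation ∂ comes from below and commutes with the group, while E has weight 1; so E⁻¹ ∂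
commutes up to ζ. The identity is checked on coordinates. -/
lemma chartDer_chartRot (f : Coord k d) :
    chartDer k c (chartRot c ζ f) = (ζ : k) • chartRot c ζ (chartDer k c f) := by
  induction f using MvPolynomial.induction_on with
  | C a =>
    have h : chartRot c ζ (MvPolynomial.C a : Coord k d) = MvPolynomial.C a :=
      (chartRot c ζ).commutes a
    rw [h, MvPolynomial.derivation_C, map_zero, smul_zero]
  | add f g hf hg => rw [map_add, map_add, map_add, map_add, smul_add, hf, hg]
  | mul_X f v hf =>
    have hc : ((ζ ^ (-((c.1.2 : ℕ) : ℤ) - 1) : kˣ) : k) = ((ζ⁻¹ : kˣ) : k) := by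
      rw [zpow_sub, zpow_neg, zpow_natCast, hζ, zpow_one, inv_one, one_mul]
    have hX : chartDer k c (chartRot c ζ (MvPolynomial.X v)) =
        (ζ : k) • chartRot c ζ (chartDer k c (MvPolynomial.X v)) := by
      rw [chartRot, scaleVars_X, Derivation.map_smul]
      change _ = (ζ : k) • chartRot c ζ _
      by_cases hv : v = c.1
      · rw [hv]
        change _ • chartDer k c (chartEq k c) = _ • chartRot c ζ (chartDer k c (chartEq k c))
        rw [chartDer_chartEq, map_smul, map_mul, chartRot_chartEq, chartRot_nextVar hζ, hc,
          chartWeight, if_pos rfl, zpow_one, smul_mul_smul_comm, Units.mul_inv, one_smul]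
      · rw [chartDer_X_of_ne k c hv, map_sub, map_smul, map_mul, chartRot_nextVar hζ,
          chartRot_nextVar hζ, hc, chartRot, scaleVars_X, chartWeight, if_neg hv, zpow_sub, zpow_one,
          smul_mul_smul_comm, ← Units.val_mul, smul_comm _ ((ζ ^ _ * ζ⁻¹ : kˣ) : k), ← smul_sub,
          smul_smul, ← Units.val_mul, mul_comm ζ, inv_mul_cancel_right]
    rw [map_mul, Derivation.leibniz, hX, hf, Derivation.leibniz, map_add, smul_add, smul_eq_mul,
      smul_eq_mul, smul_eq_mul, smul_eq_mul, map_mul, map_mul, mul_smul_comm, mul_smul_comm]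

end Chart

end AlphaP
end

/-! ### The foliation on the function field of a chart. -/

noncomputable section

namespace AlphaP

set_option linter.unusedSectionVars false

section Chart

universe u

variable {p : ℕ} [hp : Fact p.Prime] {k : Type u} [Field k] [CharP k p] {l : ℕ} {d : Fin l → ℕ}
  (hd : ∀ σ, d σ ≤ p - 1)

variable (F : Type*) [Field F] [Algebra k F] [Algebra (Coord k d) F] [IsScalarTower k (Coord k d) F]
  [IsFractionRing (Coord k d) F] [CharP F p]
  (c : PosIdx d)

include hd in
lemma idx_lt (v : Idx d) : (v.2 : ℕ) < p := by
  have h1 := v.2.2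
  have h2 := hd v.1
  have h3 := hp.out.pos
  omega

include hd in
lemma idx_ne_zero : ((c.1.2 : ℕ) : k) ≠ 0 := by
  rw [Ne, CharP.cast_eq_zero_iff k p]
  intro h
  exact absurd (Nat.le_of_dvd (by have := c.2; omega) h) (not_le.2 (idx_lt hd c.1))

variable (k) in
/-- The derivation generating the foliation on the chart, on the function field. -/
def fieldDer : Derivation k F F :=
  (exists_derivation_extension (F := F) (chartDer k c)).choose

lemma fieldDer_algebraMap (f : Coord k d) :
    fieldDer k F c (algebraMap _ F f) = algebraMap _ _ (chartDer k c f) :=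
  (exists_derivation_extension (F := F) (chartDer k c)).choose_spec f

variable (k) in
/-- The derivation `del` on the function field. -/
def fieldDel : Derivation k F F :=
  algebraMap (Coord k d) F (chartEq k c) • fieldDer k F c

lemma fieldDel_apply (x : F) :
    fieldDel k F c x = algebraMap (Coord k d) F (chartEq k c) * fieldDer k F c x := rfl

variable (k) in
/-- The pullback of functions to the chart. -/
def chartField : Coord k d →ₐ[k] F :=
  (Algebra.ofId (Coord k d) F).restrictScalars k |>.comp (chartMap k c)

lemma chartField_apply (f : Coord k d) :
    chartField k F c f = algebraMap _ F (chartMap k c f) := rfl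

lemma chartEq_ne_zero : algebraMap (Coord k d) F (chartEq k c) ≠ 0 := by
  rw [Ne, IsFractionRing.to_map_eq_zero_iff]
  exact MvPolynomial.X_ne_zero _

include hd

lemma fieldDel_chartField (f : Coord k d) :
    fieldDel k F c (chartField k F c f) = chartField k F c (del k d f) := by
  rw [fieldDel_apply, chartField_apply, fieldDer_algebraMap, ← map_mul,
    chartDer_chartMap (idx_ne_zero hd c), chartField_apply]

lemma del_iterate_X (n : ℕ) (v : Idx d) : (del k d)^[n] (MvPolynomial.X v) =
    if h : (v.2 : ℕ) + n < d v.1 + 1 then MvPolynomial.X ⟨v.1, ⟨(v.2 : ℕ) + n, h⟩⟩ else 0 := by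
  induction n with
  | zero => rw [dif_pos (show (v.2 : ℕ) + 0 < d v.1 + 1 from v.2.2)]; rfl
  | succ n ih =>
    rw [Function.iterate_succ_apply', ih]
    split_ifs with h1 h2 h2
    · rw [del, MvPolynomial.mkDerivation_X, dif_pos (show ((v.2 : ℕ) + n) + 1 < _ from h2)]
      rfl
    · rw [del, MvPolynomial.mkDerivation_X, dif_neg (show ¬ ((v.2 : ℕ) + n) + 1 < _ from h2)]
    · omega
    · rw [map_zero]

/-- The function E satisfies E^i = x_c with i invertible, so a derivation killing the x_v kills E,
and then every U_v. -/
lemma derivation_ext_field {δ : Derivation k F F}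
    (h : ∀ v, δ (chartField k F c (MvPolynomial.X v)) = 0) (x : F) : δ x = 0 := by
  have hX : ∀ v, chartField k F c (MvPolynomial.X v) = algebraMap _ F (homogVar k c v) *
      algebraMap _ F (chartEq k c) ^ (v.2 : ℕ) := by
    intro v
    rw [chartField_apply, chartMap, MvPolynomial.aeval_X, map_mul, map_pow]
  have h0 := chartEq_ne_zero (k := k) F c
  have hi : ((c.1.2 : ℕ) : F) ≠ 0 := by
    rw [← map_natCast (algebraMap k F)]
    exact (map_ne_zero _).2 (idx_ne_zero hd c)
  have hE : δ (algebraMap _ F (chartEq k c)) = 0 := by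
    have h1 := h c.1
    rw [hX, homogVar, if_pos rfl, map_one, one_mul, Derivation.leibniz_pow,
      ← Nat.cast_smul_eq_nsmul F, smul_eq_mul, smul_eq_mul] at h1
    exact (mul_eq_zero.1 ((mul_eq_zero.1 h1).resolve_left hi)).resolve_left (pow_ne_zero _ h0)
  have hA : ∀ f : Coord k d, δ (algebraMap _ F f) = 0 := by
    intro f
    induction f using MvPolynomial.induction_on with
    | C a =>
      rw [← MvPolynomial.algebraMap_eq, ← IsScalarTower.algebraMap_apply k (Coord k d),
        Derivation.map_algebraMap]
    | add f g hf hg => rw [map_add, map_add, hf, hg, add_zero]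
    | mul_X f v hf =>
      rw [map_mul, Derivation.leibniz, hf, smul_zero, add_zero]
      by_cases hv : v = c.1
      · rw [hv]
        change _ • δ (algebraMap _ F (chartEq k c)) = 0
        rw [hE, smul_zero]
      · have h1 := h v
        rw [hX, homogVar, if_neg hv, Derivation.leibniz, Derivation.leibniz_pow, hE, smul_zero,
          smul_zero, smul_zero, zero_add, smul_eq_mul] at h1
        rw [(mul_eq_zero.1 h1).resolve_left (pow_ne_zero _ h0), smul_zero]
  obtain ⟨a, b, -, rfl⟩ := IsFractionRing.div_surjective (A := Coord k d) x
  rw [div_eq_mul_inv, Derivation.leibniz, Derivation.leibniz_inv, hA, hA, smul_zero, smul_zero,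
    smul_zero, add_zero]

/-- The p-th iterate of ∂ is a derivation, so it suffices to look at the x_v. There p steps raise
the index beyond d σ ≤ p - 1. -/
lemma fieldDel_iterate (x : F) : (fieldDel k F c)^[p] x = 0 := by
  have h := derivation_ext_field hd F c (δ := iterateDerivation (p := p) (fieldDel k F c)) ?_ x
  · rwa [iterateDerivation_apply] at h
  · intro v
    rw [iterateDerivation_apply]
    have h1 : ∀ n f, (fieldDel k F c)^[n] (chartField k F c f) = chartField k F c ((del k d)^[n] f) := by
      intro n f
      induction n with
      | zero => rfl
      | succ n ih =>
        rw [Function.iterate_succ_apply', ih, fieldDel_chartField hd F, Function.iterate_succ_apply']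
    rw [h1, del_iterate_X hd, dif_neg, map_zero]
    have h2 := hd v.1
    have h3 := hp.out.pos
    omega

/-- The last variable of the block of c is a constant with the preceding one mapping to it, so their
quotient is a slice. The block has at least two variables because c has positive index. -/
lemma exists_slice : ∃ s, fieldDel k F c s = 1 := by
  have hc := c.1.2.2
  have hc' := c.2
  set v : Idx d := ⟨c.1.1, ⟨d c.1.1, by omega⟩⟩ with hv
  set v' : Idx d := ⟨c.1.1, ⟨d c.1.1 - 1, by omega⟩⟩ with hv'
  have h1 : del k d (MvPolynomial.X v) = 0 := by
    have := del_iterate_X (k := k) hd 1 v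
    rw [dif_neg (show ¬ d c.1.1 + 1 < d c.1.1 + 1 by omega)] at this
    exact this
  have h2 : del k d (MvPolynomial.X v') = MvPolynomial.X v := by
    have := del_iterate_X (k := k) hd 1 v'
    rw [dif_pos (show d c.1.1 - 1 + 1 < d c.1.1 + 1 by omega)] at this
    refine Eq.trans this ?_
    congr 1
    refine Sigma.ext rfl (heq_of_eq (Fin.ext ?_))
    change d c.1.1 - 1 + 1 = d c.1.1
    omega
  have h0 : chartField k F c (MvPolynomial.X v) ≠ 0 := by
    rw [chartField_apply, chartMap, MvPolynomial.aeval_X, map_mul, map_pow]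
    refine mul_ne_zero ?_ (pow_ne_zero _ (chartEq_ne_zero F c))
    rw [Ne, IsFractionRing.to_map_eq_zero_iff, homogVar]
    split_ifs
    · exact one_ne_zero
    · exact MvPolynomial.X_ne_zero _
  refine ⟨chartField k F c (MvPolynomial.X v') * (chartField k F c (MvPolynomial.X v))⁻¹, ?_⟩
  rw [Derivation.leibniz, Derivation.leibniz_inv, fieldDel_chartField hd F, fieldDel_chartField hd F,
    h1, h2, map_zero, smul_zero, smul_zero, zero_add, smul_eq_mul, inv_mul_cancel₀ h0]

/-- At a point of the exceptional divisor, the derivation of some coordinate does not vanish. -/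
lemma exists_chartDer_ne_zero (a : Idx d → k) : ∃ v : Idx d, v ≠ c.1 ∧
    MvPolynomial.aeval a (chartDer k c (MvPolynomial.X v)) ≠ 0 := by
  by_contra! hcon
  have hi := idx_ne_zero (k := k) hd c
  -- If D killed all other coordinates at a, the vanishing would climb along the block of c: for
  -- index 0 the correction term has coefficient 0, and afterwards it contains a factor already
  -- known to vanish. The climb ends at U_c = 1.
  have key : ∀ (n : ℕ) (hn : n < d c.1.1 + 1), 1 ≤ n → n ≤ (c.1.2 : ℕ) →
      MvPolynomial.aeval a (homogVar k c ⟨c.1.1, ⟨n, hn⟩⟩) = 0 := by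
    intro n
    induction n with
    | zero => intro _ h; omega
    | succ n ih =>
      intro hn _ hnc
      set v : Idx d := ⟨c.1.1, ⟨n, by omega⟩⟩ with hv
      have hvc : v ≠ c.1 := by
        intro h
        have : n = (c.1.2 : ℕ) := congrArg (fun w : Idx d => (w.2 : ℕ)) h
        omega
      have h1 := hcon v hvc
      rw [chartDer_X_of_ne k c hvc, map_sub, map_smul, map_mul] at h1
      have h2 : nextVar k c v = homogVar k c ⟨c.1.1, ⟨n + 1, hn⟩⟩ := by
        rw [nextVar, dif_pos (show (v.2 : ℕ) + 1 < d v.1 + 1 from hn)]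
      rw [← h2]
      rcases Nat.eq_zero_or_pos n with rfl | hpos
      · rw [show ((v.2 : ℕ) : k) = 0 from Nat.cast_zero, zero_mul, zero_smul, sub_zero] at h1
        exact h1
      · have h3 := ih (by omega) hpos (by omega)
        rw [homogVar, if_neg hvc] at h3
        rw [h3, zero_mul, smul_zero, sub_zero] at h1
        exact h1
  have h1 := key (c.1.2 : ℕ) c.1.2.2 c.2 le_rfl
  rw [homogVar, if_pos rfl, map_one] at h1
  exact one_ne_zero h1

end Chart

end AlphaP
end

/-! ### The foliated chart at a point of the exceptional divisor. -/

noncomputable section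

namespace AlphaP

set_option linter.unusedSectionVars false

section Chart

universe u

variable {p : ℕ} [hp : Fact p.Prime] {k : Type u} [Field k] [CharP k p] {l : ℕ} {d : Fin l → ℕ}
  (hd : ∀ σ, d σ ≤ p - 1)
variable (F : Type*) [Field F] [Algebra k F] [Algebra (Coord k d) F] [IsScalarTower k (Coord k d) F]
  [IsFractionRing (Coord k d) F] [CharP F p]
  (c : PosIdx d)

/-- The automorphism `chartRot` on the function field. -/
def fieldRot (ζ : kˣ) : F ≃ₐ[k] F :=
  IsFractionRing.algEquivOfAlgEquiv (chartRot c ζ)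

variable {F c} in
lemma fieldRot_algebraMap (ζ : kˣ) (f : Coord k d) :
    fieldRot F c ζ (algebraMap _ F f) = algebraMap _ F (chartRot c ζ f) :=
  IsFractionRing.algEquivOfAlgEquiv_algebraMap _ _

variable {ζ : kˣ}

lemma algebraMap_smul_eq (e : k) (f : Coord k d) :
    algebraMap (Coord k d) F (e • f) = e • algebraMap (Coord k d) F f := by
  rw [Algebra.smul_def, map_mul, ← IsScalarTower.algebraMap_apply, Algebra.smul_def]

lemma fieldDer_fieldRot (hζ : ζ ^ (c.1.2 : ℕ) = 1) (x : F) :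
    fieldDer k F c (fieldRot F c ζ x) = (ζ : k) • fieldRot F c ζ (fieldDer k F c x) := by
  have hA : ∀ f : Coord k d, fieldDer k F c (fieldRot F c ζ (algebraMap (Coord k d) F f)) =
      (ζ : k) • fieldRot F c ζ (fieldDer k F c (algebraMap (Coord k d) F f)) := by
    intro f
    rw [fieldRot_algebraMap, fieldDer_algebraMap, fieldDer_algebraMap, fieldRot_algebraMap,
      chartDer_chartRot hζ, algebraMap_smul_eq]
  obtain ⟨a, b, -, rfl⟩ := IsFractionRing.div_surjective (A := Coord k d) x
  rw [div_eq_mul_inv, map_mul, map_inv₀, Derivation.leibniz, Derivation.leibniz_inv, hA, hA,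
    Derivation.leibniz, Derivation.leibniz_inv, map_add]
  simp only [smul_eq_mul, map_mul, map_neg, map_pow, map_inv₀, Algebra.smul_def]
  ring

/-- The chart of the weighted blow-up at a point `a` of the exceptional divisor, with a coordinate
`v₀` whose derivative does not vanish at `a`. -/
def foliatedChart (hζ : ζ ^ (c.1.2 : ℕ) = 1) (a : Idx d → k) (ha : a c.1 = 0) (v₀ : Idx d)
    (h₀ : MvPolynomial.aeval a (chartDer k c (MvPolynomial.X v₀)) ≠ 0) :
    FoliatedChart p k (Coord k d) F where
  ev := MvPolynomial.aeval a
  rot := chartRot c ζ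
  rotF := fieldRot F c ζ
  rotF_algebraMap := fieldRot_algebraMap ζ
  order := c.1.2
  order_ne_zero := idx_ne_zero hd c
  rot_iterate_order := scaleVars_iterate_eq _ fun v => by
    rw [← zpow_natCast, ← zpow_mul, mul_comm, zpow_mul, zpow_natCast, hζ, one_zpow]
  Δ := (algebraMap _ F (chartDer k c (MvPolynomial.X v₀)))⁻¹ • fieldDer k F c
  Δ_iterate := by
    have h1 := algebraMap_ne_zero_of_ev F (MvPolynomial.aeval a) h₀
    have h2 := chartEq_ne_zero (k := k) F c
    -- Written as a multiple of ∂, which is p-nilpotent and has a slice, the derivation satisfies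
    -- the hypotheses of `iterate_smul_eq_zero`.
    have h3 : (algebraMap _ F (chartDer k c (MvPolynomial.X v₀)))⁻¹ • fieldDer k F c =
        (algebraMap (Coord k d) F (chartEq k c) * algebraMap (Coord k d) F (chartDer k c (MvPolynomial.X v₀)))⁻¹ •
          fieldDel k F c := by
      ext x
      rw [Derivation.smul_apply, Derivation.smul_apply, fieldDel_apply, smul_eq_mul, smul_eq_mul,
        mul_inv_rev, mul_assoc, inv_mul_cancel_left₀ h2]
    obtain ⟨s, hs⟩ := exists_slice (k := k) hd F c
    rw [h3]
    refine fun f => iterate_smul_eq_zero (fieldDel k F c) (fieldDel_iterate hd F c) hs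
      (y := algebraMap (Coord k d) F (MvPolynomial.X v₀)) ?_ f
    rw [fieldDel_apply, fieldDer_algebraMap, inv_mul_cancel₀ (mul_ne_zero h2 h1)]
  slice := MvPolynomial.X v₀
  Δ_slice := by
    rw [Derivation.smul_apply, fieldDer_algebraMap, smul_eq_mul,
      inv_mul_cancel₀ (algebraMap_ne_zero_of_ev F (MvPolynomial.aeval a) h₀)]
  slope := ((ζ ^ chartWeight c v₀ : kˣ) : k)
  slope_ne_zero := Units.ne_zero _
  rot_slice := scaleVars_X _ _
  Δ_rotF x := by
    have h1 := algebraMap_ne_zero_of_ev F (MvPolynomial.aeval a) h₀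
    have h3 : chartRot c ζ (MvPolynomial.X v₀) =
        ((ζ ^ chartWeight c v₀ : kˣ) : k) • MvPolynomial.X v₀ := scaleVars_X _ _
    have h2 := fieldDer_fieldRot F c hζ (algebraMap (Coord k d) F (MvPolynomial.X v₀))
    rw [fieldRot_algebraMap, h3, algebraMap_smul_eq, Derivation.map_smul, fieldDer_algebraMap] at h2
    have h4 : fieldRot F c ζ (algebraMap (Coord k d) F (chartDer k c (MvPolynomial.X v₀))) ≠ 0 :=
      (map_ne_zero _).2 h1
    rw [Derivation.smul_apply, Derivation.smul_apply, fieldDer_fieldRot F c hζ, smul_eq_mul,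
      smul_eq_mul, map_mul, map_inv₀]
    generalize algebraMap (Coord k d) F (chartDer k c (MvPolynomial.X v₀)) = D at h1 h2 h4 ⊢
    rw [Algebra.smul_def, Algebra.smul_def] at h2 ⊢
    field_simp
    linear_combination (-fieldRot F c ζ (fieldDer k F c x)) * h2
  Δ_mem f := by
    rw [Derivation.smul_apply, fieldDer_algebraMap, smul_eq_mul]
    exact mul_mem (inv_mem_locRing F _ h₀) (algebraMap_mem_locRing F _ _)
  div := chartEq k c
  div_prime := MvPolynomial.X_prime
  ev_div := by rw [chartEq, MvPolynomial.aeval_X, ha]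
  divWeight := ζ
  rot_div := chartRot_chartEq
  Δ_div := by
    refine ⟨(algebraMap _ F (chartDer k c (MvPolynomial.X v₀)))⁻¹ *
      algebraMap _ F (((c.1.2 : ℕ) : k)⁻¹ • nextVar k c c.1), mul_mem (inv_mem_locRing F _ h₀)
        (algebraMap_mem_locRing F _ _), ?_⟩
    rw [Derivation.smul_apply, fieldDer_algebraMap, smul_eq_mul, chartDer_chartEq, ← mul_smul_comm,
      map_mul]
    ring

end Chart

end AlphaP
end

/-! ### Generators for the constants vanishing at the point. -/

noncomputable section

namespace AlphaP

set_option linter.unusedSectionVars false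

namespace FoliatedChart

variable {p : ℕ} {k A F : Type*} [Field k] [CommRing A] [IsDomain A] [Algebra k A]
    [Field F] [Algebra k F] [Algebra A F] [IsScalarTower k A F] [IsFractionRing A F]

lemma Δ_iterate_rotF_iterate (S : FoliatedChart p k A F) (n j : ℕ) (x : F) :
    S.Δ^[j] (S.rotF^[n] x) = (S.slope ^ n) ^ j • S.rotF^[n] (S.Δ^[j] x) := by
  induction j with
  | zero => simp
  | succ j ih =>
    rw [Function.iterate_succ_apply', ih, Derivation.map_smul, S.Δ_rotF_iterate, smul_smul,
      ← pow_succ, Function.iterate_succ_apply']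

/-- The powers of y and the iterates of Δ pick up the same power of the slope, so the Taylor
projection is equivariant. -/
lemma rotF_iterate_constProj (S : FoliatedChart p k A F) {n : ℕ} {y : A}
    (hy : S.rotF^[n] (algebraMap A F y) = S.slope ^ n • algebraMap A F y) (x : F) :
    S.rotF^[n] (constProj p S.Δ (algebraMap A F y) x) =
      constProj p S.Δ (algebraMap A F y) (S.rotF^[n] x) := by
  simp only [constProj]
  rw [← AlgEquiv.coe_pow, map_sum]
  refine Finset.sum_congr rfl fun j _ => ?_
  rw [map_mul, map_mul, map_pow, map_neg, map_inv₀, map_natCast, AlgEquiv.coe_pow, hy,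
    Δ_iterate_rotF_iterate, ← smul_neg, smul_pow, smul_mul_assoc, smul_mul_assoc, mul_smul_comm]

lemma inv_factorial_mem_locRing (S : FoliatedChart p k A F) (n : ℕ) :
    (n.factorial : F)⁻¹ ∈ locRing F S.ev := by
  rw [← map_natCast (algebraMap k F), ← map_inv₀]
  exact scalar_mem_locRing F _ _

variable [hp : Fact p.Prime]

lemma exists_constProj_eq (S : FoliatedChart p k A F) (y : A) {x : F} (hx : x ∈ locRing F S.ev) :
    ∃ e ∈ locRing F S.ev, constProj p S.Δ (algebraMap A F y) x = x + algebraMap A F y * e := by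
  refine ⟨∑ n ∈ Finset.range (p - 1), -((-algebraMap A F y) ^ n * ((n + 1).factorial : F)⁻¹ *
    S.Δ^[n + 1] x), sum_mem fun n _ => neg_mem (mul_mem (mul_mem
      (pow_mem (neg_mem (algebraMap_mem_locRing F _ y)) _) (S.inv_factorial_mem_locRing _))
        (S.Δ_iterate_mem (fun _ => S.Δ_mem_locRing) _ hx)), ?_⟩
  have hr : Finset.range p = Finset.range (p - 1 + 1) := by rw [Nat.sub_add_cancel hp.out.one_le]
  rw [constProj, hr, Finset.sum_range_succ', add_comm, Finset.mul_sum]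
  congr 1
  · simp
  · refine Finset.sum_congr rfl fun n _ => ?_
    rw [pow_succ]; ring

lemma exists_Δ_iterate_div (S : FoliatedChart p k A F) (n : ℕ) :
    ∃ e ∈ locRing F S.ev, S.Δ^[n] (algebraMap A F S.div) = algebraMap A F S.div * e := by
  induction n with
  | zero => exact ⟨1, one_mem _, by simp⟩
  | succ n ih =>
    obtain ⟨e, he, h⟩ := ih
    obtain ⟨e', he', h'⟩ := S.Δ_div
    refine ⟨S.Δ e + e' * e, add_mem (S.Δ_mem_locRing he) (mul_mem he' he), ?_⟩
    rw [Function.iterate_succ_apply', h, Derivation.leibniz, h', smul_eq_mul, smul_eq_mul]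
    ring

/-- All iterated derivatives of the equation are multiples of it, and all terms beyond the first
contain y. At a zero of y the projection is thus the equation times a unit. -/
lemma exists_constProj_div (S : FoliatedChart p k A F) (y : A) :
    ∃ e ∈ locRing F S.ev, constProj p S.Δ (algebraMap A F y) (algebraMap A F S.div) =
      algebraMap A F S.div * (1 + algebraMap A F y * e) := by
  choose e he h using S.exists_Δ_iterate_div
  refine ⟨∑ n ∈ Finset.range (p - 1), -((-algebraMap A F y) ^ n * ((n + 1).factorial : F)⁻¹ *
    e (n + 1)), sum_mem fun n _ => neg_mem (mul_mem (mul_mem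
      (pow_mem (neg_mem (algebraMap_mem_locRing F _ y)) _) (S.inv_factorial_mem_locRing _))
        (he _)), ?_⟩
  have hr : Finset.range p = Finset.range (p - 1 + 1) := by rw [Nat.sub_add_cancel hp.out.one_le]
  rw [constProj, hr, Finset.sum_range_succ', add_comm, mul_add, Finset.mul_sum, Finset.mul_sum]
  congr 1
  · simp
  · refine Finset.sum_congr rfl fun n _ => ?_
    rw [pow_succ, h]; ring

lemma one_add_mul_mem (S : FoliatedChart p k A F) {y : A} (hy : S.ev y = 0) {e : F}
    (he : e ∈ locRing F S.ev) : 1 + algebraMap A F y * e ≠ 0 ∧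
      (1 + algebraMap A F y * e)⁻¹ ∈ locRing F S.ev := by
  have h1 : algebraMap A F y * e ∈ locIdeal F S.ev (RingHom.ker S.ev) := by
    rw [mul_comm]
    exact mul_mem_locIdeal_of_mem_locRing he (algebraMap_mem_locIdeal hy)
  have h2 : 1 + algebraMap A F y * e ∉ locIdeal F S.ev (RingHom.ker S.ev) := fun h =>
    one_notMem_locIdeal (F := F) (ev := S.ev) le_rfl (by simpa using sub_mem h h1)
  refine ⟨fun h => h2 (h ▸ zero_mem _), inv_mem_locRing_of_notMem ?_ h2⟩
  exact add_mem (one_mem _) (mul_mem (algebraMap_mem_locRing F _ _) he)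

variable [CharP F p]

/-- The constants in the maximal ideal are generated by the projections of the coordinates and the
`p`-th power of the slice. -/
lemma mem_span_constProj (S : FoliatedChart p k A F) {ι : Type*} {x : ι → A} (y : ι)
    (hx : RingHom.ker S.ev = Ideal.span (Set.range x)) (hy : S.Δ (algebraMap A F (x y)) = 1)
    (z : ι → S.const) (hz : ∀ v, v ≠ y →
      (z v : F) = constProj p S.Δ (algebraMap A F (x y)) (algebraMap A F (x v)))
    (hzy : (z y : F) = algebraMap A F (x y) ^ p) (t : S.const) :
    (t : F) ∈ locIdeal F S.ev (RingHom.ker S.ev) ↔ t ∈ Ideal.span (Set.range z) := by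
  have hπ : ∀ b ∈ locRing F S.ev, constProj p S.Δ (algebraMap A F (x y)) b ∈ S.const := fun b hb =>
    ⟨S.constProj_mem (fun _ => S.Δ_mem_locRing) _ hb, S.Δ_constProj hy b⟩
  have hsq : ∀ b ∈ locRing F S.ev, ∃ j ∈ Ideal.span (Set.range z),
      constProj p S.Δ (algebraMap A F (x y)) (algebraMap A F (x y) * b) = (j : F) := by
    intro b hb
    rw [constProj_mul_self S.Δ hy]
    have hc : -(-1) ^ p * ((p - 1).factorial : F)⁻¹ * S.Δ^[p - 1] b ∈ S.const := by
      refine ⟨mul_mem (mul_mem (neg_mem (pow_mem (neg_mem (one_mem _)) _))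
        (S.inv_factorial_mem_locRing _)) (S.Δ_iterate_mem (fun _ => S.Δ_mem_locRing) _ hb), ?_⟩
      have h1 : S.Δ (S.Δ^[p - 1] b) = 0 := by
        rw [← Function.iterate_succ_apply' (f := S.Δ), Nat.succ_eq_add_one,
          Nat.sub_add_cancel hp.out.one_le, S.Δ_iterate]
      have h2 : S.Δ (-(-1) ^ p * ((p - 1).factorial : F)⁻¹) = 0 := by
        have h3 : (-(-1) ^ p * ((p - 1).factorial : F)⁻¹) =
            algebraMap k F (-(-1) ^ p * ((p - 1).factorial : k)⁻¹) := by simp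
        rw [h3, Derivation.map_algebraMap]
      rw [Derivation.leibniz, h1, h2, smul_zero, smul_zero, add_zero]
    refine ⟨z y * ⟨_, hc⟩, Ideal.mul_mem_right _ _ (Ideal.subset_span ⟨y, rfl⟩), ?_⟩
    rw [MulMemClass.coe_mul, hzy]
  constructor
  · rintro ⟨g, hg, f, hf, hgt⟩
    rw [hx] at hf
    -- Each x v differs from the constant z v by a multiple of the slice. Projection is linear in z
    -- v, and on multiples of the slice it produces multiples of its p-th power.
    have hkey : ∀ b ∈ locRing F S.ev, ∃ j ∈ Ideal.span (Set.range z),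
        constProj p S.Δ (algebraMap A F (x y)) (algebraMap A F f * b) = (j : F) := by
      clear hgt
      induction hf using Submodule.span_induction with
      | mem f hf =>
        obtain ⟨v, rfl⟩ := hf
        intro b hb
        by_cases hv : v = y
        · subst hv; exact hsq b hb
        obtain ⟨e, he, h⟩ := S.exists_constProj_eq (x y) (algebraMap_mem_locRing F S.ev (x v))
        obtain ⟨j, hj, h'⟩ := hsq (-e * b) (mul_mem (neg_mem he) hb)
        refine ⟨z v * ⟨_, hπ b hb⟩ + j, add_mem (Ideal.mul_mem_right _ _
          (Ideal.subset_span ⟨v, rfl⟩)) hj, ?_⟩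
        have h2 : algebraMap A F (x v) * b = (z v : F) * b + algebraMap A F (x y) * (-e * b) := by
          rw [hz v hv, h]; ring
        rw [h2, constProj_add, constProj_const_mul _ (z v).2.2, h']
        rfl
      | zero =>
        intro b _
        exact ⟨0, zero_mem _, by rw [map_zero, zero_mul, constProj_of_const _ (map_zero _)]; rfl⟩
      | add f f' _ _ h h' =>
        intro b hb
        obtain ⟨j, hj, e⟩ := h b hb
        obtain ⟨j', hj', e'⟩ := h' b hb
        refine ⟨j + j', add_mem hj hj', ?_⟩
        rw [map_add, add_mul, constProj_add, e, e']
        rfl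
      | smul r f _ h =>
        intro b hb
        obtain ⟨j, hj, e⟩ := h (algebraMap A F r * b) (mul_mem (algebraMap_mem_locRing F _ _) hb)
        refine ⟨j, hj, ?_⟩
        rw [← e, smul_eq_mul, map_mul]
        ring_nf
    -- Taking for b the inverse denominator recovers t, which the projection fixes.
    obtain ⟨j, hj, e⟩ := hkey _ (inv_mem_locRing F S.ev hg)
    rw [← hgt, mul_comm, inv_mul_cancel_left₀ (algebraMap_ne_zero_of_ev F S.ev hg),
      constProj_of_const _ t.2.2] at e
    rwa [Subtype.ext e]
  · intro ht
    have hxm : ∀ v, algebraMap A F (x v) ∈ locIdeal F S.ev (RingHom.ker S.ev) := fun v =>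
      algebraMap_mem_locIdeal (hx ▸ Ideal.subset_span ⟨v, rfl⟩)
    induction ht using Submodule.span_induction with
    | mem t ht =>
      obtain ⟨v, rfl⟩ := ht
      by_cases hv : v = y
      · subst hv
        rw [hzy, ← pow_sub_one_mul hp.out.ne_zero]
        exact mul_mem_locIdeal_of_mem_locRing (pow_mem (algebraMap_mem_locRing F _ _) _) (hxm v)
      obtain ⟨e, he, h⟩ := S.exists_constProj_eq (x y) (algebraMap_mem_locRing F S.ev (x v))
      rw [hz v hv, h, mul_comm]
      exact add_mem (hxm v) (mul_mem_locIdeal_of_mem_locRing he (hxm y))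
    | zero => exact zero_mem _
    | add t t' _ _ h h' => exact add_mem h h'
    | smul r t _ h => exact mul_mem_locIdeal_of_mem_locRing r.2.1 h

end FoliatedChart

lemma ker_aeval_eq_span {k σ : Type*} [Field k] (a : σ → k) :
    RingHom.ker (MvPolynomial.aeval a : MvPolynomial σ k →ₐ[k] k) =
      Ideal.span (Set.range fun v => MvPolynomial.X v - MvPolynomial.C (a v)) := by
  refine le_antisymm (fun f hf => ?_) ?_
  · have h : ∀ f : MvPolynomial σ k, f - MvPolynomial.C (MvPolynomial.aeval a f) ∈
        Ideal.span (Set.range fun v => (MvPolynomial.X v - MvPolynomial.C (a v) :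
          MvPolynomial σ k)) := by
      intro f
      induction f using MvPolynomial.induction_on with
      | C e => simp
      | add f g hf hg =>
        rw [map_add, map_add, add_sub_add_comm]
        exact add_mem hf hg
      | mul_X f v hf =>
        rw [map_mul, map_mul, MvPolynomial.aeval_X]
        have h1 : f * MvPolynomial.X v - MvPolynomial.C (MvPolynomial.aeval a f) *
            MvPolynomial.C (a v) = MvPolynomial.X v * (f - MvPolynomial.C (MvPolynomial.aeval a f)) +
              MvPolynomial.C (MvPolynomial.aeval a f) *
                (MvPolynomial.X v - MvPolynomial.C (a v)) := by ring
        rw [h1]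
        exact add_mem (Ideal.mul_mem_left _ _ hf)
          (Ideal.mul_mem_left _ _ (Ideal.subset_span ⟨v, rfl⟩))
    have := h f
    rwa [(RingHom.mem_ker).1 hf, map_zero, sub_zero] at this
  · rw [Ideal.span_le]
    rintro _ ⟨v, rfl⟩
    simp [RingHom.mem_ker]

/-- The powers of the coordinates cut out a rational point, up to conjugation by roots of unity. -/
lemma eq_ker_aeval_of_pow_mem {k σ : Type*} [Field k] {a : σ → k} {i n : ℕ} (hi : (i : k) ≠ 0)
    {Q : Ideal (MvPolynomial σ k)} [Q.IsPrime]
    (hQ : Q ≤ RingHom.ker (MvPolynomial.aeval a : MvPolynomial σ k →ₐ[k] k))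
    (h : ∀ v, ((MvPolynomial.X v : MvPolynomial σ k) ^ i - MvPolynomial.C (a v ^ i)) ^ n ∈ Q) :
    Q = RingHom.ker (MvPolynomial.aeval a : MvPolynomial σ k →ₐ[k] k) := by
  refine le_antisymm hQ ?_
  rw [ker_aeval_eq_span, Ideal.span_le]
  rintro _ ⟨v, rfl⟩
  have h1 := Ideal.IsPrime.mem_of_pow_mem ‹_› _ (h v)
  have hi0 : i ≠ 0 := fun h => hi (by simp [h])
  by_cases ha : a v = 0
  · rw [ha, zero_pow hi0, map_zero, sub_zero] at h1
    rw [SetLike.mem_coe]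
    beta_reduce
    rw [ha, map_zero, sub_zero]
    exact Ideal.IsPrime.mem_of_pow_mem ‹_› _ h1
  -- In the factorization of X^i - a^i the cofactor of X - a has the value i a^(i-1) ≠ 0 at the
  -- point, so it does not lie in Q.
  · rw [map_pow, ← (Commute.all _ _).geom_sum₂_mul] at h1
    refine (Ideal.IsPrime.mem_or_mem ‹_› h1).resolve_left fun h2 => ?_
    have h3 := (RingHom.mem_ker).1 (hQ h2)
    rw [map_sum, Finset.sum_congr rfl (g := fun _ => a v ^ (i - 1))] at h3
    · rw [Finset.sum_const, Finset.card_range, nsmul_eq_mul] at h3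
      exact mul_ne_zero hi (pow_ne_zero _ ha) h3
    · intro j hj
      have := Finset.mem_range.1 hj
      rw [map_mul, map_pow, map_pow, MvPolynomial.aeval_X, MvPolynomial.algHom_C,
        Algebra.algebraMap_self_apply, ← pow_add]
      congr 1; omega

end AlphaP
end

/-! ### The stabilizer of the point and the weights of the coordinates. -/

noncomputable section

namespace AlphaP

set_option linter.unusedSectionVars false

section ChartCoords

universe u

lemma zmodChar_intCast {K : Type*} [Field K] {g : ℕ} [NeZero g] {ω : Kˣ} (hω : (ω : K) ^ g = 1)
    (n : ℤ) : AddChar.zmodChar g hω (n : ZMod g) = ((ω ^ n : Kˣ) : K) := by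
  have h1 : AddChar.zmodChar g hω 1 = (ω : K) := by
    have := AddChar.zmodChar_apply' hω 1
    rwa [Nat.cast_one, pow_one] at this
  have h2 : (n : ZMod g) = n • (1 : ZMod g) := by rw [zsmul_eq_mul, mul_one]
  rw [h2, AddChar.map_zsmul_eq_zpow, h1, Units.val_zpow_eq_zpow_val]

variable {p : ℕ} [hp : Fact p.Prime] {k : Type u} [Field k] [CharP k p] {l : ℕ} {d : Fin l → ℕ}
  {c : PosIdx d} {ζ : kˣ}

variable (c) in
/-- The index `(σ, i - 1)` preceding `c = (σ, i)`. -/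
def predIdx : Idx d := ⟨c.1.1, ⟨(c.1.2 : ℕ) - 1, by have := c.1.2.2; omega⟩⟩

lemma eq_predIdx_iff {v : Idx d} : v = predIdx c ↔ v.1 = c.1.1 ∧ (v.2 : ℕ) + 1 = (c.1.2 : ℕ) := by
  have hc := c.2
  constructor
  · rintro rfl
    exact ⟨rfl, Nat.sub_add_cancel hc⟩
  · rcases v with ⟨σ, j⟩
    rintro ⟨h1, h2⟩
    obtain rfl : σ = c.1.1 := h1
    change (j : ℕ) + 1 = _ at h2
    refine congrArg (Sigma.mk c.1.1) (Fin.ext ?_)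
    change (j : ℕ) = (c.1.2 : ℕ) - 1
    omega

variable (c) in
lemma predIdx_ne : predIdx c ≠ c.1 := by
  intro h
  have := (eq_predIdx_iff (c := c)).1 h.symm
  omega

variable (c) in
lemma chartWeight_predIdx : chartWeight c (predIdx c) = 1 - ((c.1.2 : ℕ) : ℤ) := by
  have hc := c.2
  rw [chartWeight, if_neg (predIdx_ne c)]
  change -((((c.1.2 : ℕ) - 1 : ℕ)) : ℤ) = _
  omega

variable (c) in
lemma weights_eq (v : Idx d) :
    weights p c v = if v = predIdx c then (p : ℤ) else chartWeight c v := by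
  unfold weights chartWeight
  simp only [eq_predIdx_iff]

/-- The index (σ, i - 1) has weight 1 - i, which acts through ω as weight 1, and so does v₀ by
hypothesis. Exchanging the two moves the p-th power to (σ, i - 1) without altering the other
weights. -/
lemma weights_swap {ω : kˣ} (hω : ω ^ (c.1.2 : ℕ) = 1) {v₀ : Idx d}
    (h : ω ^ chartWeight c v₀ = ω) (v : Idx d) :
    ω ^ weights p c v = if Equiv.swap (predIdx c) v₀ v = v₀ then (ω ^ chartWeight c v₀) ^ p
      else ω ^ chartWeight c (Equiv.swap (predIdx c) v₀ v) := by
  rw [weights_eq]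
  by_cases h1 : v = predIdx c
  · rw [if_pos h1, h1, Equiv.swap_apply_left, if_pos rfl, h, zpow_natCast]
  rw [if_neg h1]
  by_cases h2 : v = v₀
  · rw [h2, Equiv.swap_apply_right, if_neg (fun h' => h1 (h2.trans h'.symm)), h,
      chartWeight_predIdx, zpow_sub, zpow_one, zpow_natCast, hω, inv_one, mul_one]
  · rw [Equiv.swap_apply_of_ne_of_ne h1 h2, if_neg h2]

section Stabilizer

variable (hζ : IsPrimitiveRoot ζ (c.1.2 : ℕ)) {a : Idx d → k} (ha : a c.1 = 0)
  {S : Finset (PosIdx d)} (hc : c ∈ S) (haS : ∀ v : PosIdx d, v ≠ c → (a v.1 ≠ 0 ↔ v ∈ S))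

include hc in
lemma gcdIdx_pos : 0 < gcdIdx S := by
  refine Nat.pos_of_ne_zero fun h => ?_
  have := c.2
  have h1 := (Finset.gcd_eq_zero_iff.1 h) c hc
  omega

include hc in
lemma div_mul_gcdIdx : (c.1.2 : ℕ) / gcdIdx S * gcdIdx S = (c.1.2 : ℕ) :=
  Nat.div_mul_cancel (Finset.gcd_dvd hc)

include hζ ha hc haS

/-- The stabilizer of the point `a` of the chart. -/
lemma stabilizer_iff (n : ℕ) : (∀ v, ((ζ ^ chartWeight c v : kˣ) : k) ^ n * a v = a v) ↔
    (c.1.2 : ℕ) / gcdIdx S ∣ n := by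
  have hpow : ∀ v : Idx d, v ≠ c.1 →
      (((ζ ^ chartWeight c v : kˣ) : k) ^ n = 1 ↔ (c.1.2 : ℕ) ∣ (v.2 : ℕ) * n) := by
    intro v hv
    rw [← Units.val_pow_eq_pow_val, Units.val_eq_one, chartWeight, if_neg hv, ← zpow_natCast,
      ← zpow_mul, hζ.zpow_eq_one_iff_dvd, neg_mul, dvd_neg, ← Nat.cast_mul, Int.natCast_dvd_natCast]
  have hdiv := div_mul_gcdIdx hc
  constructor
  · intro h
    have h1 : (c.1.2 : ℕ) ∣ n * gcdIdx S := by
      -- Fixing a means that i divides n j for each (π, j) in S, with c itself causing no condition.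
      -- Hence i divides n times the gcd, and one divides by the gcd.
      have h2 : (S.gcd fun v => n * (v.1.2 : ℕ)) = n * gcdIdx S := by
        rw [Finset.gcd_mul_left, normalize_eq]; rfl
      rw [← h2]
      refine Finset.dvd_gcd fun v hv => ?_
      by_cases hvc : v = c
      · rw [hvc]; exact Dvd.intro_left n rfl
      · have h3 := h v.1
        have h4 := (haS v hvc).2 hv
        rw [mul_comm]
        refine (hpow v.1 fun h => hvc (Subtype.ext h)).1 ?_
        exact mul_right_cancel₀ h4 (h3.trans (one_mul _).symm)
    rw [← hdiv] at h1
    rw [hdiv] at h1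
    exact Nat.dvd_of_mul_dvd_mul_right (gcdIdx_pos hc) (by rwa [hdiv])
  · intro h v
    by_cases hvc : v = c.1
    · rw [hvc, ha, mul_zero]
    by_cases hva : a v = 0
    · rw [hva, mul_zero]
    rw [(hpow v hvc).2, one_mul]
    by_cases hv : 1 ≤ (v.2 : ℕ)
    · have h1 : (⟨v, hv⟩ : PosIdx d) ∈ S :=
        (haS ⟨v, hv⟩ fun h => hvc (congrArg Subtype.val h)).1 hva
      have h2 : gcdIdx S ∣ (v.2 : ℕ) := Finset.gcd_dvd (f := fun c : PosIdx d => (c.1.2 : ℕ)) h1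
      rw [← hdiv, mul_comm]
      exact mul_dvd_mul h2 h
    · rw [Nat.lt_one_iff.1 (not_le.1 hv), zero_mul]
      exact dvd_zero _

lemma chartDer_iterate_chartRot (n : ℕ) (f : Coord k d) :
    chartDer k c ((chartRot c ζ)^[n] f) = ((ζ : k) ^ n) • (chartRot c ζ)^[n] (chartDer k c f) := by
  clear ha hc haS
  induction n with
  | zero => simp
  | succ n ih =>
    rw [Function.iterate_succ_apply', chartDer_chartRot hζ.pow_eq_one, ih, map_smul, smul_smul,
      ← pow_succ', Function.iterate_succ_apply']

lemma aeval_iterate_chartRot {n : ℕ} (hn : (c.1.2 : ℕ) / gcdIdx S ∣ n) (f : Coord k d) :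
    MvPolynomial.aeval a ((chartRot c ζ)^[n] f) = MvPolynomial.aeval a f := by
  rw [chartRot, aeval_scaleVars_iterate, funext ((stabilizer_iff hζ ha hc haS n).2 hn)]

/-- Evaluate the commutation rule of D with the rotation at the fixed point a, where D X_{v₀} is
nonzero and can be cancelled. -/
lemma pow_chartWeight_eq {v₀ : Idx d}
    (h₀ : MvPolynomial.aeval a (chartDer k c (MvPolynomial.X v₀)) ≠ 0) :
    (ζ ^ ((c.1.2 : ℕ) / gcdIdx S)) ^ chartWeight c v₀ = ζ ^ ((c.1.2 : ℕ) / gcdIdx S) := by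
  have h1 := congrArg (MvPolynomial.aeval a) (chartDer_iterate_chartRot hζ ha hc haS
    ((c.1.2 : ℕ) / gcdIdx S) (MvPolynomial.X v₀))
  rw [map_smul, aeval_iterate_chartRot hζ ha hc haS dvd_rfl, chartRot, scaleVars_iterate_X,
    Derivation.map_smul, map_smul, smul_eq_mul, smul_eq_mul] at h1
  refine Units.ext ?_
  rw [← zpow_natCast, ← zpow_mul, mul_comm, zpow_mul, zpow_natCast, Units.val_pow_eq_pow_val,
    zpow_natCast, Units.val_pow_eq_pow_val]
  exact mul_right_cancel₀ h₀ h1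

end Stabilizer

variable (hd : ∀ σ, d σ ≤ p - 1)
variable (F : Type*) [Field F] [Algebra k F] [Algebra (Coord k d) F] [IsScalarTower k (Coord k d) F]
  [IsFractionRing (Coord k d) F] [CharP F p]

section

variable (hζ : ζ ^ (c.1.2 : ℕ) = 1) {a : Idx d → k} (ha : a c.1 = 0) {v₀ : Idx d}
    (h₀ : MvPolynomial.aeval a (chartDer k c (MvPolynomial.X v₀)) ≠ 0)

lemma foliatedChart_Δ_sub_C (v : Idx d) (e : k) :
    (foliatedChart hd F c hζ a ha v₀ h₀).Δ
        (algebraMap (Coord k d) F (MvPolynomial.X v - MvPolynomial.C e)) =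
      (foliatedChart hd F c hζ a ha v₀ h₀).Δ (algebraMap (Coord k d) F (MvPolynomial.X v)) := by
  have h : algebraMap (Coord k d) F (MvPolynomial.C e) = algebraMap k F e :=
    (IsScalarTower.algebraMap_apply k (Coord k d) F e).symm
  rw [map_sub, map_sub, h, Derivation.map_algebraMap, sub_zero]

lemma foliatedChart_Δ_pow (x : F) : (foliatedChart hd F c hζ a ha v₀ h₀).Δ (x ^ p) = 0 := by
  rw [Derivation.leibniz_pow, ← Nat.cast_smul_eq_nsmul F, CharP.cast_eq_zero, zero_smul]

/-- The coordinates of the quotient of the chart by the foliation. -/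
def chartCoord (v : Idx d) : (foliatedChart hd F c hζ a ha v₀ h₀).const :=
  if v = v₀ then ⟨algebraMap (Coord k d) F (MvPolynomial.X v₀ - MvPolynomial.C (a v₀)) ^ p,
    pow_mem (algebraMap_mem_locRing F _ _) _, foliatedChart_Δ_pow hd F hζ ha h₀ _⟩
  else ⟨constProj p (foliatedChart hd F c hζ a ha v₀ h₀).Δ
      (algebraMap (Coord k d) F (MvPolynomial.X v₀ - MvPolynomial.C (a v₀)))
      (algebraMap (Coord k d) F (MvPolynomial.X v - MvPolynomial.C (a v))),
    FoliatedChart.constProj_mem _ (fun _ => FoliatedChart.Δ_mem_locRing _) _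
      (algebraMap_mem_locRing F _ _),
    FoliatedChart.Δ_constProj _ ((foliatedChart_Δ_sub_C hd F hζ ha h₀ _ _).trans
      (foliatedChart hd F c hζ a ha v₀ h₀).Δ_slice) _⟩

lemma chartCoord_self : (chartCoord hd F hζ ha h₀ v₀ : F) =
    algebraMap (Coord k d) F (MvPolynomial.X v₀ - MvPolynomial.C (a v₀)) ^ p := by
  rw [chartCoord, if_pos rfl]

lemma chartCoord_of_ne {v : Idx d} (hv : v ≠ v₀) : (chartCoord hd F hζ ha h₀ v : F) =
    constProj p (foliatedChart hd F c hζ a ha v₀ h₀).Δ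
      (algebraMap (Coord k d) F (MvPolynomial.X v₀ - MvPolynomial.C (a v₀)))
      (algebraMap (Coord k d) F (MvPolynomial.X v - MvPolynomial.C (a v))) := by
  rw [chartCoord, if_neg hv]

/-- As c is neither v₀ nor its own predecessor, the swap fixes it; the corresponding coordinate is
the projection of E, which is E times a unit. -/
lemma exists_chartCoord_eq (hv : v₀ ≠ c.1) :
    ∃ e ∈ locRing F (foliatedChart hd F c hζ a ha v₀ h₀).ev, e ≠ 0 ∧
      e⁻¹ ∈ locRing F (foliatedChart hd F c hζ a ha v₀ h₀).ev ∧
      (chartCoord hd F hζ ha h₀ (Equiv.swap (predIdx c) v₀ c.1) : F) =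
        algebraMap (Coord k d) F (foliatedChart hd F c hζ a ha v₀ h₀).div * e := by
  obtain ⟨e, he, h⟩ := (foliatedChart hd F c hζ a ha v₀ h₀).exists_constProj_div
    (MvPolynomial.X v₀ - MvPolynomial.C (a v₀))
  have h1 : (foliatedChart hd F c hζ a ha v₀ h₀).ev
      (MvPolynomial.X v₀ - MvPolynomial.C (a v₀)) = 0 := by
    change MvPolynomial.aeval a _ = 0
    simp
  obtain ⟨h2, h3⟩ := FoliatedChart.one_add_mul_mem _ h1 he
  refine ⟨_, add_mem (one_mem _) (mul_mem (algebraMap_mem_locRing F _ _) he), h2, h3, ?_⟩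
  rw [← h, Equiv.swap_apply_of_ne_of_ne (predIdx_ne c).symm hv.symm,
    chartCoord_of_ne hd F hζ ha h₀ hv.symm, ha, map_zero, sub_zero]
  rfl

end

variable [IsAlgClosed k] (hζ : IsPrimitiveRoot ζ (c.1.2 : ℕ)) {a : Idx d → k} (ha : a c.1 = 0)
  {S : Finset (PosIdx d)} (hc : c ∈ S) (haS : ∀ v : PosIdx d, v ≠ c → (a v.1 ≠ 0 ↔ v ∈ S))
  {v₀ : Idx d}
  (h₀ : MvPolynomial.aeval a (chartDer k c (MvPolynomial.X v₀)) ≠ 0)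

include hc hζ in
lemma isPrimitiveRoot_pow_div : IsPrimitiveRoot (ζ ^ ((c.1.2 : ℕ) / gcdIdx S)) (gcdIdx S) :=
  hζ.pow c.2 (div_mul_gcdIdx hc).symm

include hc haS in
lemma rotF_iterate_coord {n : ℕ} (hn : (c.1.2 : ℕ) / gcdIdx S ∣ n) (v : Idx d) :
    (foliatedChart hd F c hζ.pow_eq_one a ha v₀ h₀).rotF^[n]
        (algebraMap (Coord k d) F (MvPolynomial.X v - MvPolynomial.C (a v))) =
      ((ζ ^ chartWeight c v : kˣ) : k) ^ n •
        algebraMap (Coord k d) F (MvPolynomial.X v - MvPolynomial.C (a v)) := by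
  rw [FoliatedChart.rotF_iterate_algebraMap, ← algebraMap_smul_eq]
  congr 1
  change (chartRot c ζ)^[n] _ = _
  have h1 := (stabilizer_iff hζ ha hc haS n).2 hn v
  rw [← AlgEquiv.coe_pow, map_sub, AlgEquiv.coe_pow, chartRot, scaleVars_iterate_X, smul_sub]
  congr 1
  rw [← AlgEquiv.coe_pow, MvPolynomial.smul_eq_C_mul, ← map_mul, h1]
  exact (scaleVars (fun v => ζ ^ chartWeight c v) ^ n).commutes (a v)

-- The swap places y^p at the index (σ, i - 1), as `weights` requires. The root ζ^(i/g) generates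
-- the stabilizer and is primitive of order g, which makes the character faithful.
include hc haS in
theorem chartCoord_constCoords [NeZero (gcdIdx S)] :
    (foliatedChart hd F c hζ.pow_eq_one a ha v₀ h₀).ConstCoords
      (fun v => chartCoord hd F hζ.pow_eq_one ha h₀ (Equiv.swap (predIdx c) v₀ v))
      (fun v => ((weights p c v : ℤ) : ZMod (gcdIdx S)))
      (AddChar.zmodChar (gcdIdx S) (ζ := ((ζ ^ ((c.1.2 : ℕ) / gcdIdx S) : kˣ) : k)) (by
        rw [← Units.val_pow_eq_pow_val, (isPrimitiveRoot_pow_div hζ hc).pow_eq_one, Units.val_one]))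
      ((c.1.2 : ℕ) / gcdIdx S) (gcdIdx S) where
  mem_iff t := by
    have hr : Set.range (fun v =>
        chartCoord hd F hζ.pow_eq_one ha h₀ (Equiv.swap (predIdx c) v₀ v)) =
        Set.range (chartCoord hd F hζ.pow_eq_one ha h₀) :=
      (Equiv.swap (predIdx c) v₀).surjective.range_comp (chartCoord hd F hζ.pow_eq_one ha h₀)
    rw [hr]
    exact FoliatedChart.mem_span_constProj _
      (x := fun v => MvPolynomial.X v - MvPolynomial.C (a v)) v₀ (ker_aeval_eq_span a)
      ((foliatedChart_Δ_sub_C hd F _ ha h₀ _ _).trans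
        (foliatedChart hd F c _ a ha v₀ h₀).Δ_slice) _
      (fun v hv => chartCoord_of_ne hd F _ ha h₀ hv) (chartCoord_self hd F _ ha h₀) t
  height := height_ker_aeval a
  faithful x hx := by
    obtain ⟨n, rfl⟩ := ZMod.intCast_surjective x
    rw [zmodChar_intCast, Units.val_eq_one,
      (isPrimitiveRoot_pow_div hζ hc).zpow_eq_one_iff_dvd] at hx
    exact (ZMod.intCast_zmod_eq_zero_iff_dvd _ _).2 hx
  order_eq := (div_mul_gcdIdx hc).symm
  ev_rot f := aeval_iterate_chartRot hζ ha hc haS dvd_rfl f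
  exists_ne s hs := by
    by_contra! h
    refine hs ((stabilizer_iff hζ ha hc haS s).1 fun v => ?_)
    have h1 := h (MvPolynomial.X v)
    change MvPolynomial.aeval a ((chartRot c ζ)^[s] _) = MvPolynomial.aeval a _ at h1
    rwa [chartRot, aeval_scaleVars_iterate, MvPolynomial.aeval_X, MvPolynomial.aeval_X] at h1
  rot_coord v := by
    have hω : (ζ ^ ((c.1.2 : ℕ) / gcdIdx S)) ^ (c.1.2 : ℕ) = 1 := by
      rw [← pow_mul, mul_comm, pow_mul, hζ.pow_eq_one, one_pow]
    have hw := pow_chartWeight_eq hζ ha hc haS h₀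
    have hcomm : ∀ v, ((ζ ^ chartWeight c v : kˣ) : k) ^ ((c.1.2 : ℕ) / gcdIdx S) =
        (((ζ ^ ((c.1.2 : ℕ) / gcdIdx S)) ^ chartWeight c v : kˣ) : k) := fun v => by
      rw [← Units.val_pow_eq_pow_val, ← zpow_natCast, ← zpow_mul, mul_comm, zpow_mul, zpow_natCast]
    rw [zmodChar_intCast, weights_swap hω hw]
    generalize (Equiv.swap (predIdx c) v₀) v = u
    have hrot := rotF_iterate_coord hd F hζ ha hc haS h₀ dvd_rfl
    by_cases hu : u = v₀
    · rw [if_pos hu, hu, chartCoord_self, ← AlgEquiv.coe_pow, map_pow, AlgEquiv.coe_pow, hrot,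
        smul_pow, hcomm, Units.val_pow_eq_pow_val]
    · rw [if_neg hu, chartCoord_of_ne _ _ _ _ _ hu, FoliatedChart.rotF_iterate_constProj _ (hrot _),
        hrot, hcomm, Algebra.smul_def, Algebra.smul_def,
        constProj_const_mul _ (Derivation.map_algebraMap _ _)]

/-- The power of a coordinate which descends to the quotient. -/
lemma exists_parameters :
    ∃ q : Idx d → F, (∀ v, q v ∈ (foliatedChart hd F c hζ.pow_eq_one a ha v₀ h₀).inv ∧
      q v ∈ locIdeal F (foliatedChart hd F c hζ.pow_eq_one a ha v₀ h₀).ev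
        (RingHom.ker (foliatedChart hd F c hζ.pow_eq_one a ha v₀ h₀).ev)) ∧
      IsParameters (foliatedChart hd F c hζ.pow_eq_one a ha v₀ h₀).ev (Set.range q) := by
  refine ⟨fun v => algebraMap (Coord k d) F
    ((MvPolynomial.X v ^ (c.1.2 : ℕ) - MvPolynomial.C (a v ^ (c.1.2 : ℕ))) ^ p),
    fun v => ⟨⟨algebraMap_mem_locRing F _ _, ?_, ?_⟩, algebraMap_mem_locIdeal ?_⟩, ?_⟩
  · rw [FoliatedChart.rotF_algebraMap]
    congr 1
    change chartRot c ζ _ = _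
    have h1 : chartRot c ζ (MvPolynomial.C (a v ^ (c.1.2 : ℕ))) =
      MvPolynomial.C (a v ^ (c.1.2 : ℕ)) := (chartRot c ζ).commutes _
    have h2 : ((ζ ^ chartWeight c v : kˣ) : k) ^ (c.1.2 : ℕ) = 1 := by
      rw [← Units.val_pow_eq_pow_val, ← zpow_natCast, ← zpow_mul, mul_comm, zpow_mul, zpow_natCast,
        hζ.pow_eq_one, one_zpow, Units.val_one]
    rw [map_pow, map_sub, h1, map_pow, chartRot, scaleVars_X, smul_pow, h2, one_smul]
  · beta_reduce
    rw [map_pow]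
    exact foliatedChart_Δ_pow hd F _ ha h₀ _
  · change MvPolynomial.aeval a _ = 0
    simp [hp.out.ne_zero]
  · intro Q hQ hle h
    refine eq_ker_aeval_of_pow_mem (idx_ne_zero hd c) hle (n := p) fun v => ?_
    exact (algebraMap_mem_locIdeal_iff hle).1 (h _ ⟨v, rfl⟩)

end ChartCoords

end AlphaP
end

/-! ### Dehomogenization of the Rees algebra on a chart. -/

noncomputable section

namespace AlphaP

set_option linter.unusedSectionVars false

section ReesMap

universe u

variable {p : ℕ} [hp : Fact p.Prime] {k : Type u} [Field k] [CharP k p] {l : ℕ} {d : Fin l → ℕ}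
  (c : PosIdx d)

/-- The effect of the blow-up on exponent vectors. -/
def chartExp (e : Idx d →₀ ℕ) : Idx d →₀ ℕ := e.erase c.1 + Finsupp.single c.1 (wt d e)

lemma wt_single (v : Idx d) (n : ℕ) : wt d (Finsupp.single v n) = n * (v.2 : ℕ) := by
  simp [wt]

/-- The exponent at c is replaced by the total weight, from which it can be recovered because c has
positive index. -/
lemma chartExp_injective : Function.Injective (chartExp c) := by
  intro e f h
  have h1 : e.erase c.1 = f.erase c.1 := by
    ext v
    by_cases hv : v = c.1
    · rw [hv, Finsupp.erase_same, Finsupp.erase_same]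
    · have := DFunLike.congr_fun h v
      rwa [chartExp, chartExp, Finsupp.add_apply, Finsupp.add_apply,
        Finsupp.single_eq_of_ne hv, Finsupp.single_eq_of_ne hv, add_zero, add_zero] at this
  have h2 : wt d e = wt d f := by
    have := DFunLike.congr_fun h c.1
    rwa [chartExp, chartExp, Finsupp.add_apply, Finsupp.add_apply, Finsupp.erase_same,
      Finsupp.erase_same, Finsupp.single_eq_same, Finsupp.single_eq_same, zero_add, zero_add] at this
  rw [← Finsupp.erase_add_single c.1 e, ← Finsupp.erase_add_single c.1 f, wt_add, wt_add, h1,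
    wt_single, wt_single, add_right_inj] at h2
  rw [← Finsupp.erase_add_single c.1 e, ← Finsupp.erase_add_single c.1 f, h1,
    Nat.eq_of_mul_eq_mul_right c.2 h2]

lemma chartMap_monomial (e : Idx d →₀ ℕ) (a : k) :
    chartMap k c (MvPolynomial.monomial e a) = MvPolynomial.monomial (chartExp c e) a := by
  induction e using Finsupp.induction_linear generalizing a with
  | zero =>
    have : chartExp c (0 : Idx d →₀ ℕ) = 0 := by
      rw [chartExp, Finsupp.erase_zero]
      simp [wt]
    rw [this]
    exact (chartMap k c).commutes a
  | add e f he hf =>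
    have h1 : chartExp c (e + f) = chartExp c e + chartExp c f := by
      rw [chartExp, Finsupp.erase_add, wt_add, Finsupp.single_add, chartExp, chartExp]
      exact add_add_add_comm _ _ _ _
    have h2 : (MvPolynomial.monomial (e + f) a : Coord k d) =
        MvPolynomial.monomial e a * MvPolynomial.monomial f 1 := by
      rw [MvPolynomial.monomial_mul, mul_one]
    rw [h2, map_mul, he, hf, MvPolynomial.monomial_mul, mul_one, h1]
  | single v n =>
    have h2 : (MvPolynomial.monomial (Finsupp.single v n) a : Coord k d) =
        MvPolynomial.C a * MvPolynomial.X v ^ n := by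
      rw [MvPolynomial.X_pow_eq_monomial, MvPolynomial.C_mul_monomial, mul_one]
    rw [h2, map_mul, map_pow, MvPolynomial.algHom_C, chartMap, MvPolynomial.aeval_X, mul_pow,
      ← pow_mul, chartExp, wt_single, MvPolynomial.algebraMap_eq, homogVar, chartEq]
    split_ifs with h
    · have h3 : (Finsupp.single v n).erase c.1 = 0 := by
        rw [h, Finsupp.erase_single]
      rw [h3, zero_add, one_pow, one_mul, MvPolynomial.X_pow_eq_monomial,
        MvPolynomial.C_mul_monomial, mul_one, mul_comm]
    · have h3 : (Finsupp.single v n).erase c.1 = Finsupp.single v n :=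
        Finsupp.erase_of_notMem_support fun hm => h (Finset.mem_singleton.1
          (Finsupp.support_single_subset hm)).symm
      rw [h3, MvPolynomial.X_pow_eq_monomial, MvPolynomial.X_pow_eq_monomial,
        MvPolynomial.monomial_mul, MvPolynomial.C_mul_monomial, mul_one, mul_one, mul_comm]

lemma chartMap_injective : Function.Injective (chartMap k c) := by
  have h : ∀ (f : Coord k d) e, (chartMap k c f).coeff (chartExp c e) = f.coeff e := by
    intro f e
    induction f using MvPolynomial.induction_on' with
    | monomial e' a =>
      rw [chartMap_monomial, MvPolynomial.coeff_monomial, MvPolynomial.coeff_monomial]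
      simp only [(chartExp_injective c).eq_iff]
    | add f g hf hg => rw [map_add, MvPolynomial.coeff_add, MvPolynomial.coeff_add, hf, hg]
  intro f g hfg
  ext e
  rw [← h f, ← h g, hfg]

/-- The `m`-th piece of the filtration pulls back to the `m`-th power of the equation of the
exceptional divisor. -/
lemma exists_chartMap_eq {m : ℕ} {f : Coord k d} (hf : f ∈ weightIdeal k d m) :
    chartEq k c ^ m ∣ chartMap k c f := by
  have h : (weightIdeal k d m).map (chartMap k c) ≤ Ideal.span {chartEq k c ^ m} := by
    rw [weightIdeal, Ideal.map_span, Ideal.span_le]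
    rintro _ ⟨_, ⟨e, he, rfl⟩, rfl⟩
    rw [SetLike.mem_coe, Ideal.mem_span_singleton, chartMap_monomial, chartExp]
    refine (pow_dvd_pow _ he).trans ⟨MvPolynomial.monomial (e.erase c.1) 1, ?_⟩
    rw [chartEq, MvPolynomial.X_pow_eq_monomial, MvPolynomial.monomial_mul, mul_one, add_comm]
  exact Ideal.mem_span_singleton.1 (h (Ideal.mem_map_of_mem _ hf))

variable (F : Type*) [Field F] [Algebra k F] [Algebra (Coord k d) F] [IsScalarTower k (Coord k d) F]
  [IsFractionRing (Coord k d) F]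

variable (k)

/-- The function on the chart defined by an element of the Rees algebra, as a rational function. -/
def reesEval : rees k d →+* F :=
  (Polynomial.eval₂RingHom (chartField k F c : Coord k d →+* F)
    (algebraMap (Coord k d) F (chartEq k c))⁻¹).comp (rees k d).subtype

lemma reesEval_apply (P : rees k d) : reesEval k c F P =
    ∑ m ∈ (P : Polynomial (Coord k d)).support,
      chartField k F c ((P : Polynomial (Coord k d)).coeff m) *
        (algebraMap (Coord k d) F (chartEq k c))⁻¹ ^ m :=
  Polynomial.eval₂_def _ _ _

lemma exists_reesEval_eq (P : rees k d) : ∃ f, algebraMap (Coord k d) F f = reesEval k c F P := by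
  have h : reesEval k c F P ∈ (algebraMap (Coord k d) F).range := by
    rw [reesEval_apply]
    refine sum_mem fun m _ => ?_
    obtain ⟨b, hb⟩ := exists_chartMap_eq c (P.2 m)
    refine ⟨b, ?_⟩
    rw [chartField_apply, hb, map_mul, map_pow, mul_comm, ← mul_assoc, ← mul_pow,
      inv_mul_cancel₀ (chartEq_ne_zero F c), one_pow, one_mul]
  exact h

/-- The function on the chart defined by an element of the Rees algebra: homogeneous coordinates are
dehomogenized by setting the coordinate with index `c` to one. -/
def reesMap : rees k d →+* Coord k d where
  toFun P := (exists_reesEval_eq k c F P).choose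
  map_one' := IsFractionRing.injective (Coord k d) F <| by
    rw [(exists_reesEval_eq k c F 1).choose_spec, map_one, map_one]
  map_zero' := IsFractionRing.injective (Coord k d) F <| by
    rw [(exists_reesEval_eq k c F 0).choose_spec, map_zero, map_zero]
  map_mul' P Q := IsFractionRing.injective (Coord k d) F <| by
    refine (exists_reesEval_eq k c F (P * Q)).choose_spec.trans ((map_mul _ P Q).trans ?_)
    rw [map_mul (algebraMap (Coord k d) F), (exists_reesEval_eq k c F P).choose_spec,
      (exists_reesEval_eq k c F Q).choose_spec]
  map_add' P Q := IsFractionRing.injective (Coord k d) F <| by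
    refine (exists_reesEval_eq k c F (P + Q)).choose_spec.trans ((map_add _ P Q).trans ?_)
    rw [map_add (algebraMap (Coord k d) F), (exists_reesEval_eq k c F P).choose_spec,
      (exists_reesEval_eq k c F Q).choose_spec]

lemma algebraMap_reesMap (P : rees k d) :
    algebraMap (Coord k d) F (reesMap k c F P) = reesEval k c F P :=
  (exists_reesEval_eq k c F P).choose_spec

variable {k c}

lemma eq_reesMonomial {m : ℕ} {P : rees k d} (hP : P ∈ reesGrading k d m) :
    (P : Polynomial (Coord k d)) = Polynomial.monomial m (atOne k d P) := by
  have h : (P : Polynomial (Coord k d)) =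
      Polynomial.monomial m ((P : Polynomial (Coord k d)).coeff m) := by
    ext1 n
    rw [Polynomial.coeff_monomial]
    split_ifs with h
    · rw [h]
    · exact hP n (Ne.symm h)
  have h2 : atOne k d P = (P : Polynomial (Coord k d)).coeff m := by
    change Polynomial.eval 1 (P : Polynomial (Coord k d)) = _
    rw [h, Polynomial.eval_monomial, one_pow, mul_one, Polynomial.coeff_monomial, if_pos rfl]
  rw [h2, ← h]

lemma atOne_eq_zero_iff {m : ℕ} {P : rees k d} (hP : P ∈ reesGrading k d m) :
    atOne k d P = 0 ↔ P = 0 := by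
  refine ⟨fun h => Subtype.ext ?_, fun h => by rw [h, map_zero]⟩
  rw [eq_reesMonomial hP, h, map_zero]
  rfl

lemma reesMap_homogeneous {m : ℕ} {P : rees k d} (hP : P ∈ reesGrading k d m) :
    chartEq k c ^ m * reesMap k c F P = chartMap k c (atOne k d P) := by
  refine IsFractionRing.injective (Coord k d) F ?_
  have h : reesEval k c F P = chartField k F c (atOne k d P) *
      (algebraMap (Coord k d) F (chartEq k c))⁻¹ ^ m := by
    change Polynomial.eval₂ _ _ (P : Polynomial (Coord k d)) = _
    rw [eq_reesMonomial hP, Polynomial.eval₂_monomial]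
    rfl
  rw [map_mul, algebraMap_reesMap, h, map_pow, mul_comm, mul_assoc, ← mul_pow,
    inv_mul_cancel₀ (chartEq_ne_zero F c), one_pow, mul_one, chartField_apply]

lemma reesMap_eq_iff {m : ℕ} {P : rees k d} (hP : P ∈ reesGrading k d m) {f : Coord k d} :
    reesMap k c F P = f ↔ chartMap k c (atOne k d P) = chartEq k c ^ m * f := by
  rw [← reesMap_homogeneous F hP]
  exact ⟨fun h => by rw [h], fun h =>
    mul_left_cancel₀ (pow_ne_zero _ (MvPolynomial.X_ne_zero _)) h⟩

lemma reesMap_eq_zero_iff {m : ℕ} {P : rees k d} (hP : P ∈ reesGrading k d m) :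
    reesMap k c F P = 0 ↔ P = 0 := by
  rw [reesMap_eq_iff F hP, mul_zero, map_eq_zero_iff _ (chartMap_injective c),
    atOne_eq_zero_iff hP]

lemma reesMap_inj {m : ℕ} {P Q : rees k d} (hP : P ∈ reesGrading k d m)
    (hQ : Q ∈ reesGrading k d m) (h : reesMap k c F P = reesMap k c F Q) : P = Q := by
  rw [← sub_eq_zero, ← map_sub, reesMap_eq_zero_iff F (sub_mem hP hQ), sub_eq_zero] at h
  exact h

lemma reesMonomial_mem (m : ℕ) (f : Coord k d) (hf : f ∈ weightIdeal k d m) :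
    reesMonomial k d m f hf ∈ reesGrading k d m := fun n hn => by
  simp [reesMonomial, Polynomial.coeff_monomial, hn.symm]

lemma atOne_reesMonomial (m : ℕ) (f : Coord k d) (hf : f ∈ weightIdeal k d m) :
    atOne k d (reesMonomial k d m f hf) = f := by
  change Polynomial.eval 1 (Polynomial.monomial m f) = f
  rw [Polynomial.eval_monomial, one_pow, mul_one]

lemma X_mem_weightIdeal_of_le {v : Idx d} {m : ℕ} (h : m ≤ (v.2 : ℕ)) :
    MvPolynomial.X v ∈ weightIdeal k d m :=
  Ideal.subset_span ⟨Finsupp.single v 1, by rwa [wt_single, one_mul], rfl⟩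

/-- The element `x_v t^m` of the Rees algebra. -/
def reesVar (v : Idx d) (m : ℕ) (h : m ≤ (v.2 : ℕ)) : rees k d :=
  reesMonomial k d m (MvPolynomial.X v) (X_mem_weightIdeal_of_le h)

lemma reesMap_reesVar (v : Idx d) (m : ℕ) (h : m ≤ (v.2 : ℕ)) :
    reesMap k c F (reesVar v m h) = homogVar k c v * chartEq k c ^ ((v.2 : ℕ) - m) := by
  rw [reesVar, reesMap_eq_iff F (reesMonomial_mem _ _ _), atOne_reesMonomial, chartMap,
    MvPolynomial.aeval_X, mul_left_comm, ← pow_add, Nat.add_sub_cancel' h]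

lemma reesMap_reesVar_self : reesMap k c F (reesVar c.1 (c.1.2 : ℕ) le_rfl) = 1 := by
  rw [reesMap_reesVar, Nat.sub_self, pow_zero, mul_one, homogVar, if_pos rfl]

lemma reesMap_reesVar_pred :
    reesMap k c F (reesVar c.1 ((c.1.2 : ℕ) - 1) (Nat.sub_le _ _)) = chartEq k c := by
  have := c.2
  rw [reesMap_reesVar, Nat.sub_sub_self this, pow_one, homogVar, if_pos rfl, one_mul]

lemma reesMap_reesZero (e : k) :
    reesMap k c F (reesZero k d (MvPolynomial.C e)) = MvPolynomial.C e := by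
  rw [reesMap_eq_iff F (reesZero k d (MvPolynomial.C e)).2, pow_zero, one_mul]
  have : atOne k d (reesZero k d (MvPolynomial.C e)) = MvPolynomial.C e :=
    atOne_reesMonomial 0 (MvPolynomial.C e) (by rw [weightIdeal_zero]; trivial)
  rw [this]
  exact (chartMap k c).commutes e

/-- The U_v come from x_v t^j, and E comes from x_c t^(i-1); the latter lies in the Rees algebra
because its pieces are defined by an inequality on weights. -/
lemma reesMap_surjective : Function.Surjective (reesMap k c F) := by
  intro f
  induction f using MvPolynomial.induction_on with
  | C e => exact ⟨_, reesMap_reesZero F e⟩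
  | add f g hf hg =>
    obtain ⟨P, rfl⟩ := hf
    obtain ⟨Q, rfl⟩ := hg
    exact ⟨P + Q, map_add _ _ _⟩
  | mul_X f v hf =>
    obtain ⟨P, rfl⟩ := hf
    obtain ⟨Q, hQ⟩ : ∃ Q, reesMap k c F Q = MvPolynomial.X v := by
      by_cases hv : v = c.1
      · rw [hv]; exact ⟨_, reesMap_reesVar_pred F⟩
      · refine ⟨reesVar v (v.2 : ℕ) le_rfl, ?_⟩
        rw [reesMap_reesVar, Nat.sub_self, pow_zero, mul_one, homogVar, if_neg hv]
    exact ⟨P * Q, by rw [map_mul, hQ]⟩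

variable {ζ : kˣ}

/-- Multiplied by E^m, the value of P becomes a function from below and is invariant. As E has
weight 1, the degree is turned into the weight -m. -/
lemma chartRot_reesMap (hζ : ζ ^ (c.1.2 : ℕ) = 1) {m : ℕ} {P : rees k d}
    (hP : P ∈ reesGrading k d m) :
    chartRot c ζ (reesMap k c F P) = ((ζ : k)⁻¹ ^ m) • reesMap k c F P := by
  have h := congrArg (chartRot c ζ) (reesMap_homogeneous (c := c) F hP)
  rw [chartRot_chartMap hζ, ← reesMap_homogeneous (c := c) F hP, map_mul, map_pow, chartRot_chartEq, smul_pow,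
    smul_mul_assoc, ← mul_smul_comm] at h
  have h1 := mul_left_cancel₀ (pow_ne_zero _ (MvPolynomial.X_ne_zero _)) h
  conv_rhs => rw [← h1]
  rw [smul_smul, ← mul_pow, inv_mul_cancel₀ (Units.ne_zero ζ), one_pow, one_smul]

lemma sum_reesComponent (P : rees k d) :
    ∑ m ∈ (P : Polynomial (Coord k d)).support, (reesComponent k d P m : rees k d) = P := by
  refine Subtype.ext ?_
  rw [AddSubmonoidClass.coe_finsetSum]
  exact (P : Polynomial (Coord k d)).as_sum_support.symm

lemma reesComponent_mem {I : Ideal (rees k d)} (hI : I.IsHomogeneous (reesGrading k d))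
    {P : rees k d} (hP : P ∈ I) (m : ℕ) : (reesComponent k d P m : rees k d) ∈ I := by
  have h := hI m hP
  have h1 : (DirectSum.decompose (reesGrading k d) P m : rees k d) = reesComponent k d P m := by
    conv_lhs => rw [← sum_reesComponent P]
    rw [DirectSum.decompose_sum, DFinsupp.finsetSum_apply, AddSubmonoidClass.coe_finsetSum]
    by_cases hm : m ∈ (P : Polynomial (Coord k d)).support
    · rw [Finset.sum_eq_single_of_mem m hm, DirectSum.decompose_of_mem_same _
        (reesComponent k d P m).2]
      intro n _ hn
      exact DirectSum.decompose_of_mem_ne _ (reesComponent k d P n).2 hn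
    · rw [Finset.sum_eq_zero]
      · refine (Subtype.ext ?_ : (0 : rees k d) = _)
        rw [reesComponent_coe, Polynomial.notMem_support_iff.1 hm, map_zero]
        rfl
      · intro n hn
        exact DirectSum.decompose_of_mem_ne _ (reesComponent k d P n).2 fun h => hm (h ▸ hn)
  rwa [h1] at h

/-- A function on the chart which is invariant under the cyclic group is defined by a homogeneous
element, whose degree may be chosen to be large. -/
lemma exists_homogeneous_of_fixed (hζ : IsPrimitiveRoot ζ (c.1.2 : ℕ))
    (hi : ((c.1.2 : ℕ) : k) ≠ 0) {I : Ideal (rees k d)} (hI : I.IsHomogeneous (reesGrading k d))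
    {P : rees k d} (hP : P ∈ I) (hfix : chartRot c ζ (reesMap k c F P) = reesMap k c F P) :
    ∃ L₀, ∀ L, L₀ ≤ L → ∃ Q ∈ I, Q ∈ reesGrading k d (L * (c.1.2 : ℕ)) ∧
      reesMap k c F Q = reesMap k c F P := by
  set i := (c.1.2 : ℕ) with hi'
  set s := (P : Polynomial (Coord k d)).support
  have hrot : ∀ (n m : ℕ), (chartRot c ζ)^[n] (reesMap k c F (reesComponent k d P m)) =
      (((ζ : k)⁻¹ ^ m) ^ n) • reesMap k c F (reesComponent k d P m) := by
    intro n m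
    induction n with
    | zero => simp
    | succ n ih =>
      rw [Function.iterate_succ_apply', ih, map_smul,
        chartRot_reesMap F hζ.pow_eq_one (reesComponent k d P m).2, smul_smul, pow_succ]
  have hgeom : ∀ m, ∑ n ∈ Finset.range i, ((ζ : k)⁻¹ ^ m) ^ n = if i ∣ m then (i : k) else 0 := by
    intro m
    split_ifs with h
    · have h1 : (ζ : k)⁻¹ ^ m = 1 := by
        rw [inv_pow, ← Units.val_pow_eq_pow_val, (hζ.pow_eq_one_iff_dvd m).2 h, Units.val_one,
          inv_one]
      simp [h1]
    · have h1 : (ζ : k)⁻¹ ^ m ≠ 1 := by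
        intro h2
        rw [inv_pow, inv_eq_one, ← Units.val_pow_eq_pow_val, Units.val_eq_one,
          hζ.pow_eq_one_iff_dvd] at h2
        exact h h2
      rw [geom_sum_eq h1, ← pow_mul, mul_comm, pow_mul, inv_pow (ζ : k) i,
        ← Units.val_pow_eq_pow_val, hζ.pow_eq_one, Units.val_one, inv_one, one_pow, sub_self,
        zero_div]
  -- Averaging over the group keeps only the components of degree divisible by i, by orthogonality
  -- of characters.
  have hsum : reesMap k c F P =
      ∑ m ∈ s with i ∣ m, reesMap k c F (reesComponent k d P m) := by
    have h1 : ∑ n ∈ Finset.range i, (chartRot c ζ)^[n] (reesMap k c F P) =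
        (i : k) • reesMap k c F P := by
      rw [Finset.sum_congr rfl fun n _ => Function.iterate_fixed hfix n, Finset.sum_const,
        Finset.card_range, Nat.cast_smul_eq_nsmul]
    have h2 : ∑ n ∈ Finset.range i, (chartRot c ζ)^[n] (reesMap k c F P) =
        (i : k) • ∑ m ∈ s with i ∣ m, reesMap k c F (reesComponent k d P m) := by
      conv_lhs => rw [← sum_reesComponent P]
      simp only [map_sum, ← AlgEquiv.coe_pow]
      simp only [AlgEquiv.coe_pow, hrot]
      rw [Finset.sum_comm, Finset.smul_sum, Finset.sum_filter]
      refine Finset.sum_congr rfl fun m _ => ?_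
      rw [← Finset.sum_smul, hgeom]
      split_ifs
      · rfl
      · rw [zero_smul]
    exact smul_right_injective _ hi (h1.symm.trans h2)
  -- Powers of the homogeneous coordinate U_c, whose value is 1, bring the surviving components to
  -- the common degree L i.
  refine ⟨s.sup id, fun L hL => ⟨∑ m ∈ s with i ∣ m, reesVar c.1 i le_rfl ^ (L - m / i) *
    (reesComponent k d P m : rees k d), sum_mem fun m _ => Ideal.mul_mem_left _ _
      (reesComponent_mem hI hP m), sum_mem fun m hm => ?_, ?_⟩⟩
  · have h1 := Finset.mem_filter.1 hm
    have h2 : m ≤ L := (Finset.le_sup (f := id) h1.1).trans hL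
    have h3 : L * i = (L - m / i) • i + m := by
      have h4 : m / i ≤ L := (Nat.div_le_self m i).trans h2
      have h5 := Nat.div_mul_cancel h1.2
      rw [smul_eq_mul, Nat.sub_mul, h5, Nat.sub_add_cancel]
      rw [← h5]
      exact Nat.mul_le_mul_right _ h4
    rw [h3]
    exact SetLike.mul_mem_graded (SetLike.pow_mem_graded _ (reesMonomial_mem _ _ _))
      (reesComponent k d P m).2
  · rw [hsum, map_sum]
    refine Finset.sum_congr rfl fun m _ => ?_
    rw [map_mul, map_pow, reesMap_reesVar_self, one_pow, one_mul]

end ReesMap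

end AlphaP
end

/-! ### The local rings of Y and W inside the function field of the chart. -/

noncomputable section

namespace AlphaP

set_option linter.unusedSectionVars false

section Stalk

universe u

open HomogeneousLocalization

variable {p : ℕ} [hp : Fact p.Prime] {k : Type u} [Field k] [CharP k p] {l : ℕ} {d : Fin l → ℕ}

variable (F : Type*) [Field F] [Algebra k F] [Algebra (Coord k d) F] [IsScalarTower k (Coord k d) F]
  [IsFractionRing (Coord k d) F] [CharP F p] (c : PosIdx d)

lemma chartField_atOne_ne_zero {m : ℕ} {P : rees k d} (hP : P ∈ reesGrading k d m) (h : P ≠ 0) :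
    chartField k F c (atOne k d P) ≠ 0 := by
  rwa [chartField_apply, Ne, IsFractionRing.to_map_eq_zero_iff,
    map_eq_zero_iff _ (chartMap_injective c), atOne_eq_zero_iff hP]

variable (y : ProjectiveSpectrum (reesGrading k d))

lemma chartField_den_ne_zero
    (a : NumDenSameDeg (reesGrading k d) y.asHomogeneousIdeal.toIdeal.primeCompl) :
    chartField k F c (atOne k d a.den) ≠ 0 :=
  chartField_atOne_ne_zero F c a.den.2 fun h => a.den_mem (h ▸ zero_mem _)

/-- The rational function defined by a homogeneous fraction. -/
def ratioFun (z : AtPrime (reesGrading k d) y.asHomogeneousIdeal.toIdeal) : F :=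
  Quotient.liftOn' z
    (fun a => chartField k F c (atOne k d a.num) / chartField k F c (atOne k d a.den)) fun a b h => by
      have h : Localization.mk (a.num : rees k d)
          (⟨a.den, a.den_mem⟩ : y.asHomogeneousIdeal.toIdeal.primeCompl) =
          Localization.mk (b.num : rees k d) ⟨b.den, b.den_mem⟩ := h
      rw [Localization.mk_eq_mk_iff, Localization.r_iff_exists] at h
      obtain ⟨e, he⟩ := h
      have he0 : (e : rees k d) ≠ 0 := fun h => e.2 (h ▸ zero_mem _)
      have h1 := mul_left_cancel₀ he0 he
      rw [div_eq_div_iff (chartField_den_ne_zero F c y a) (chartField_den_ne_zero F c y b),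
        ← map_mul, ← map_mul, ← map_mul, ← map_mul, mul_comm _ (b.den : rees k d),
        mul_comm (b.num : rees k d)]
      exact congrArg _ (congrArg _ h1)

lemma ratioFun_mk (a : NumDenSameDeg (reesGrading k d) y.asHomogeneousIdeal.toIdeal.primeCompl) :
    ratioFun F c y (.mk a) =
      chartField k F c (atOne k d a.num) / chartField k F c (atOne k d a.den) := rfl

/-- The embedding of the local ring of the blow-up in the function field of the chart. -/
def ratioMap : AtPrime (reesGrading k d) y.asHomogeneousIdeal.toIdeal →+* F where
  toFun := ratioFun F c y
  map_one' := by
    change ratioFun F c y (.mk 1) = 1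
    rw [ratioFun_mk, div_eq_one_iff_eq (chartField_den_ne_zero F c y _)]
    rfl
  map_zero' := by
    change ratioFun F c y (.mk 0) = 0
    rw [ratioFun_mk, NumDenSameDeg.num_zero, ZeroMemClass.coe_zero, map_zero, map_zero, zero_div]
  map_mul' z z' := by
    obtain ⟨a, rfl⟩ := mk_surjective z
    obtain ⟨b, rfl⟩ := mk_surjective z'
    rw [← mk_mul, ratioFun_mk, ratioFun_mk, ratioFun_mk, NumDenSameDeg.num_mul,
      NumDenSameDeg.den_mul, map_mul, map_mul, map_mul, map_mul, div_mul_div_comm]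
  map_add' z z' := by
    obtain ⟨a, rfl⟩ := mk_surjective z
    obtain ⟨b, rfl⟩ := mk_surjective z'
    rw [← mk_add, ratioFun_mk, ratioFun_mk, ratioFun_mk, NumDenSameDeg.num_add,
      NumDenSameDeg.den_add, map_add, map_add, map_mul, map_mul, map_mul, map_mul, map_mul, map_mul,
      div_add_div _ _ (chartField_den_ne_zero F c y _) (chartField_den_ne_zero F c y _)]
    ring

lemma ratioMap_mk (a : NumDenSameDeg (reesGrading k d) y.asHomogeneousIdeal.toIdeal.primeCompl) :
    ratioMap F c y (.mk a) =
      chartField k F c (atOne k d a.num) / chartField k F c (atOne k d a.den) := rfl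

lemma ratioMap_injective : Function.Injective (ratioMap F c y) := by
  rw [injective_iff_map_eq_zero]
  intro z hz
  obtain ⟨a, rfl⟩ := mk_surjective z
  rw [ratioMap_mk, div_eq_zero_iff, or_iff_left (chartField_den_ne_zero F c y a)] at hz
  have h1 : (a.num : rees k d) = 0 := by
    by_contra h
    exact chartField_atOne_ne_zero F c a.num.2 h hz
  apply HomogeneousLocalization.val_injective
  rw [val_mk, h1, Localization.mk_zero, val_zero]

lemma isUnit_mk_iff
    (a : NumDenSameDeg (reesGrading k d) y.asHomogeneousIdeal.toIdeal.primeCompl) :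
    IsUnit (HomogeneousLocalization.mk a : AtPrime (reesGrading k d)
      y.asHomogeneousIdeal.toIdeal) ↔ (a.num : rees k d) ∉ y.asHomogeneousIdeal := by
  rw [← isUnit_iff_isUnit_val, HomogeneousLocalization.val_mk, Localization.mk_eq_mk',
    IsLocalization.AtPrime.isUnit_mk'_iff _ y.asHomogeneousIdeal.toIdeal]
  rfl

section

variable (hd : ∀ σ, d σ ≤ p - 1)

include hd in
lemma isConst_iff (z : AtPrime (reesGrading k d) y.asHomogeneousIdeal.toIdeal) :
    z ∈ constSubring k d y ↔ fieldDel k F c (ratioMap F c y z) = 0 := by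
  have key : ∀ a : NumDenSameDeg (reesGrading k d) y.asHomogeneousIdeal.toIdeal.primeCompl,
      atOne k d a.den * del k d (atOne k d a.num) = atOne k d a.num * del k d (atOne k d a.den) ↔
        fieldDel k F c (ratioMap F c y (.mk a)) = 0 := by
    intro a
    have h0 := chartField_den_ne_zero F c y a
    have hinj : Function.Injective (chartField k F c) :=
      (IsFractionRing.injective (Coord k d) F).comp (chartMap_injective c)
    rw [ratioMap_mk, div_eq_mul_inv, Derivation.leibniz, Derivation.leibniz_inv,
      fieldDel_chartField hd, fieldDel_chartField hd, ← hinj.eq_iff, map_mul, map_mul]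
    simp only [smul_eq_mul]
    generalize chartField k F c (atOne k d a.den) = D at h0 ⊢
    generalize chartField k F c (atOne k d a.num) = N
    have h1 : ∀ x y : F, N * (-D⁻¹ ^ 2 * y) + D⁻¹ * x = D⁻¹ ^ 2 * (D * x - N * y) := by
      intro x y
      field_simp
      ring
    rw [h1, mul_eq_zero, or_iff_right (pow_ne_zero _ (inv_ne_zero h0)), sub_eq_zero]
  constructor
  · rintro ⟨a, rfl, ha⟩
    exact (key a).1 ha
  · intro h
    obtain ⟨a, rfl⟩ := mk_surjective z
    exact ⟨a, rfl, (key a).2 h⟩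

end

/-- The embedding of the local ring of the quotient in the function field of the chart. -/
def stalkEmb (w : ProjectiveSpectrum (reesGrading k d)) :
    (quotPresheaf k d).stalk w →+* F :=
  ((ratioMap F c w).comp (Proj.stalkIso' (reesGrading k d) w).toRingHom).comp
    ((quotHom k d).stalkMap w).hom

variable (w : ProjectiveSpectrum (reesGrading k d))

lemma stalkIso_stalkMap_germ (U : Opens (ProjectiveSpectrum.top (reesGrading k d))) (hw : w ∈ U)
    (s : quotSections k d (op U)) :
    Proj.stalkIso' (reesGrading k d) w
      (((quotHom k d).stalkMap w).hom ((quotPresheaf k d).germ U w hw s)) = s.1.1 ⟨w, hw⟩ := by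
  have h1 : ((quotHom k d).stalkMap w).hom ((quotPresheaf k d).germ U w hw s) =
      (sheafY k d).presheaf.germ U w hw s.1 :=
    PresheafedSpace.stalkMap_germ_apply (quotHom k d) U w hw s
  rw [h1]
  exact Proj.stalkIso'_germ _ _ _ _ _

lemma stalkEmb_germ (U : Opens (ProjectiveSpectrum.top (reesGrading k d))) (hw : w ∈ U)
    (s : quotSections k d (op U)) :
    stalkEmb F c w ((quotPresheaf k d).germ U w hw s) = ratioMap F c w (s.1.1 ⟨w, hw⟩) :=
  congrArg (ratioMap F c w) (stalkIso_stalkMap_germ w U hw s)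

lemma stalkMap_quotHom_injective : Function.Injective ((quotHom k d).stalkMap w).hom := by
  rw [injective_iff_map_eq_zero]
  intro z hz
  obtain ⟨U, hU, s, rfl⟩ := (quotPresheaf k d).exists_germ_eq (x := w) z
  have h1 : ((quotHom k d).stalkMap w).hom ((quotPresheaf k d).germ U w hU s) =
      (sheafY k d).presheaf.germ U w hU s.1 :=
    PresheafedSpace.stalkMap_germ_apply (quotHom k d) U w hU s
  have h2 : (sheafY k d).presheaf.germ U w hU s.1 = (sheafY k d).presheaf.germ U w hU 0 := by
    rw [map_zero]; exact h1.symm.trans hz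
  obtain ⟨W, hW, i, j, h⟩ := (sheafY k d).presheaf.germ_eq w hU hU _ _ h2
  have h3 : (quotPresheaf k d).map i.op s = 0 := Subtype.ext (h.trans (map_zero _))
  exact ((quotPresheaf k d).germ_res_apply i w hW s).symm.trans ((congrArg _ h3).trans (map_zero _))

lemma stalkEmb_injective : Function.Injective (stalkEmb F c w) :=
  (ratioMap_injective F c w).comp
    ((Proj.stalkIso' (reesGrading k d) w).injective.comp (stalkMap_quotHom_injective w))

/-- Near w a section is a single fraction, and every generization v of w lies in the same
neighbourhood, so both germs are the same rational function. -/
lemma stalkEmb_stalkSpecializes {v w : ProjectiveSpectrum (reesGrading k d)} (h : v ⤳ w)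
    (o : (quotPresheaf k d).stalk w) :
    stalkEmb F c v (((quotPresheaf k d).stalkSpecializes h).hom o) = stalkEmb F c w o := by
  obtain ⟨U, hU, s, rfl⟩ := (quotPresheaf k d).exists_germ_eq (x := w) o
  have hv : v ∈ U := h.mem_open U.2 hU
  have h1 : ((quotPresheaf k d).stalkSpecializes h).hom ((quotPresheaf k d).germ U w hU s) =
      (quotPresheaf k d).germ U v hv s :=
    ConcreteCategory.congr_hom ((quotPresheaf k d).germ_stalkSpecializes hU h) s
  rw [h1]
  refine (stalkEmb_germ F c v U hv s).trans (Eq.trans ?_ (stalkEmb_germ F c w U hU s).symm)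
  obtain ⟨V, hV, i, m, a, b, hb, e⟩ := s.1.2 ⟨w, hU⟩
  have h2 := e ⟨w, hV⟩
  have h3 := e ⟨v, h.mem_open V.2 hV⟩
  exact (congrArg (ratioMap F c v) h3).trans (congrArg (ratioMap F c w) h2).symm

variable (hd : ∀ σ, d σ ≤ p - 1)

-- A homogeneous fraction defines a section wherever its denominator is nonzero. Being killed by ∂
-- depends only on the rational function, so it holds at all those points at once.
include hd in
lemma exists_stalkEmb_eq (z : AtPrime (reesGrading k d) w.asHomogeneousIdeal.toIdeal)
    (hz : fieldDel k F c (ratioMap F c w z) = 0) : ∃ o, stalkEmb F c w o = ratioMap F c w z := by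
  obtain ⟨a, rfl⟩ := mk_surjective z
  have hs : sectionInBasicOpen (reesGrading k d) w a ∈
      quotSections k d (op (ProjectiveSpectrum.basicOpen (reesGrading k d) (a.den : rees k d))) :=
    (mem_quotSections k d).2 fun y hy => (isConst_iff F c y hd _).2 hz
  exact ⟨(quotPresheaf k d).germ _ w (mem_basicOpen_den _ w a) ⟨_, hs⟩,
    stalkEmb_germ F c w _ (mem_basicOpen_den _ w a) ⟨_, hs⟩⟩

include hd in
lemma fieldDel_stalkEmb (o : (quotPresheaf k d).stalk w) :
    fieldDel k F c (stalkEmb F c w o) = 0 := by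
  obtain ⟨U, hU, s, rfl⟩ := (quotPresheaf k d).exists_germ_eq (x := w) o
  refine (congrArg (fieldDel k F c) (stalkEmb_germ F c w U hU s)).trans
    ((isConst_iff F c w hd _).1 ?_)
  exact (mem_quotSections k d).1 s.2 w hU

variable (k) in
lemma chartField_div_eq {m : ℕ} {P Q : rees k d} (hP : P ∈ reesGrading k d m)
    (hQ : Q ∈ reesGrading k d m) :
    chartField k F c (atOne k d P) / chartField k F c (atOne k d Q) =
      algebraMap (Coord k d) F (reesMap k c F P) / algebraMap (Coord k d) F (reesMap k c F Q) := by
  rw [chartField_apply, chartField_apply, ← reesMap_homogeneous F hP, ← reesMap_homogeneous F hQ,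
    map_mul, map_mul, map_pow, mul_div_mul_left _ _ (pow_ne_zero _ (chartEq_ne_zero F c))]

include hd in
/-- The image of the local ring in the function field of the chart. -/
lemma stalkEmb_range (x : F) : (∃ o, stalkEmb F c w o = x) ↔
    (∃ m, ∃ P ∈ reesGrading k d m, ∃ Q ∈ reesGrading k d m, Q ∉ w.asHomogeneousIdeal ∧
      x = algebraMap (Coord k d) F (reesMap k c F P) /
        algebraMap (Coord k d) F (reesMap k c F Q)) ∧ fieldDel k F c x = 0 := by
  constructor
  · rintro ⟨o, rfl⟩
    refine ⟨?_, fieldDel_stalkEmb F c w hd o⟩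
    obtain ⟨a, ha⟩ := mk_surjective
      (Proj.stalkIso' (reesGrading k d) w (((quotHom k d).stalkMap w).hom o))
    refine ⟨a.deg, a.num, a.num.2, a.den, a.den.2, a.den_mem, ?_⟩
    rw [← chartField_div_eq k F c a.num.2 a.den.2]
    exact (congrArg (ratioMap F c w) ha).symm
  · rintro ⟨⟨m, P, hP, Q, hQ, hQw, rfl⟩, h⟩
    rw [← chartField_div_eq k F c hP hQ] at h ⊢
    exact exists_stalkEmb_eq F c w hd (.mk ⟨m, ⟨P, hP⟩, ⟨Q, hQ⟩, hQw⟩) h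

/-- The nonunits of the local ring. -/
lemma mem_nonunits_stalk_iff {o : (quotPresheaf k d).stalk w} {m : ℕ} {P Q : rees k d}
    (hP : P ∈ reesGrading k d m) (hQ : Q ∈ reesGrading k d m) (hQw : Q ∉ w.asHomogeneousIdeal)
    (ho : stalkEmb F c w o = algebraMap (Coord k d) F (reesMap k c F P) /
        algebraMap (Coord k d) F (reesMap k c F Q)) :
    o ∈ nonunits ((quotPresheaf k d).stalk w) ↔ P ∈ w.asHomogeneousIdeal := by
  have h1 : Proj.stalkIso' (reesGrading k d) w (((quotHom k d).stalkMap w).hom o) =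
      .mk ⟨m, ⟨P, hP⟩, ⟨Q, hQ⟩, hQw⟩ := by
    refine ratioMap_injective F c w (Eq.trans ?_ ((chartField_div_eq k F c hP hQ).symm))
    exact ho
  have h2 : IsUnit o ↔ IsUnit (Proj.stalkIso' (reesGrading k d) w
      (((quotHom k d).stalkMap w).hom o)) :=
    ⟨fun h => (h.map ((quotHom k d).stalkMap w).hom).map (Proj.stalkIso' (reesGrading k d) w),
      fun h => (isLocalHom_quotHom k d w).map_nonunit o
        ((MulEquiv.isUnit_map (Proj.stalkIso' (reesGrading k d) w)).1 h)⟩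
  rw [mem_nonunits_iff, h2, h1]
  exact (not_congr (isUnit_mk_iff w _)).trans not_not

lemma stalkEmb_algebraMap (w : partialRes k d) (e : k) :
    stalkEmb F c w (algebraMap k ((partialRes k d).presheaf.stalk w) e) = algebraMap k F e := by
  have h := stalkEmb_germ F c w ⊤ trivial (scalarSection k d e)
  refine h.trans ?_
  have h1 : ratioMap F c w ((scalarSection k d e).1.1 ⟨w, trivial⟩) =
      chartField k F c (atOne k d (reesZero k d (MvPolynomial.C e))) /
        chartField k F c (atOne k d 1) := rfl
  rw [h1, map_one, map_one, div_one]
  have h2 : atOne k d (reesZero k d (MvPolynomial.C e)) = MvPolynomial.C e :=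
    atOne_reesMonomial 0 (MvPolynomial.C e) (by rw [weightIdeal_zero]; trivial)
  rw [h2]
  exact (chartField k F c).commutes e

/-- `stalkEmb` as an algebra homomorphism. -/
def stalkEmbₐ (w : partialRes k d) : (partialRes k d).presheaf.stalk w →ₐ[k] F where
  __ := (stalkEmb F c w : (partialRes k d).presheaf.stalk w →+* F)
  commutes' := stalkEmb_algebraMap F c w

end Stalk

end AlphaP
end

/-! ### Points of the blow-up in terms of the chart. -/

noncomputable section

namespace AlphaP

set_option linter.unusedSectionVars false

section ProjPoints

universe u

/-- On the affine open set where f ≠ 0, the degree zero fraction attached to f r is a power of r. -/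
lemma mem_toSpecZero_iff {A σ : Type u} [CommRing A] [SetLike σ A] [AddSubgroupClass σ A]
    (𝒜 : ℕ → σ) [GradedRing 𝒜] {m : ℕ} (hm : 0 < m) {f : A} (hf : f ∈ 𝒜 m) (y : Proj 𝒜)
    (hy : y ∈ Proj.basicOpen 𝒜 f) (r : 𝒜 0) :
    r ∈ (Proj.toSpecZero 𝒜 y).asIdeal ↔ y ∉ Proj.basicOpen 𝒜 (f * r) := by
  rw [← Proj.opensRange_awayι 𝒜 f hf hm] at hy
  obtain ⟨z, rfl⟩ := hy
  have h1 : Proj.toSpecZero 𝒜 (Proj.awayι 𝒜 f hf hm z) =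
      Spec.map (CommRingCat.ofHom (HomogeneousLocalization.fromZeroRingHom 𝒜 _)) z := by
    rw [← Scheme.Hom.comp_apply, Proj.awayι_toSpecZero]
  have hg : f * r ∈ 𝒜 m := by
    have := SetLike.mul_mem_graded hf r.2
    rwa [add_zero] at this
  have h2 := Proj.awayι_preimage_basicOpen 𝒜 hf hm hg hm
  have h3 : Proj.awayι 𝒜 f hf hm z ∈ Proj.basicOpen 𝒜 (f * r) ↔
      z ∈ PrimeSpectrum.basicOpen (HomogeneousLocalization.Away.isLocalizationElem hf hg) := by
    rw [← h2]; rfl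
  have h4 : HomogeneousLocalization.Away.isLocalizationElem hf hg =
      HomogeneousLocalization.fromZeroRingHom 𝒜 (Submonoid.powers f) r ^ m := by
    apply HomogeneousLocalization.val_injective
    rw [HomogeneousLocalization.val_pow]
    change Localization.mk _ _ = (Localization.mk _ _) ^ m
    rw [Localization.mk_pow, Localization.mk_eq_mk_iff, Localization.r_iff_exists]
    refine ⟨1, ?_⟩
    simp [mul_pow]
  rw [h1, h3]
  change _ ↔ ¬ ¬ (_ ∈ PrimeSpectrum.asIdeal z)
  rw [not_not, h4]
  exact ((PrimeSpectrum.isPrime z).pow_mem_iff_mem m hm).symm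

variable {p : ℕ} [hp : Fact p.Prime] {k : Type u} [Field k] [CharP k p] {l : ℕ} {d : Fin l → ℕ}
  {c : PosIdx d}

/-- The homogeneous coordinate with index `c`. -/
abbrev homogCoord (c : PosIdx d) : rees k d := reesVar c.1 (c.1.2 : ℕ) le_rfl

lemma homogCoord_mem (c : PosIdx d) : (homogCoord c : rees k d) ∈ reesGrading k d (c.1.2 : ℕ) :=
  reesMonomial_mem _ _ _

lemma mem_excDiv_iff (y : weightedBlowup k d)
    (hy : (homogCoord c : rees k d) ∉
      (show ProjectiveSpectrum (reesGrading k d) from y).asHomogeneousIdeal) :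
    y ∈ excDiv k d ↔ ∀ b : PosIdx d, (reesVar b.1 0 (Nat.zero_le _) : rees k d) ∈
      (show ProjectiveSpectrum (reesGrading k d) from y).asHomogeneousIdeal := by
  have h1 : y ∈ excDiv k d ↔ ∀ b : PosIdx d, reesZero k d (MvPolynomial.X b.1) ∈
      (Proj.toSpecZero (reesGrading k d) y).asIdeal := by
    change (Set.range fun c : PosIdx d => (MvPolynomial.X c.1 : Coord k d)) ⊆ _ ↔ _
    rw [Set.range_subset_iff]
    rfl
  rw [h1]
  refine forall_congr' fun b => ?_
  rw [mem_toSpecZero_iff (reesGrading k d) c.2 (homogCoord_mem c) y hy]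
  have := (show ProjectiveSpectrum (reesGrading k d) from y).isPrime
  change ¬ (¬ _) ↔ _
  rw [not_not]
  exact (this.mul_mem_iff_mem_or_mem).trans (or_iff_right hy)

variable (F : Type*) [Field F] [Algebra k F] [Algebra (Coord k d) F] [IsScalarTower k (Coord k d) F]
  [IsFractionRing (Coord k d) F]

variable (c) in
/-- The point of the blow-up given by a point of the chart. -/
def chartPoint (J : Ideal (Coord k d)) [hJ : J.IsPrime] : ProjectiveSpectrum (reesGrading k d) where
  asHomogeneousIdeal := (J.comap (reesMap k c F)).homogeneousCore (reesGrading k d)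
  isPrime := (hJ.comap (reesMap k c F)).homogeneousCore
  not_irrelevant_le h := by
    have h1 : (homogCoord c : rees k d) ∈ HomogeneousIdeal.irrelevant (reesGrading k d) := by
      rw [HomogeneousIdeal.mem_irrelevant_iff, GradedRing.proj_apply,
        DirectSum.decompose_of_mem_ne _ (homogCoord_mem c)]
      have := c.2
      omega
    have h2 := Ideal.toIdeal_homogeneousCore_le (reesGrading k d) _ (h h1)
    rw [Ideal.mem_comap, reesMap_reesVar_self] at h2
    exact hJ.ne_top ((Ideal.eq_top_iff_one _).2 h2)

lemma mem_chartPoint_iff {J : Ideal (Coord k d)} [J.IsPrime] {m : ℕ} {P : rees k d}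
    (hP : P ∈ reesGrading k d m) :
    P ∈ (chartPoint c F J).asHomogeneousIdeal ↔ reesMap k c F P ∈ J :=
  ⟨fun h => Ideal.toIdeal_homogeneousCore_le (reesGrading k d) _ h,
    fun h => Ideal.mem_homogeneousCore_of_homogeneous_of_mem ⟨m, hP⟩ h⟩

lemma homogCoord_notMem_chartPoint (J : Ideal (Coord k d)) [hJ : J.IsPrime] :
    (homogCoord c : rees k d) ∉ (chartPoint c F J).asHomogeneousIdeal := by
  rw [mem_chartPoint_iff F (homogCoord_mem c), reesMap_reesVar_self]
  exact fun h => hJ.ne_top ((Ideal.eq_top_iff_one _).2 h)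

lemma le_chartPoint {J : Ideal (Coord k d)} [J.IsPrime]
    {w : ProjectiveSpectrum (reesGrading k d)} (h : ∀ P ∈ w.asHomogeneousIdeal, reesMap k c F P ∈ J) : w ≤ chartPoint c F J :=
  (Ideal.homogeneousCore.gc (reesGrading k d) w.asHomogeneousIdeal (J.comap (reesMap k c F))).1 h

variable {ζ : kˣ} (hζ : IsPrimitiveRoot ζ (c.1.2 : ℕ)) (hi : ((c.1.2 : ℕ) : k) ≠ 0)

include hζ hi

/-- The coordinates of a closed point. -/
lemma exists_coordinates [IsAlgClosed k] {w : ProjectiveSpectrum (reesGrading k d)}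
    (hw : IsClosed ({w} : Set (ProjectiveSpectrum (reesGrading k d))))
    (hc : (homogCoord c : rees k d) ∉ w.asHomogeneousIdeal) :
    ∃ a : Idx d → k, ∀ m, ∀ P ∈ reesGrading k d m,
      (P ∈ w.asHomogeneousIdeal ↔ MvPolynomial.aeval a (reesMap k c F P) = 0) := by
  -- If 1 were attained on the ideal of w, it would be attained by a homogeneous element there,
  -- which by injectivity in each degree is a power of U_c; but U_c does not vanish at w.
  have h1 : Ideal.map (reesMap k c F) w.asHomogeneousIdeal.toIdeal ≠ ⊤ := by
    rw [Ne, Ideal.eq_top_iff_one, Ideal.mem_map_iff_of_surjective _ (reesMap_surjective F)]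
    rintro ⟨P, hP, hP1⟩
    obtain ⟨L, hL⟩ := exists_homogeneous_of_fixed F hζ hi w.asHomogeneousIdeal.isHomogeneous hP
      (by rw [hP1, map_one])
    obtain ⟨Q, hQ, hQm, hQ1⟩ := hL L le_rfl
    have h2 : Q = homogCoord c ^ L := by
      refine reesMap_inj (c := c) F hQm ?_ ?_
      · exact SetLike.pow_mem_graded L (homogCoord_mem c)
      · rw [hQ1, hP1, map_pow, reesMap_reesVar_self, one_pow]
    rw [h2] at hQ
    exact hc (w.isPrime.mem_of_pow_mem _ hQ)
  obtain ⟨M, hM, hle⟩ := Ideal.exists_le_maximal _ h1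
  obtain ⟨a, rfl⟩ := MvPolynomial.isMaximal_iff_eq_vanishingIdeal_singleton.1 hM
  have := hM.isPrime
  refine ⟨a, fun m P hP => ?_⟩
  -- The point of the chart specializes w, hence equals it because w is closed.
  have h2 : w ≤ chartPoint c F (MvPolynomial.vanishingIdeal k {a}) :=
    le_chartPoint F fun P hP => hle (Ideal.mem_map_of_mem _ hP)
  rw [ProjectiveSpectrum.le_iff_mem_closure, hw.closure_eq, Set.mem_singleton_iff] at h2
  rw [← h2, mem_chartPoint_iff F hP, MvPolynomial.mem_vanishingIdeal_singleton_iff]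

/-- A function vanishing along the exceptional divisor belongs to all its points. -/
lemma mem_of_chartEq_dvd {v : ProjectiveSpectrum (reesGrading k d)}
    (hc : (homogCoord c : rees k d) ∉ v.asHomogeneousIdeal)
    (hv : (reesVar c.1 0 (Nat.zero_le _) : rees k d) ∈ v.asHomogeneousIdeal) {m : ℕ} {P : rees k d}
    (hP : P ∈ reesGrading k d m) (hd : chartEq k c ∣ reesMap k c F P) :
    P ∈ v.asHomogeneousIdeal := by
  -- The element x_c t^(i-1), whose value is E, has i-th power x_c · U_c^(i-1), and x_c vanishes at
  -- v.
  have hT : (reesVar c.1 ((c.1.2 : ℕ) - 1) (Nat.sub_le _ _) : rees k d) ∈ v.asHomogeneousIdeal := by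
    refine v.isPrime.mem_of_pow_mem (c.1.2 : ℕ) ?_
    have h1 : (reesVar c.1 ((c.1.2 : ℕ) - 1) (Nat.sub_le _ _) : rees k d) ^ (c.1.2 : ℕ) =
        reesVar c.1 0 (Nat.zero_le _) * homogCoord c ^ ((c.1.2 : ℕ) - 1) := by
      refine reesMap_inj (c := c) F (SetLike.pow_mem_graded _ (reesMonomial_mem _ _ _)) (m :=
        (c.1.2 : ℕ) • ((c.1.2 : ℕ) - 1)) ?_ ?_
      · have h := SetLike.mul_mem_graded (reesMonomial_mem (k := k) (d := d) 0 (MvPolynomial.X c.1)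
          (X_mem_weightIdeal_of_le (Nat.zero_le _)))
          (SetLike.pow_mem_graded ((c.1.2 : ℕ) - 1) (homogCoord_mem (k := k) c))
        rwa [zero_add, smul_eq_mul, mul_comm] at h
      · rw [map_pow, map_mul, map_pow, reesMap_reesVar_pred, reesMap_reesVar_self, one_pow, mul_one,
          reesMap_reesVar, homogVar, if_pos rfl, one_mul, Nat.sub_zero]
    rw [h1]
    exact Ideal.mul_mem_right _ _ hv
  obtain ⟨b, hb⟩ := hd
  obtain ⟨B, rfl⟩ := reesMap_surjective (c := c) F b
  -- The value of P need not be invariant, but that of P^i is. So P^i, up to a power of U_c, is the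
  -- homogeneous lift and lies in the prime ideal.
  have hPi : reesMap k c F ((reesVar c.1 ((c.1.2 : ℕ) - 1) (Nat.sub_le _ _) * B) ^ (c.1.2 : ℕ)) =
      reesMap k c F (P ^ (c.1.2 : ℕ)) := by
    rw [map_pow, map_mul, reesMap_reesVar_pred, ← hb, map_pow]
  have hi0 := c.2
  have hmem := v.asHomogeneousIdeal.toIdeal.pow_mem_of_mem
    (Ideal.mul_mem_right B v.asHomogeneousIdeal.toIdeal hT) (c.1.2 : ℕ) hi0
  have hPm := SetLike.pow_mem_graded (c.1.2 : ℕ) hP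
  obtain ⟨L, hL⟩ := exists_homogeneous_of_fixed F hζ hi v.asHomogeneousIdeal.isHomogeneous hmem (by
    rw [hPi, chartRot_reesMap F hζ.pow_eq_one hPm, smul_eq_mul, pow_mul, inv_pow,
      ← Units.val_pow_eq_pow_val, hζ.pow_eq_one, Units.val_one, inv_one, one_pow, one_smul])
  obtain ⟨Q, hQ, hQm, hQP⟩ := hL (L + m) (Nat.le_add_right _ _)
  have h1 : Q = P ^ (c.1.2 : ℕ) * homogCoord c ^ L := by
    refine reesMap_inj (c := c) F hQm ?_ ?_
    · have h := SetLike.mul_mem_graded hPm (SetLike.pow_mem_graded L (homogCoord_mem (k := k) c))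
      rwa [smul_eq_mul, smul_eq_mul, mul_comm (c.1.2 : ℕ), ← add_mul, add_comm m] at h
    · rw [hQP, hPi, map_mul, map_pow _ _ L, reesMap_reesVar_self, one_pow, mul_one]
  rw [h1] at hQ
  rcases v.isPrime.mem_or_mem hQ with h | h
  · exact v.isPrime.mem_of_pow_mem _ h
  · exact absurd (v.isPrime.mem_of_pow_mem _ h) hc

end ProjPoints

end AlphaP
end

/-! ### The local structure of W at a closed point. -/

noncomputable section

namespace AlphaP

set_option linter.unusedSectionVars false

section LocalStructure

universe u

variable {p : ℕ} [hp : Fact p.Prime] {k : Type u} [Field k] [CharP k p] {l : ℕ} {d : Fin l → ℕ}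
  (hd : ∀ σ, d σ ≤ p - 1)
variable (F : Type*) [Field F] [Algebra k F] [Algebra (Coord k d) F] [IsScalarTower k (Coord k d) F]
  [IsFractionRing (Coord k d) F] [CharP F p] {c : PosIdx d} {ζ : kˣ}
  (hζ : IsPrimitiveRoot ζ (c.1.2 : ℕ)) {a : Idx d → k} (ha : a c.1 = 0) {v₀ : Idx d}
  (h₀ : MvPolynomial.aeval a (chartDer k c (MvPolynomial.X v₀)) ≠ 0)
  {w : ProjectiveSpectrum (reesGrading k d)}
  (hw : ∀ m, ∀ P ∈ reesGrading k d m,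
    (P ∈ w.asHomogeneousIdeal ↔ MvPolynomial.aeval a (reesMap k c F P) = 0))

lemma foliatedChart_Δ_eq_zero_iff (x : F) :
    (foliatedChart hd F c hζ.pow_eq_one a ha v₀ h₀).Δ x = 0 ↔ fieldDel k F c x = 0 := by
  change (algebraMap (Coord k d) F (chartDer k c (MvPolynomial.X v₀)))⁻¹ * fieldDer k F c x = 0 ↔
    algebraMap (Coord k d) F (chartEq k c) * fieldDer k F c x = 0
  rw [mul_eq_zero, mul_eq_zero, or_iff_right (chartEq_ne_zero F c),
    or_iff_right (inv_ne_zero (algebraMap_ne_zero_of_ev F (MvPolynomial.aeval a) h₀))]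

include hw

/-- The local ring of the quotient is the ring of invariant constants of the chart. -/
lemma mem_inv_iff_stalkEmb (x : F) :
    x ∈ (foliatedChart hd F c hζ.pow_eq_one a ha v₀ h₀).inv ↔ ∃ o, stalkEmb F c w o = x := by
  rw [stalkEmb_range F c w hd, FoliatedChart.mem_inv,
    foliatedChart_Δ_eq_zero_iff hd F hζ ha h₀]
  constructor
  · rintro ⟨⟨g, hg, b, hb⟩, hrot, hΔ⟩
    refine ⟨?_, hΔ⟩
    -- With an invariant denominator the numerator is invariant too. Both then lift to homogeneous
    -- elements, of the same degree once that degree is large.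
    obtain ⟨h, hh, hfix, ⟨b', hb'⟩⟩ :=
      (foliatedChart hd F c hζ.pow_eq_one a ha v₀ h₀).exists_fixed_denominator
        (V := LinearMap.range (Algebra.linearMap (Coord k d) F)) (by
          rintro _ ⟨f, rfl⟩
          exact ⟨_, (FoliatedChart.rotF_algebraMap _ f).symm⟩) hrot hg ⟨b, hb.symm⟩
    have hb' : algebraMap (Coord k d) F b' = algebraMap (Coord k d) F h * x := hb'
    have hbfix : chartRot c ζ b' = b' := by
      refine IsFractionRing.injective (Coord k d) F ?_
      rw [← fieldRot_algebraMap, hb', map_mul, fieldRot_algebraMap]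
      exact congrArg₂ (fun y z => algebraMap (Coord k d) F y * z) hfix hrot
    obtain ⟨P, rfl⟩ := reesMap_surjective (c := c) F b'
    obtain ⟨Q, rfl⟩ := reesMap_surjective (c := c) F h
    obtain ⟨L, hL⟩ := exists_homogeneous_of_fixed F hζ (idx_ne_zero hd c)
      (Ideal.IsHomogeneous.top (reesGrading k d)) (Submodule.mem_top (x := P)) hbfix
    obtain ⟨L', hL'⟩ := exists_homogeneous_of_fixed F hζ (idx_ne_zero hd c)
      (Ideal.IsHomogeneous.top (reesGrading k d)) (Submodule.mem_top (x := Q)) hfix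
    obtain ⟨P', -, hP', hPP⟩ := hL _ (le_max_left L L')
    obtain ⟨Q', -, hQ', hQQ⟩ := hL' _ (le_max_right L L')
    refine ⟨_, P', hP', Q', hQ', fun hm => hh ?_, ?_⟩
    · have := (hw _ Q' hQ').1 hm
      rwa [hQQ] at this
    · rw [hPP, hQQ, hb', mul_div_cancel_left₀]
      exact algebraMap_ne_zero_of_ev F (MvPolynomial.aeval a) hh
  · rintro ⟨⟨m, P, hP, Q, hQ, hQw, rfl⟩, hΔ⟩
    have hQ0 : MvPolynomial.aeval a (reesMap k c F Q) ≠ 0 := fun h => hQw ((hw m Q hQ).2 h)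
    have hQF := algebraMap_ne_zero_of_ev F (MvPolynomial.aeval a) hQ0
    refine ⟨⟨_, hQ0, _, mul_div_cancel₀ _ hQF⟩, ?_, hΔ⟩
    change fieldRot F c ζ _ = _
    have hz : algebraMap k F ((ζ : k)⁻¹ ^ m) ≠ 0 :=
      (map_ne_zero _).2 (pow_ne_zero _ (inv_ne_zero (Units.ne_zero ζ)))
    rw [map_div₀, fieldRot_algebraMap, fieldRot_algebraMap, chartRot_reesMap F hζ.pow_eq_one hP,
      chartRot_reesMap F hζ.pow_eq_one hQ, algebraMap_smul_eq, algebraMap_smul_eq, Algebra.smul_def,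
      Algebra.smul_def, mul_div_mul_left _ _ hz]

/-- The ideal of the exceptional divisor. -/
lemma mem_idealAt_iff (o : (partialRes k d).presheaf.stalk w) :
    o ∈ idealAt (partialRes k d) (excDivW k d) w ↔
      stalkEmb F c w o ∈ locIdeal F (foliatedChart hd F c hζ.pow_eq_one a ha v₀ h₀).ev
        (Ideal.span {(foliatedChart hd F c hζ.pow_eq_one a ha v₀ h₀).div}) := by
  obtain ⟨⟨m, P, hP, Q, hQ, hQw, hPQ⟩, -⟩ := (stalkEmb_range F c w hd _).1 ⟨o, rfl⟩
  have hQ0 : MvPolynomial.aeval a (reesMap k c F Q) ≠ 0 := fun h => hQw ((hw m Q hQ).2 h)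
  have hQF := algebraMap_ne_zero_of_ev F (MvPolynomial.aeval a) hQ0
  have hprime : Prime (chartEq k c) := MvPolynomial.X_prime
  have hev : MvPolynomial.aeval a (chartEq k c) = 0 := by rw [chartEq, MvPolynomial.aeval_X, ha]
  have h1 : stalkEmb F c w o ∈ locIdeal F (foliatedChart hd F c hζ.pow_eq_one a ha v₀ h₀).ev
        (Ideal.span {(foliatedChart hd F c hζ.pow_eq_one a ha v₀ h₀).div}) ↔
      chartEq k c ∣ reesMap k c F P := by
    rw [hPQ]
    constructor
    · rintro ⟨g, hg, b, hb, h⟩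
      obtain ⟨b', rfl⟩ := Ideal.mem_span_singleton'.1 hb
      have h2 : g * reesMap k c F P = (b' * chartEq k c) * reesMap k c F Q := by
        refine IsFractionRing.injective (Coord k d) F ?_
        rw [map_mul, map_mul, eq_comm]
        refine (congrArg (· * _) h).symm.trans ?_
        rw [mul_assoc, div_mul_cancel₀ _ hQF]
      refine (hprime.dvd_or_dvd ⟨b' * reesMap k c F Q, h2.trans (by ring)⟩).resolve_left ?_
      rintro ⟨g', rfl⟩
      refine hg ?_
      change MvPolynomial.aeval a (chartEq k c * g') = 0
      rw [map_mul, hev, zero_mul]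
    · rintro h
      exact ⟨reesMap k c F Q, hQ0, _, Ideal.mem_span_singleton.2 h, mul_div_cancel₀ _ hQF⟩
  have h2 : o ∈ idealAt (partialRes k d) (excDivW k d) w ↔
      ∀ v : ProjectiveSpectrum (reesGrading k d), v ⤳ w → v ∈ excDiv k d →
        P ∈ v.asHomogeneousIdeal := by
    simp only [idealAt, Submodule.mem_iInf]
    refine forall_congr' fun (v : ProjectiveSpectrum (reesGrading k d)) => forall_congr' fun h =>
      ?_
    have h3 : v ∈ excDivW k d ↔ v ∈ excDiv k d :=
      ⟨fun ⟨y, hy, hyv⟩ => (show y = v from hyv) ▸ hy, fun hy => ⟨v, hy, rfl⟩⟩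
    refine imp_congr h3 ?_
    have hQv : Q ∉ v.asHomogeneousIdeal := fun hQv => hQw
      (((ProjectiveSpectrum.le_iff_mem_closure _ v w).2 h.mem_closure) hQv)
    exact mem_nonunits_stalk_iff F c v hP hQ hQv
      ((stalkEmb_stalkSpecializes F c h o).trans hPQ)
  have hcw : (homogCoord c : rees k d) ∉ w.asHomogeneousIdeal := by
    rw [hw _ _ (homogCoord_mem c), reesMap_reesVar_self, map_one]
    exact one_ne_zero
  rw [h1, h2]
  constructor
  · intro h
    -- Vanishing along the exceptional divisor is tested at its generic point in the chart, the
    -- prime (E); the reverse implication is `mem_of_chartEq_dvd`.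
    have hJ : (Ideal.span {chartEq k c}).IsPrime :=
      (Ideal.span_singleton_prime hprime.ne_zero).2 hprime
    have hle : chartPoint c F (Ideal.span {chartEq k c}) ≤ w := by
      change Ideal.span _ ≤ w.asHomogeneousIdeal.toIdeal
      rw [Ideal.span_le]
      rintro _ ⟨⟨R, n, hR⟩, hRJ, rfl⟩
      refine (hw n R hR).2 ?_
      obtain ⟨b, hb⟩ := Ideal.mem_span_singleton.1 hRJ
      rw [hb, map_mul, hev, zero_mul]
    have h3 := h (chartPoint c F (Ideal.span {chartEq k c}))
      (specializes_iff_mem_closure.2 ((ProjectiveSpectrum.le_iff_mem_closure _ _ _).1 hle))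
      ((mem_excDiv_iff (c := c) _ (homogCoord_notMem_chartPoint F _)).2 fun b => by
        refine (mem_chartPoint_iff F (reesMonomial_mem _ _ _)).2 ?_
        have := b.2
        change reesMap k c F (reesVar b.1 0 (Nat.zero_le _)) ∈ _
        rw [reesMap_reesVar, Ideal.mem_span_singleton]
        exact (dvd_pow_self _ (by omega)).mul_left _)
    exact Ideal.mem_span_singleton.1 ((mem_chartPoint_iff F hP).1 h3)
  · intro h v hv hvE
    have hcv : (homogCoord c : rees k d) ∉ v.asHomogeneousIdeal := fun hcv =>
      hcw (((ProjectiveSpectrum.le_iff_mem_closure _ v w).2 hv.mem_closure) hcv)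
    exact mem_of_chartEq_dvd F hζ (idx_ne_zero hd c) hcv
      ((mem_excDiv_iff (c := c) v hcv).1 hvE c) hP h

omit hw

include hd F in
/-- The local structure of the quotient of the weighted blow-up at a closed point of a stratum. -/
theorem localStructure [IsAlgClosed k] {S : Finset (PosIdx d)} {w : partialRes k d}
    (hcl : IsClosed ({w} : Set (partialRes k d))) (hwS : w ∈ stratumW k d S) (hc : c ∈ S) :
    IsCyclicQuotient k ((partialRes k d).presheaf.stalk w)
        (idealAt (partialRes k d) (excDivW k d) w) (gcdIdx S) (weights p c) c.1 ∧
      (gcdIdx S = 1 → IsRegularLocalRing ((partialRes k d).presheaf.stalk w)) := by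
  have hi := idx_ne_zero (k := k) hd c
  have hne : NeZero ((c.1.2 : ℕ) : k) := ⟨hi⟩
  have hi0 : (c.1.2 : ℕ) ≠ 0 := by have := c.2; omega
  -- Primitive i-th roots of unity exist because k is algebraically closed and i is invertible in k.
  obtain ⟨ζ', hζ'⟩ := HasEnoughRootsOfUnity.exists_primitiveRoot k (c.1.2 : ℕ)
  obtain ⟨ζ, rfl⟩ := hζ'.isUnit hi0
  have hζ : IsPrimitiveRoot ζ (c.1.2 : ℕ) := IsPrimitiveRoot.coe_units_iff.1 hζ'
  obtain ⟨⟨hyE, hyS⟩, hyS'⟩ : (show weightedBlowup k d from w) ∈ stratumY k d S := by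
    obtain ⟨y, hy, hyw⟩ := hwS
    exact (show y = w from hyw) ▸ hy
  have hcoord : ∀ b : PosIdx d, (homogCoord b : rees k d) ∈
      (show ProjectiveSpectrum (reesGrading k d) from w).asHomogeneousIdeal ↔ b ∉ S := by
    intro b
    constructor
    · intro hb hbS
      exact hyS' (Set.mem_biUnion hbS ⟨hyE, hb⟩)
    · intro hbS
      exact (Set.mem_iInter₂.1 hyS b hbS).2
  have hcy := fun h => (hcoord c).1 h hc
  obtain ⟨a, haw⟩ := exists_coordinates F hζ hi
    (w := (show ProjectiveSpectrum (reesGrading k d) from w)) hcl hcy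
  -- On the exceptional divisor x_c vanishes, and its value on the chart is E^i.
  have ha : a c.1 = 0 := by
    have h1 := (haw _ _ (reesMonomial_mem _ _ _)).1 ((mem_excDiv_iff (c := c) w hcy).1 hyE c)
    change MvPolynomial.aeval a (reesMap k c F (reesVar c.1 0 (Nat.zero_le _))) = 0 at h1
    rw [reesMap_reesVar, homogVar, if_pos rfl, one_mul, Nat.sub_zero, map_pow, chartEq,
      MvPolynomial.aeval_X] at h1
    exact pow_eq_zero_iff hi0 |>.1 h1
  have haS : ∀ v : PosIdx d, v ≠ c → (a v.1 ≠ 0 ↔ v ∈ S) := by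
    intro v hv
    have h1 := haw _ _ (homogCoord_mem v)
    rw [hcoord, reesMap_reesVar, Nat.sub_self, pow_zero, mul_one, homogVar,
      if_neg fun h => hv (Subtype.ext h), MvPolynomial.aeval_X] at h1
    exact (not_congr h1.symm).trans not_not
  obtain ⟨v₀, hv₀, h₀⟩ := exists_chartDer_ne_zero hd c a
  have hg : NeZero (gcdIdx S) := ⟨(gcdIdx_pos hc).ne'⟩
  have H := chartCoord_constCoords hd F hζ ha hc haS h₀
  obtain ⟨q, hq, hpar⟩ := exists_parameters hd F hζ ha h₀
  have hψ : ∀ x, x ∈ (foliatedChart hd F c hζ.pow_eq_one a ha v₀ h₀).inv ↔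
      ∃ o, stalkEmbₐ F c w o = x := mem_inv_iff_stalkEmb hd F hζ ha h₀ haw
  have hinj : Function.Injective (stalkEmbₐ F c w) := stalkEmb_injective F c w
  choose o ho using fun v => (hψ _).1 (hq v).1
  have hmax : ∀ v, o v ∈ IsLocalRing.maximalIdeal ((partialRes k d).presheaf.stalk w) := fun v => by
    rw [FoliatedChart.mem_maximalIdeal_iff _ _ hψ hinj, ho]
    exact (hq v).2
  have hpar' : IsParameters (foliatedChart hd F c hζ.pow_eq_one a ha v₀ h₀).ev
      (Set.range fun v => stalkEmbₐ F c w (o v)) := by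
    rwa [show (fun v => stalkEmbₐ F c w (o v)) = q from funext ho]
  have : Infinite k := IsAlgClosed.instInfinite
  refine ⟨H.isCyclicQuotient _ hψ H hinj o hmax hpar' c.1
    (exists_chartCoord_eq hd F hζ.pow_eq_one ha h₀ hv₀) _
    (mem_idealAt_iff hd F hζ ha h₀ haw), fun h1 => ?_⟩
  refine H.isRegularLocalRing _ hψ (fun v => ?_) hinj o hmax hpar'
  have : Subsingleton (ZMod (gcdIdx S)) := by rw [h1]; infer_instance
  exact Subsingleton.elim _ _

end LocalStructure

end AlphaP
end

theorem mainTheorem6 {p : ℕ} [Fact p.Prime] {k : Type*} [Field k] [IsAlgClosed k] [CharP k p]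
    {l : ℕ} (d : Fin l → ℕ) (hd : ∀ σ, d σ ≤ p - 1)
    (hD : 2 ≤ ∑ σ, (d σ * (d σ + 1) / 2))
    (S : Finset (AlphaP.PosIdx d)) (hS : S.Nonempty)
    (w : AlphaP.partialRes k d) (hw : IsClosed {w}) (hwS : w ∈ AlphaP.stratumW k d S) :
    (AlphaP.gcdIdx S = 1 →
      IsRegularLocalRing ((AlphaP.partialRes k d).presheaf.stalk w)) ∧
    (AlphaP.gcdIdx S ≠ 1 →
      ¬ p ∣ AlphaP.gcdIdx S ∧
      ∀ c ∈ S,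
        AlphaP.IsCyclicQuotient k ((AlphaP.partialRes k d).presheaf.stalk w)
          (AlphaP.idealAt (AlphaP.partialRes k d) (AlphaP.excDivW k d) w)
          (AlphaP.gcdIdx S) (AlphaP.weights p c) c.1) := by
  have : CharP (FractionRing (AlphaP.Coord k d)) p :=
    charP_of_injective_algebraMap
      (algebraMap k (FractionRing (AlphaP.Coord k d))).injective p
  have key := fun (c : AlphaP.PosIdx d) (hc : c ∈ S) =>
    AlphaP.localStructure hd (FractionRing (AlphaP.Coord k d)) hw hwS hc
  obtain ⟨c, hc⟩ := hS
  refine ⟨(key c hc).2, fun _ => ⟨fun hp => ?_, fun c hc => (key c hc).1⟩⟩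
  -- The gcd divides the positive index i < p, so p cannot divide it.
  have h1 : p ∣ (c.1.2 : ℕ) := hp.trans (Finset.gcd_dvd hc)
  exact absurd (Nat.le_of_dvd c.2 h1) (not_le.2 (AlphaP.idx_lt hd c.1))
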